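/- Let $1\le d\le\sqrt2$ and let $L\subset\mathbb R^3$ be the union of a string of closed unit balls whose centres are the points $(0,0,c+2dk)$, $k\in\mathbb Z$, for some $c\in\mathbb R$. A packing of translates of $L$ is a family $\{L+t : t\in T\}$, $T\subset\mathbb R^3$, whose distinct members have disjoint interiors. The upper density of a set $U\subset\mathbb R^3$ is $\limsup_{R\to\infty}\operatorname{vol}(U\cap B(0,R))/\operatorname{vol}(B(0,R))$, and $U$ has density $\delta$ if the limit exists and equals $\delta$; the (upper) density of a packing is that of the union of its members. A point lattice is a translate of a discrete subgroup of $\mathbb R^3$ (possibly not of full rank); a lattice packing of translates of $L$ is a packing $\{L+\lambda:\lambda\in\Lambda\}$ with $\Lambda$ a point lattice; and the point lattice generated by a set $S$ of points is $S$ plus the group generated by the differences of the points of $S$. Then: 1. Every packing of translates of $L$ has upper density at most $\dfrac{\pi}{3d\sqrt{3-d^2}}$. 2. There exists a tetrahedron with one edge of length $2d$, parallel to the $z$-axis, and five edges of length $2$. For every such tetrahedron, the point lattice $\Lambda_0$ generated by its vertices yields a lattice packing $\{L+\lambda:\lambda\in\Lambda_0\}$ of translates of $L$, and this packing has density exactly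 $\dfrac{\pi}{3d\sqrt{3-d^2}}$. 3. $\Lambda_0$ is the unique densest lattice, up to congruence: if a lattice packing $\{L+\lambda:\lambda\in\Lambda\}$ of translates of $L$ has upper density $\dfrac{\pi}{3d\sqrt{3-d^2}}$, then the set $\{\lambda+(0,0,c+2dk):\lambda\in\Lambda,\ k\in\mathbb Z\}$ of all its ball centres is the image of $\Lambda_0$ under an isometry of $\mathbb R^3$ whose linear part fixes $(0,0,1)$. 4. For all points $A,B\in\mathbb R^3$, the point lattices generated by the vertices of a tetrahedron with edge $AB$ of length $2d$ and its five other edges of length $2$ are exactly the point lattices generated by the vertices of a rectangular right pyramid with base edge $AB$ of length $2d$, adjacent base edge of length $2$, and all lateral edges of length $2$. -/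

import Mathlib

open scoped Pointwise

/-- Euclidean three-space. -/
abbrev E3 : Type := EuclideanSpace ℝ (Fin 3)

noncomputable section

/-- The unit vector `(0, 0, 1)`. -/
def zAxis : E3 := EuclideanSpace.single 2 1

/-- The centres `(0, 0, c + 2dk)`, `k ∈ ℤ`, of a string on the `z`-axis with spacing `2d`. -/
def stringCentres (c d : ℝ) : Set E3 := Set.range fun k : ℤ => (c + 2 * d * k) • zAxis

/-- The union of the closed unit balls whose centres are equally spaced, at distance `2d`,
on the `z`-axis. -/
def ballString (c d : ℝ) : Set E3 := ⋃ p ∈ stringCentres c d, Metric.closedBall p 1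

/-- The family `{t + L | t ∈ T}` of translates of `L`. -/
def translates (L T : Set E3) : Set (Set E3) := (fun t : E3 => t +ᵥ L) '' T

/-- A family of sets is a packing if different members have disjoint interiors. -/
def IsPacking (F : Set (Set E3)) : Prop := F.PairwiseDisjoint interior

/-- The portion of the ball of radius `R` about the origin that is covered by `U`. -/
def coveredPortion (U : Set E3) (R : ℝ) : ENNReal :=
  MeasureTheory.volume (U ∩ Metric.closedBall 0 R) /
    MeasureTheory.volume (Metric.closedBall (0 : E3) R)

/-- The upper density of `U`. -/
def upperDensity (U : Set E3) : ENNReal := Filter.limsup (coveredPortion U) Filter.atTop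

/-- `U` has a density (as a limit), and it is equal to `δ`. -/
def HasDensity (U : Set E3) (δ : ENNReal) : Prop :=
  Filter.Tendsto (coveredPortion U) Filter.atTop (nhds δ)

/-- A point lattice: a translate of a discrete subgroup, possibly not of full rank. -/
def IsPointLattice (Λ : Set E3) : Prop :=
  ∃ (G : AddSubgroup E3) (a : E3), DiscreteTopology G ∧ Λ = a +ᵥ (G : Set E3)

/-- `{λ + L | λ ∈ Λ}` is a lattice packing of translates of `L`. -/
def IsLatticePacking (L Λ : Set E3) : Prop := IsPointLattice Λ ∧ IsPacking (translates L Λ)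

/-- The point lattice generated by the points of `S`: all `a + v` with `a ∈ S` and `v` in the
group generated by the differences of points of `S`. -/
def latticeGeneratedBy (S : Set E3) : Set E3 :=
  S + (AddSubgroup.closure (S - S) : Set E3)

/-- `ABCE` is a tetrahedron whose edge `AB` has length `2d` and whose five other edges have
length `2` (for `0 < d < √3` such four points are never coplanar). -/
def IsTetrahedron (d : ℝ) (A B C E : E3) : Prop :=
  dist A B = 2 * d ∧ dist A C = 2 ∧ dist A E = 2 ∧ dist B C = 2 ∧ dist B E = 2 ∧ dist C E = 2

/-- `PQRS` is a rectangle with `|PQ| = 2d` and `|QR| = 2`, and `X` is the apex of a pyramid over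
it all of whose lateral edges have length `2` (hence a right pyramid). -/
def IsRectPyramid (d : ℝ) (P Q R S X : E3) : Prop :=
  R - Q = S - P ∧ inner ℝ (Q - P) (S - P) = 0 ∧ dist P Q = 2 * d ∧ dist Q R = 2 ∧
    dist X P = 2 ∧ dist X Q = 2 ∧ dist X R = 2 ∧ dist X S = 2

end

/-! Project along the strings. Shifting along a string by multiples of 2d brings the heights of two
centres within d of each other, so different projected strings are at distance at least √(4 − d²),
written below as √2·r. With A = √(3 − d²), the bound says that every point of the projected set S
can be given plane area 2A: a ball then occupies volume 2A·2d, and (4π/3)/(4dA) is the asserted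
density.

The area comes from Heron's formula. Going round a triangle of three strings, the height differences
reduced modulo 2d lie in [−d, d] and add up to 0 or ±2d. For a non-obtuse triangle this forces area
at least A, with equality only for sides 2, √(4 − d²), √(4 − d²) (`heron_bound`).

No triangulation is needed. Call a triangle small if the discs of radius r about its vertices meet.
Its sides lie between √2·r and 2r, so it is non-obtuse. Small triangles do not overlap
(`vertices_eq_of_mem_openTriangle`), and each is shared among its vertices in proportion to their
angles. In the remaining directions a point p keeps its Voronoi cell, truncated to the disc of
radius r. There the bisectors of the neighbours cut into the disc in disjoint wedges, and half a
wedge of angle θ ≤ π/4 leaves a right triangle of area r² sin 2θ / 4 ≥ r²θ/π (`volume_restCell_ge`).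
Since A ≤ r², every direction at p yields at least A/π per radian, in total 2A
(`exists_area_distribution`).

The tetrahedron's lattice attains the bound: its nonzero vectors have length at least 2
(`IsFrame.two_le_norm`), and it has a prism of volume 4dA as fundamental domain.

For uniqueness, adjoin the vertical period to the lattice. If the projection lies in a line, the
density is too small. Otherwise a Gauss-reduced basis gives a non-obtuse triangle of area at most A,
and the equality case of `heron_bound` determines the lattice up to isometry.

Tetrahedron and pyramid give the same lattices because the translation by E − C carries AB to the
opposite base edge. -/

namespace StringPacking

open MeasureTheory

/-! ### Plane geometry of small triangles -/

/-- The determinant of two plane vectors. -/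
def cross (u v : ℂ) : ℝ := u.re * v.im - u.im * v.re

/-- The scalar product of two plane vectors. -/
def dot (u v : ℂ) : ℝ := u.re * v.re + u.im * v.im

/-- The open cone spanned by `u` and `v`, provided that `0 < cross u v`. -/
def openCone (u v : ℂ) : Set ℂ := {x | 0 < cross u x ∧ 0 < cross x v}

/-- The interior of the positively oriented triangle `p a b`. -/
def openTriangle (p a b : ℂ) : Set ℂ :=
  {x | 0 < cross (a - p) (x - p) ∧ 0 < cross (b - a) (x - a) ∧ 0 < cross (p - b) (x - b)}

/-- `p a b` is positively oriented and the open discs of radius `r` about its vertices have a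
common point. -/
def IsSmall (r : ℝ) (p a b : ℂ) : Prop :=
  0 < cross (a - p) (b - p) ∧ ∃ y : ℂ, Complex.normSq (p - y) < r ^ 2 ∧
    Complex.normSq (a - y) < r ^ 2 ∧ Complex.normSq (b - y) < r ^ 2

/-- Different points of `S` have distance at least `√2 * r`. -/
def Separated (r : ℝ) (S : Set ℂ) : Prop :=
  ∀ p ∈ S, ∀ q ∈ S, p ≠ q → 2 * r ^ 2 ≤ Complex.normSq (p - q)

lemma continuous_cross_left (u : ℂ) : Continuous fun x => cross u x := by
  unfold cross; fun_prop

lemma continuous_cross_right (u : ℂ) : Continuous fun x => cross x u := by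
  unfold cross; fun_prop

lemma isOpen_openCone (u v : ℂ) : IsOpen (openCone u v) :=
  (isOpen_lt continuous_const (continuous_cross_left u)).inter
    (isOpen_lt continuous_const (continuous_cross_right v))

lemma isOpen_openTriangle (p a b : ℂ) : IsOpen (openTriangle p a b) := by
  have h : ∀ u v : ℂ, IsOpen {x | 0 < cross u (x - v)} := fun u v =>
    isOpen_lt continuous_const ((continuous_cross_left u).comp (continuous_id.sub continuous_const))
  exact (h _ _).inter ((h _ _).inter (h _ _))

lemma openTriangle_rotate (p a b : ℂ) : openTriangle p a b = openTriangle a b p := by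
  ext x; simp only [openTriangle, Set.mem_ofPred_eq]; tauto

lemma IsSmall.rotate {r : ℝ} {p a b : ℂ} (h : IsSmall r p a b) : IsSmall r a b p := by
  obtain ⟨h, y, hp, ha, hb⟩ := h
  refine ⟨?_, y, ha, hb, hp⟩
  simp only [cross, Complex.sub_re, Complex.sub_im] at h ⊢
  linarith

lemma sub_mem_openCone_of_mem_openTriangle {p a b x : ℂ} (h : x ∈ openTriangle p a b) :
    x - p ∈ openCone (a - p) (b - p) := by
  obtain ⟨h1, -, h3⟩ := h
  refine ⟨h1, ?_⟩
  simp only [cross, Complex.sub_re, Complex.sub_im] at h3 ⊢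
  linarith

/-- For a positively oriented pair, the three cones are the angles of the triangle 0, u, v moved to
the origin; going round, they alternate with their opposites. -/
lemma neg_openCone_disjoint {u v : ℂ} :
    Disjoint (openCone u v ∪ openCone (v - u) (-u) ∪ openCone (-v) (u - v))
      (-(openCone u v ∪ openCone (v - u) (-u) ∪ openCone (-v) (u - v))) := by
  rw [Set.disjoint_left]
  intro x hx hx'
  simp only [openCone, Set.mem_union, Set.mem_ofPred_eq, Set.mem_neg, cross, Complex.sub_re,
    Complex.sub_im, Complex.neg_re, Complex.neg_im] at hx hx'
  rcases hx with (⟨h1, h2⟩ | ⟨h1, h2⟩) | ⟨h1, h2⟩ <;>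
    rcases hx' with (⟨h3, h4⟩ | ⟨h3, h4⟩) | ⟨h3, h4⟩ <;> nlinarith

/-- Half the angle between `u` and `v`, as the area of a circular sector. -/
noncomputable def sectorArea (u v : ℂ) : ENNReal := volume (openCone u v ∩ Metric.ball 0 1)

lemma volume_unit_disc : volume (Metric.ball (0 : ℂ) 1) = ENNReal.ofReal Real.pi := by
  rw [Complex.volume_ball]
  rw [ENNReal.ofReal_one, one_pow, one_mul, ENNReal.ofReal,
    Real.toNNReal_of_nonneg Real.pi_pos.le]
  rfl

/-- The angles of a triangle add up to at most `π`. -/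
lemma sectorArea_add_le (u v : ℂ) :
    2 * (sectorArea u v + sectorArea (v - u) (-u) + sectorArea (-v) (u - v)) ≤
      ENNReal.ofReal Real.pi := by
  set U := openCone u v ∪ openCone (v - u) (-u) ∪ openCone (-v) (u - v) with hU
  have hUm : MeasurableSet U := (((isOpen_openCone _ _).union (isOpen_openCone _ _)).union
    (isOpen_openCone _ _)).measurableSet
  have hB : MeasurableSet (Metric.ball (0 : ℂ) 1) := Metric.isOpen_ball.measurableSet
  have h1 : sectorArea u v + sectorArea (v - u) (-u) + sectorArea (-v) (u - v)
      = volume (U ∩ Metric.ball 0 1) := by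
    rw [hU, Set.union_inter_distrib_right, Set.union_inter_distrib_right, measure_union,
      measure_union]
    · rfl
    · rw [Set.disjoint_left]
      rintro x ⟨⟨h1, h2⟩, -⟩ ⟨⟨h3, h4⟩, -⟩
      simp only [cross, Complex.sub_re,
        Complex.sub_im, Complex.neg_re, Complex.neg_im] at h1 h2 h3 h4
      nlinarith
    · exact (isOpen_openCone _ _).measurableSet.inter hB
    · rw [Set.disjoint_left]
      rintro x (⟨⟨h1, h2⟩, -⟩ | ⟨⟨h1, h2⟩, -⟩) ⟨⟨h3, h4⟩, -⟩ <;>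
      simp only [cross, Complex.sub_re,
        Complex.sub_im, Complex.neg_re, Complex.neg_im] at h1 h2 h3 h4 <;>
      nlinarith
    · exact (isOpen_openCone _ _).measurableSet.inter hB
  have h2 : volume (-U ∩ Metric.ball 0 1) = volume (U ∩ Metric.ball 0 1) := by
    have : -U ∩ Metric.ball 0 1 = -(U ∩ Metric.ball (0 : ℂ) 1) := by
      rw [Set.inter_neg, neg_ball, neg_zero]
    rw [this, Measure.measure_neg]
  have h3 : volume ((U ∩ Metric.ball 0 1) ∪ (-U ∩ Metric.ball 0 1)) ≤
      ENNReal.ofReal Real.pi := by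
    calc _ ≤ volume (Metric.ball (0 : ℂ) 1) :=
          measure_mono (Set.union_subset Set.inter_subset_right Set.inter_subset_right)
      _ = ENNReal.ofReal Real.pi := by
          exact volume_unit_disc
  rw [measure_union _ (hUm.neg.inter hB), h2] at h3
  · rw [h1, two_mul]; exact h3
  · exact neg_openCone_disjoint.mono Set.inter_subset_left Set.inter_subset_left

/-! ### Small triangles do not overlap -/

/-- Two systems of weights on a separated set which have the same barycentre and are both
supported in open discs of radius `r` are equal. -/
lemma weights_unique {r : ℝ} {S : Set ℂ} (hS : Separated r S)
    {W : Finset ℂ} (hW : ↑W ⊆ S) {f g : ℂ → ℝ} (hf0 : ∀ v ∈ W, 0 ≤ f v) (hg0 : ∀ v ∈ W, 0 ≤ g v)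
    (h0 : ∑ v ∈ W, f v = ∑ v ∈ W, g v)
    (hre : ∑ v ∈ W, f v * v.re = ∑ v ∈ W, g v * v.re)
    (him : ∑ v ∈ W, f v * v.im = ∑ v ∈ W, g v * v.im)
    {y z : ℂ} (hy : ∀ v ∈ W, f v ≠ 0 → Complex.normSq (v - y) < r ^ 2)
    (hz : ∀ v ∈ W, g v ≠ 0 → Complex.normSq (v - z) < r ^ 2) :
    ∀ v ∈ W, f v = g v := by
  -- After the common weight is cancelled, P and N have disjoint supports, but still equal mass M
  -- and equal moments X, Y, and they stay inside the two discs.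
  set P : ℂ → ℝ := fun v => max (f v - g v) 0 with hP
  set N : ℂ → ℝ := fun v => max (g v - f v) 0 with hN
  have hPN : ∀ v, P v - N v = f v - g v := by
    intro v
    rcases le_total (f v) (g v) with h | h
    · simp [hP, hN, max_eq_right (sub_nonpos.2 h), max_eq_left (sub_nonneg.2 h)]
    · simp [hP, hN, max_eq_right (sub_nonpos.2 h), max_eq_left (sub_nonneg.2 h)]
  have hP0 : ∀ v, 0 ≤ P v := fun v => le_max_right _ _
  have hN0 : ∀ v, 0 ≤ N v := fun v => le_max_right _ _
  have hmul : ∀ v, P v * N v = 0 := by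
    intro v
    rcases le_total (f v) (g v) with h | h
    · simp [hP, max_eq_right (sub_nonpos.2 h)]
    · simp [hN, max_eq_right (sub_nonpos.2 h)]
  have hPy : ∀ v ∈ W, P v ≠ 0 → Complex.normSq (v - y) < r ^ 2 := by
    intro v hv h
    refine hy v hv fun h' => h ?_
    simp only [hP, h', max_eq_right_iff]
    linarith [hg0 v hv]
  have hNz : ∀ v ∈ W, N v ≠ 0 → Complex.normSq (v - z) < r ^ 2 := by
    intro v hv h
    refine hz v hv fun h' => h ?_
    simp only [hN, h', max_eq_right_iff]
    linarith [hf0 v hv]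
  set M := ∑ v ∈ W, P v with hM
  have hMN : ∑ v ∈ W, N v = M := by
    have : ∑ v ∈ W, (P v - N v) = 0 := by
      simp only [hPN, Finset.sum_sub_distrib, h0, sub_self]
    rw [Finset.sum_sub_distrib] at this; linarith
  set X := ∑ v ∈ W, P v * v.re with hX
  have hXN : ∑ v ∈ W, N v * v.re = X := by
    have : ∑ v ∈ W, (P v - N v) * v.re = 0 := by
      simp only [hPN, sub_mul, Finset.sum_sub_distrib, hre, sub_self]
    simp only [sub_mul, Finset.sum_sub_distrib] at this; linarith
  set Y := ∑ v ∈ W, P v * v.im with hY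
  have hYN : ∑ v ∈ W, N v * v.im = Y := by
    have : ∑ v ∈ W, (P v - N v) * v.im = 0 := by
      simp only [hPN, sub_mul, Finset.sum_sub_distrib, him, sub_self]
    simp only [sub_mul, Finset.sum_sub_distrib] at this; linarith
  have hM0 : 0 ≤ M := Finset.sum_nonneg fun v _ => hP0 v
  rcases hM0.eq_or_lt with hM0 | hM0
  · intro v hv
    have h1 := (Finset.sum_eq_zero_iff_of_nonneg fun v _ => hP0 v).1 hM0.symm v hv
    have h2 := (Finset.sum_eq_zero_iff_of_nonneg fun v _ => hN0 v).1 (hMN.trans hM0.symm) v hv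
    linarith [hPN v]
  exfalso
  set QP := ∑ v ∈ W, P v * Complex.normSq v with hQP
  set QN := ∑ v ∈ W, N v * Complex.normSq v with hQN
  have key : ∀ (c : ℂ) (H : ℂ → ℝ), (∀ v, 0 ≤ H v) →
      (∀ v ∈ W, H v ≠ 0 → Complex.normSq (v - c) < r ^ 2) → ∑ v ∈ W, H v = M →
      ∑ v ∈ W, H v * Complex.normSq v - 2 * c.re * (∑ v ∈ W, H v * v.re)
        - 2 * c.im * (∑ v ∈ W, H v * v.im) + Complex.normSq c * M < r ^ 2 * M := by
    intro c H hH hc hHM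
    have e : ∑ v ∈ W, H v * Complex.normSq (v - c) =
        ∑ v ∈ W, H v * Complex.normSq v - 2 * c.re * (∑ v ∈ W, H v * v.re)
        - 2 * c.im * (∑ v ∈ W, H v * v.im) + Complex.normSq c * M := by
      rw [← hHM, Finset.mul_sum, Finset.mul_sum, Finset.mul_sum, ← Finset.sum_sub_distrib,
        ← Finset.sum_sub_distrib, ← Finset.sum_add_distrib]
      refine Finset.sum_congr rfl fun v _ => ?_
      simp only [Complex.normSq_apply, Complex.sub_re, Complex.sub_im]; ring
    rw [← e, ← hHM, Finset.mul_sum]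
    obtain ⟨v, hv, hne⟩ : ∃ v ∈ W, H v ≠ 0 := by
      by_contra! h
      rw [Finset.sum_eq_zero h] at hHM
      exact hM0.ne hHM
    refine Finset.sum_lt_sum (fun v hv => ?_) ⟨v, hv, ?_⟩
    · by_cases h : H v = 0
      · simp [h]
      · nlinarith [hc v hv h, hH v]
    · nlinarith [hc v hv hne, lt_of_le_of_ne (hH v) (Ne.symm hne)]
  have k1 := key y P hP0 hPy rfl
  have k2 := key z N hN0 hNz hMN
  rw [hXN, hYN] at k2
  -- Only pairs of different points contribute, so the double sum is at least 2r²M². On the other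
  -- hand it is the sum of M·QP − X² − Y² and M·QN − X² − Y², each less than r²M², because a second
  -- moment is least about the barycentre.
  have e : ∑ u ∈ W, ∑ v ∈ W, P u * N v * Complex.normSq (u - v) =
      M * QP + M * QN - 2 * (X ^ 2 + Y ^ 2) := by
    have h1 : M * QP = ∑ u ∈ W, ∑ v ∈ W, N v * (P u * Complex.normSq u) := by
      rw [← hMN, hQP, Finset.sum_mul_sum, Finset.sum_comm]
    have h2 : M * QN = ∑ u ∈ W, ∑ v ∈ W, P u * (N v * Complex.normSq v) := by
      rw [hM, hQN, Finset.sum_mul_sum]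
    have h3 : X ^ 2 = ∑ u ∈ W, ∑ v ∈ W, (P u * u.re) * (N v * v.re) := by
      rw [← Finset.sum_mul_sum, hXN, sq]
    have h4 : Y ^ 2 = ∑ u ∈ W, ∑ v ∈ W, (P u * u.im) * (N v * v.im) := by
      rw [← Finset.sum_mul_sum, hYN, sq]
    rw [h1, h2, h3, h4, ← Finset.sum_add_distrib, ← Finset.sum_add_distrib, Finset.mul_sum,
      ← Finset.sum_sub_distrib]
    refine Finset.sum_congr rfl fun u _ => ?_
    rw [← Finset.sum_add_distrib, ← Finset.sum_add_distrib, Finset.mul_sum,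
      ← Finset.sum_sub_distrib]
    refine Finset.sum_congr rfl fun v _ => ?_
    simp only [Complex.normSq_apply, Complex.sub_re, Complex.sub_im]; ring
  have l : 2 * r ^ 2 * (M * M) ≤ ∑ u ∈ W, ∑ v ∈ W, P u * N v * Complex.normSq (u - v) := by
    nth_rewrite 2 [← hMN]
    rw [hM, Finset.sum_mul_sum, Finset.mul_sum]
    refine Finset.sum_le_sum fun u hu => ?_
    rw [Finset.mul_sum]
    refine Finset.sum_le_sum fun v hv => ?_
    by_cases huv : u = v
    · subst huv; simp [hmul]
    · nlinarith [hS u (hW hu) v (hW hv) huv, mul_nonneg (hP0 u) (hN0 v)]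
  rw [e] at l
  rw [Complex.normSq_apply] at k1 k2
  nlinarith [mul_lt_mul_of_pos_left k1 hM0, mul_lt_mul_of_pos_left k2 hM0,
    sq_nonneg (M * y.re - X), sq_nonneg (M * y.im - Y), sq_nonneg (M * z.re - X),
    sq_nonneg (M * z.im - Y)]

/-- The barycentric coordinates of x, multiplied by twice the area of the triangle. -/
lemma openTriangle_weights {p a b x : ℂ} :
    cross (b - a) (x - a) + cross (p - b) (x - b) + cross (a - p) (x - p) = cross (a - p) (b - p) ∧
    cross (b - a) (x - a) * p.re + cross (p - b) (x - b) * a.re + cross (a - p) (x - p) * b.re =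
      cross (a - p) (b - p) * x.re ∧
    cross (b - a) (x - a) * p.im + cross (p - b) (x - b) * a.im + cross (a - p) (x - p) * b.im =
      cross (a - p) (b - p) * x.im := by
  simp only [cross, Complex.sub_re, Complex.sub_im]
  refine ⟨?_, ?_, ?_⟩ <;> ring

lemma cross_pos_of_mem_openTriangle {p a b x : ℂ} (h : x ∈ openTriangle p a b) :
    0 < cross (a - p) (b - p) := by
  rw [← (openTriangle_weights (x := x)).1]
  linarith [h.1, h.2.1, h.2.2]

/-- Small triangles with vertices in a separated set do not overlap. -/
lemma vertices_eq_of_mem_openTriangle {r : ℝ} {S : Set ℂ} (hS : Separated r S)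
    {p a b p' a' b' x : ℂ} (hp : p ∈ S) (ha : a ∈ S) (hb : b ∈ S) (hp' : p' ∈ S) (ha' : a' ∈ S)
    (hb' : b' ∈ S) (h : IsSmall r p a b) (h' : IsSmall r p' a' b') (hx : x ∈ openTriangle p a b)
    (hx' : x ∈ openTriangle p' a' b') :
    ({p, a, b} : Finset ℂ) = {p', a', b'} := by
  classical
  set W : Finset ℂ := {p, a, b} ∪ {p', a', b'} with hW
  let F : ℂ → ℂ → ℂ → ℂ → ℝ := fun p a b v =>
    ((if v = p then cross (b - a) (x - a) else 0) + (if v = a then cross (p - b) (x - b) else 0)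
      + (if v = b then cross (a - p) (x - p) else 0)) / cross (a - p) (b - p)
  have hne : ∀ {p a b v : ℂ}, F p a b v ≠ 0 → v = p ∨ v = a ∨ v = b := by
    intro p a b v h
    by_contra! hv
    apply h
    simp [F, hv.1, hv.2.1, hv.2.2]
  have hnn : ∀ {p a b : ℂ}, x ∈ openTriangle p a b → ∀ v, 0 ≤ F p a b v := by
    intro p a b h v
    have h0 := cross_pos_of_mem_openTriangle h
    obtain ⟨h1, h2, h3⟩ := h
    simp only [F]
    refine div_nonneg (add_nonneg (add_nonneg ?_ ?_) ?_) h0.le <;> split_ifs <;> linarith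
  have hpos : ∀ {p a b : ℂ}, x ∈ openTriangle p a b → ∀ v ∈ ({p, a, b} : Finset ℂ),
      0 < F p a b v := by
    intro p a b h v hv
    have h0 := cross_pos_of_mem_openTriangle h
    obtain ⟨h1, h2, h3⟩ := h
    simp only [F]
    simp only [Finset.mem_insert, Finset.mem_singleton] at hv
    refine div_pos ?_ h0
    split_ifs <;> first | linarith | (exfalso; tauto)
  have hsum : ∀ {p a b : ℂ}, x ∈ openTriangle p a b → p ∈ W → a ∈ W → b ∈ W → 
      ∑ v ∈ W, F p a b v = 1 ∧ ∑ v ∈ W, F p a b v * v.re = x.re ∧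
      ∑ v ∈ W, F p a b v * v.im = x.im := by
    intro p a b h hp ha hb
    have h0 := (cross_pos_of_mem_openTriangle h).ne'
    obtain ⟨e1, e2, e3⟩ := openTriangle_weights (p := p) (a := a) (b := b) (x := x)
    refine ⟨?_, ?_, ?_⟩
    · simp only [F]
      rw [← Finset.sum_div, Finset.sum_add_distrib, Finset.sum_add_distrib]
      simp only [Finset.sum_ite_eq', hp, ha, hb, if_true]
      rw [e1, div_self h0]
    · simp only [F, div_mul_eq_mul_div]
      rw [← Finset.sum_div]
      simp only [add_mul, ite_mul, zero_mul]
      rw [Finset.sum_add_distrib, Finset.sum_add_distrib]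
      simp only [Finset.sum_ite_eq', hp, ha, hb, if_true]
      rw [e2]; field_simp
    · simp only [F, div_mul_eq_mul_div]
      rw [← Finset.sum_div]
      simp only [add_mul, ite_mul, zero_mul]
      rw [Finset.sum_add_distrib, Finset.sum_add_distrib]
      simp only [Finset.sum_ite_eq', hp, ha, hb, if_true]
      rw [e3]; field_simp
  obtain ⟨-, y, hyp, hya, hyb⟩ := h
  obtain ⟨-, z, hzp, hza, hzb⟩ := h'
  have s1 := hsum hx (by simp [hW]) (by simp [hW]) (by simp [hW])
  have s2 := hsum hx' (by simp [hW]) (by simp [hW]) (by simp [hW])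
  have hWS : ↑W ⊆ S := by
    intro v hv
    simp only [hW, Finset.coe_union, Finset.coe_insert, Finset.coe_singleton, Set.mem_union,
      Set.mem_insert_iff, Set.mem_singleton_iff] at hv
    rcases hv with (rfl | rfl | rfl) | (rfl | rfl | rfl) <;> assumption
  have huniq := weights_unique hS hWS (fun v _ => hnn hx v) (fun v _ => hnn hx' v)
    (s1.1.trans s2.1.symm) (s1.2.1.trans s2.2.1.symm) (s1.2.2.trans s2.2.2.symm) (y := y) (z := z)
    (fun v _ hv => by rcases hne hv with rfl | rfl | rfl <;> assumption)
    (fun v _ hv => by rcases hne hv with rfl | rfl | rfl <;> assumption)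
  ext v
  constructor
  · intro hv
    have := huniq v (Finset.mem_union_left _ hv) ▸ hpos hx v hv
    simpa using hne this.ne'
  · intro hv
    have := (huniq v (Finset.mem_union_right _ hv)).symm ▸ hpos hx' v hv
    simpa using hne this.ne'

/-- A point of a small triangle is closer to one of the vertices than to any other point of a
separated set. -/
lemma not_nearest_of_mem_openTriangle {r : ℝ} {S : Set ℂ} (hS : Separated r S)
    {p a b q x : ℂ} (hp : p ∈ S) (ha : a ∈ S) (hb : b ∈ S) (hq : q ∈ S) (h : IsSmall r p a b)
    (hx : x ∈ openTriangle p a b) (hqp : q ≠ p) (hqa : q ≠ a) (hqb : q ≠ b)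
    (h1 : Complex.normSq (x - q) ≤ Complex.normSq (x - p))
    (h2 : Complex.normSq (x - q) ≤ Complex.normSq (x - a))
    (h3 : Complex.normSq (x - q) ≤ Complex.normSq (x - b)) : False := by
  have s1 := hS q hq p hp hqp
  have s2 := hS q hq a ha hqa
  have s3 := hS q hq b hb hqb
  obtain ⟨-, y, hyp, hya, hyb⟩ := h
  have hD := cross_pos_of_mem_openTriangle hx
  obtain ⟨e1, e2, e3⟩ := openTriangle_weights (p := p) (a := a) (b := b) (x := x)
  obtain ⟨w3, w1, w2⟩ := hx
  generalize cross (b - a) (x - a) = α at *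
  generalize cross (p - b) (x - b) = β at *
  generalize cross (a - p) (x - p) = γ at *
  generalize cross (a - p) (b - p) = D at *
  -- The parallel axis theorem. For c = y it bounds the weighted sum of squared distances from x by
  -- less than r²D. If q were as near to x as the vertices, the case c = q would then give less than
  -- 2r²D, contrary to separation.
  have id : ∀ c : ℂ, α * Complex.normSq (c - p) + β * Complex.normSq (c - a) +
      γ * Complex.normSq (c - b) = α * Complex.normSq (x - p) + β * Complex.normSq (x - a) +
      γ * Complex.normSq (x - b) + D * Complex.normSq (x - c) := by
    intro c
    simp only [Complex.normSq_apply, Complex.sub_re, Complex.sub_im]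
    linear_combination (2 * (x.re - c.re)) * e2 + (2 * (x.im - c.im)) * e3 +
      (c.re * c.re + c.im * c.im - x.re * x.re - x.im * x.im) * e1
  have i1 := id q
  have i2 := id y
  have n : 0 ≤ D * Complex.normSq (x - y) := mul_nonneg hD.le (Complex.normSq_nonneg _)
  rw [← Complex.normSq_neg, neg_sub] at hyp hya hyb
  have m1 := mul_lt_mul_of_pos_left hyp w1
  have m2 := mul_lt_mul_of_pos_left hya w2
  have m3 := mul_lt_mul_of_pos_left hyb w3
  have m4 := mul_le_mul_of_nonneg_left h1 w1.le
  have m5 := mul_le_mul_of_nonneg_left h2 w2.le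
  have m6 := mul_le_mul_of_nonneg_left h3 w3.le
  have m7 := mul_le_mul_of_nonneg_left s1 w1.le
  have m8 := mul_le_mul_of_nonneg_left s2 w2.le
  have m9 := mul_le_mul_of_nonneg_left s3 w3.le
  have d : D * Complex.normSq (x - q) = α * Complex.normSq (x - q) + β * Complex.normSq (x - q)
    + γ * Complex.normSq (x - q) := by rw [← e1]; ring
  nlinarith

/-- If the open discs of radius `r` about three points of a separated set have a common point,
then it belongs to the triangle spanned by the three points. -/
lemma mem_openTriangle_of_near {r : ℝ} {p a b y : ℂ} 
    (hpa : 2 * r ^ 2 ≤ Complex.normSq (p - a)) (hpb : 2 * r ^ 2 ≤ Complex.normSq (p - b))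
    (hab : 2 * r ^ 2 ≤ Complex.normSq (a - b)) (hp : Complex.normSq (p - y) < r ^ 2)
    (ha : Complex.normSq (a - y) < r ^ 2) (hb : Complex.normSq (b - y) < r ^ 2) :
    (0 < cross (a - p) (b - p) ∧ y ∈ openTriangle p a b) ∨
    (0 < cross (b - p) (a - p) ∧ y ∈ openTriangle p b a) := by
  -- Vectors shorter than r whose ends are at least √2·r apart form obtuse angles. Three pairwise
  -- obtuse vectors go round the origin, so consecutive determinants have the same sign.
  have aux : ∀ u v w : ℂ, 2 * r ^ 2 ≤ Complex.normSq (u - v) → 2 * r ^ 2 ≤ Complex.normSq (u - w) →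
      2 * r ^ 2 ≤ Complex.normSq (v - w) → Complex.normSq u < r ^ 2 → Complex.normSq v < r ^ 2 →
      Complex.normSq w < r ^ 2 → 0 < cross u v * cross v w := by
    intro u v w h1 h2 h3 h4 h5 h6
    have e : cross u v * cross v w = dot u v * dot v w - dot u w * Complex.normSq v := by
      simp only [cross, dot, Complex.normSq_apply]; ring
    have d1 : dot u v < 0 := by
      simp only [dot, Complex.normSq_apply, Complex.sub_re, Complex.sub_im] at *; nlinarith
    have d2 : dot u w < 0 := by
      simp only [dot, Complex.normSq_apply, Complex.sub_re, Complex.sub_im] at *; nlinarith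
    have d3 : dot v w < 0 := by
      simp only [dot, Complex.normSq_apply, Complex.sub_re, Complex.sub_im] at *; nlinarith
    rw [e]
    nlinarith [mul_pos_of_neg_of_neg d1 d3, mul_nonneg (neg_nonneg.2 d2.le)
      (Complex.normSq_nonneg v)]
  have k1 := aux (p - y) (a - y) (b - y) (by simpa using hpa) (by simpa using hpb)
    (by simpa using hab) hp ha hb
  have k2 := aux (a - y) (b - y) (p - y) (by simpa using hab)
    (by rw [← Complex.normSq_neg]; simpa using hpa) (by rw [← Complex.normSq_neg]; simpa using hpb)
    ha hb hp
  set c1 := cross (p - y) (a - y) with hc1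
  set c2 := cross (a - y) (b - y) with hc2
  set c3 := cross (b - y) (p - y) with hc3
  simp only [cross, Complex.sub_re, Complex.sub_im] at hc1 hc2 hc3
  rcases lt_trichotomy 0 c2 with h | h | h
  · have h1 : 0 < c1 := pos_of_mul_pos_left k1 h.le
    have h3 : 0 < c3 := (pos_iff_pos_of_mul_pos k2).1 h
    left
    simp only [openTriangle, Set.mem_ofPred_eq, cross, Complex.sub_re, Complex.sub_im]
    refine ⟨by linarith, by linarith, by linarith, by linarith⟩
  · rw [← h] at k1; simp at k1
  · have h1 : c1 < 0 := neg_of_mul_pos_left k1 h.le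
    have h3 : c3 < 0 := by nlinarith
    right
    simp only [openTriangle, Set.mem_ofPred_eq, cross, Complex.sub_re, Complex.sub_im]
    refine ⟨by linarith, by linarith, by linarith, by linarith⟩

/-! ### Wedges of neighbours and cones of small triangles -/

/-- The directions of the rays from the origin that meet the perpendicular bisector of the
origin and `v` at distance less than `r` from the origin. -/
def wedge (r : ℝ) (v : ℂ) : Set ℂ := {x | ‖x‖ * Complex.normSq v < 2 * r * dot x v}

lemma normSq_eq_sq (z : ℂ) : Complex.normSq z = ‖z‖ ^ 2 := Complex.normSq_eq_norm_sq z

lemma dot_le_norm_mul (x y : ℂ) : dot x y ≤ ‖x‖ * ‖y‖ := by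
  refine (le_abs_self _).trans (abs_le_of_sq_le_sq ?_ (by positivity))
  rw [mul_pow, ← normSq_eq_sq, ← normSq_eq_sq]
  simp only [dot, Complex.normSq_apply]
  nlinarith [sq_nonneg (x.re * y.im - x.im * y.re)]

lemma norm_pos_of_mem_wedge {r : ℝ} {v x : ℂ} (hx : x ∈ wedge r v) : 0 < ‖x‖ := by
  rw [norm_pos_iff]
  rintro rfl
  simp [wedge, dot] at hx

/-- Two wedges overlap only in the cone of a small triangle. -/
lemma isSmall_of_mem_wedge {r : ℝ} (hr : 0 < r) {p v w x : ℂ} (hv : 2 * r ^ 2 ≤ Complex.normSq v)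
    (hw : 2 * r ^ 2 ≤ Complex.normSq w) (hvw : 2 * r ^ 2 ≤ Complex.normSq (v - w))
    (hxv : x ∈ wedge r v) (hxw : x ∈ wedge r w) :
    (IsSmall r p (p + v) (p + w) ∧ x ∈ openCone v w) ∨
    (IsSmall r p (p + w) (p + v) ∧ x ∈ openCone w v) := by
  have hx := norm_pos_of_mem_wedge hxv
  have ht0 : 0 < r / ‖x‖ := by positivity
  -- At distance r from the origin the ray is strictly beyond the bisector, hence within r of v.
  -- Moving back slightly keeps this and makes the point also nearer than r to the origin.
  have key : ∀ v : ℂ, x ∈ wedge r v →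
      ∀ᶠ t : ℝ in nhds (r / ‖x‖), Complex.normSq (v - t * x) < r ^ 2 := by
    intro v hv
    have hc : Continuous fun t : ℝ => Complex.normSq (v - t * x) := by
      exact Complex.continuous_normSq.comp (by fun_prop)
    refine hc.continuousAt.eventually_lt_const ?_
    have e : Complex.normSq (v - (r / ‖x‖ : ℝ) * x) =
        Complex.normSq v - 2 * (r / ‖x‖) * dot x v + (r / ‖x‖) ^ 2 * Complex.normSq x := by
      simp only [Complex.normSq_apply, dot, Complex.sub_re, Complex.sub_im, Complex.re_ofReal_mul,
        Complex.im_ofReal_mul]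
      ring
    beta_reduce
    rw [e, normSq_eq_sq x, ← mul_pow, div_mul_cancel₀ _ hx.ne']
    have : ‖x‖ * Complex.normSq v < 2 * r * dot x v := hv
    have : Complex.normSq v < 2 * (r / ‖x‖) * dot x v := by
      rw [mul_div_assoc', div_mul_eq_mul_div, lt_div_iff₀ hx]; linarith
    linarith
  have h1 : ∀ᶠ t : ℝ in nhdsWithin (r / ‖x‖) (Set.Iio (r / ‖x‖)), t < r / ‖x‖ :=
    self_mem_nhdsWithin
  have h2 : ∀ᶠ t : ℝ in nhdsWithin (r / ‖x‖) (Set.Iio (r / ‖x‖)), 0 < t :=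
    (eventually_gt_nhds ht0).filter_mono nhdsWithin_le_nhds
  obtain ⟨t, ht1, ht2, htv, htw⟩ := (h1.and (h2.and
    (((key v hxv).and (key w hxw)).filter_mono nhdsWithin_le_nhds))).exists
  have htx : Complex.normSq (t * x) < r ^ 2 := by
    rw [normSq_eq_sq, norm_mul, Complex.norm_real, Real.norm_eq_abs, abs_of_pos ht2]
    rw [lt_div_iff₀ hx] at ht1
    exact pow_lt_pow_left₀ ht1 (by positivity) two_ne_zero
  have hcone : ∀ u w : ℂ, (t : ℂ) * x ∈ openCone u w → x ∈ openCone u w := by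
    rintro u w ⟨h1, h2⟩
    have e1 : cross u (t * x) = t * cross u x := by
      simp only [cross, Complex.re_ofReal_mul, Complex.im_ofReal_mul]; ring
    have e2 : cross (t * x) w = t * cross x w := by
      simp only [cross, Complex.re_ofReal_mul, Complex.im_ofReal_mul]; ring
    rw [e1] at h1; rw [e2] at h2
    exact ⟨pos_of_mul_pos_right h1 ht2.le, pos_of_mul_pos_right h2 ht2.le⟩
  have n1 : Complex.normSq (p - (p + t * x)) < r ^ 2 := by
    rw [← Complex.normSq_neg]; simpa using htx
  have n2 : Complex.normSq (p + v - (p + t * x)) < r ^ 2 := by simpa using htv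
  have n3 : Complex.normSq (p + w - (p + t * x)) < r ^ 2 := by simpa using htw
  have := mem_openTriangle_of_near (r := r) (p := p) (a := p + v) (b := p + w) (y := p + t * x)
    (by rw [← Complex.normSq_neg]; simpa using hv) (by rw [← Complex.normSq_neg]; simpa using hw)
    (by simpa using hvw) n1 n2 n3
  rcases this with ⟨h, h'⟩ | ⟨h, h'⟩
  · refine Or.inl ⟨⟨h, _, n1, n2, n3⟩, hcone _ _ ?_⟩
    simpa using sub_mem_openCone_of_mem_openTriangle h'
  · refine Or.inr ⟨⟨h, _, n1, n3, n2⟩, hcone _ _ ?_⟩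
    simpa using sub_mem_openCone_of_mem_openTriangle h'

lemma normSq_sub_lt_of_near {r : ℝ} {u v y : ℂ} (hu : Complex.normSq (u - y) < r ^ 2)
    (hv : Complex.normSq (v - y) < r ^ 2) : Complex.normSq (u - v) < 4 * r ^ 2 := by
  simp only [Complex.normSq_apply, Complex.sub_re, Complex.sub_im] at *
  nlinarith [sq_nonneg (u.re - y.re + (v.re - y.re)), sq_nonneg (u.im - y.im + (v.im - y.im))]

/-- The cone of a small triangle is covered by the wedges of its vertices. -/
lemma mem_wedge_of_mem_openCone {r : ℝ} (hr : 0 < r) {p a b x : ℂ}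
    (ha : 2 * r ^ 2 ≤ Complex.normSq a)
    (hb : 2 * r ^ 2 ≤ Complex.normSq b) (h : IsSmall r p (p + a) (p + b))
    (hx : x ∈ openCone a b) : x ∈ wedge r a ∨ x ∈ wedge r b := by
  obtain ⟨hD, y, hyp, hya, hyb⟩ := h
  have hab := normSq_sub_lt_of_near hya hyb
  obtain ⟨z, rfl⟩ : ∃ z, y = p + z := ⟨y - p, by ring⟩
  have hz : Complex.normSq z < r ^ 2 := by
    rw [← Complex.normSq_neg] at hyp; simpa using hyp
  simp only [add_sub_add_left_eq_sub] at hya hyb hab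
  simp only [add_sub_cancel_left] at hD
  by_contra! hcon
  obtain ⟨c1, c2⟩ := hcon
  simp only [wedge, Set.mem_ofPred_eq, not_lt] at c1 c2
  obtain ⟨hβ, hα⟩ := hx
  have e1 : cross a b * x.re = cross x b * a.re + cross a x * b.re := by simp only [cross]; ring
  have e2 : cross a b * x.im = cross x b * a.im + cross a x * b.im := by simp only [cross]; ring
  generalize cross x b = α at *
  generalize cross a x = β at *
  generalize cross a b = D at *
  have hx0 : 0 < ‖x‖ := by
    rw [norm_pos_iff]
    rintro rfl
    simp only [Complex.zero_re, Complex.zero_im, mul_zero] at e1 e2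
    simp only [Complex.normSq_apply, Complex.sub_re, Complex.sub_im] at *
    have h1 : α * (α * (a.re * a.re + a.im * a.im)) = β * (β * (b.re * b.re + b.im * b.im)) := by
      linear_combination (β * b.re - α * a.re) * e1 + (β * b.im - α * a.im) * e2
    have h2 : (α + β) * (α * (a.re * a.re + a.im * a.im) + β * (b.re * b.re + b.im * b.im)) =
      α * β * ((a.re - b.re) * (a.re - b.re) + (a.im - b.im) * (a.im - b.im)) := by
      linear_combination (-β * b.re - α * a.re) * e1 + (-β * b.im - α * a.im) * e2
    have h3 := mul_lt_mul_of_pos_left hab (mul_pos hα hβ)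
    have h4 := mul_le_mul_of_nonneg_left ha hα.le
    have h5 := mul_le_mul_of_nonneg_left hb hβ.le
    have h6 := mul_le_mul_of_nonneg_left (add_le_add h4 h5) (add_pos hα hβ).le
    nlinarith [mul_nonneg (sq_nonneg (α - β)) (sq_nonneg r), mul_pos (mul_pos hα hβ) (pow_pos hr 2),
      mul_pos (pow_pos hα 2) (pow_pos hr 2)]
  -- Since D·x = αa + βb, n is the norm of αa + βb. Lying outside both wedges gives `i1`, the side
  -- lengths give `i4`, and the point z common to the three discs gives `i5`; as ‖z‖ < r, these are
  -- incompatible.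
  set n := D * ‖x‖ with hn
  set E := α * Complex.normSq a + β * Complex.normSq b with hE
  have hn0 : 0 < n := mul_pos hD hx0
  have i1 : 2 * r * n ≤ E := by
    have : 2 * r * (D * ‖x‖ ^ 2) ≤ ‖x‖ * E := by
      rw [← normSq_eq_sq]
      have d : D * Complex.normSq x = α * dot x a + β * dot x b := by
        simp only [Complex.normSq_apply, dot]
        linear_combination x.re * e1 + x.im * e2
      rw [d]
      nlinarith [mul_le_mul_of_nonneg_left c1 hα.le, mul_le_mul_of_nonneg_left c2 hβ.le]
    refine le_of_mul_le_mul_left ?_ hx0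
    rw [hn]; linarith
  have i2 : n ^ 2 = (α + β) * E - α * β * Complex.normSq (a - b) := by
    rw [hn, mul_pow, ← normSq_eq_sq]
    simp only [hE, Complex.normSq_apply, Complex.sub_re, Complex.sub_im]
    linear_combination (D * x.re + α * a.re + β * b.re) * e1 +
      (D * x.im + α * a.im + β * b.im) * e2
  have i3 : ((α + β) * r) ^ 2 ≤ n ^ 2 := by
    rw [i2, hE]
    have h3 := mul_lt_mul_of_pos_left hab (mul_pos hα hβ)
    have h4 := mul_le_mul_of_nonneg_left ha hα.le
    have h5 := mul_le_mul_of_nonneg_left hb hβ.le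
    have h6 := mul_le_mul_of_nonneg_left (add_le_add h4 h5) (add_pos hα hβ).le
    nlinarith [mul_nonneg (sq_nonneg (α - β)) (sq_nonneg r)]
  have i4 : (α + β) * r ≤ n := (le_abs_self _).trans (abs_le_of_sq_le_sq i3 hn0.le)
  have hzr : ‖z‖ < r := by
    rw [normSq_eq_sq] at hz
    exact lt_of_pow_lt_pow_left₀ 2 hr.le hz
  have i5 : E < (α + β) * (r ^ 2 - ‖z‖ ^ 2) + 2 * ‖z‖ * n := by
    have d : D * dot x z ≤ ‖z‖ * n := by
      have := mul_le_mul_of_nonneg_left (dot_le_norm_mul x z) hD.le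
      rw [hn]; linarith
    have d2 : D * dot x z = α * dot a z + β * dot b z := by
      simp only [dot]
      linear_combination z.re * e1 + z.im * e2
    have m1 := mul_lt_mul_of_pos_left hya hα
    have m2 := mul_lt_mul_of_pos_left hyb hβ
    have ex : ∀ u : ℂ, Complex.normSq (u - z) =
        Complex.normSq u - 2 * dot u z + Complex.normSq z := by
      intro u
      simp only [Complex.normSq_apply, Complex.sub_re, Complex.sub_im, dot]; ring
    rw [ex] at m1 m2
    rw [← normSq_eq_sq, hE]
    linarith
  nlinarith [mul_pos (add_pos hα hβ) (pow_pos (sub_pos.2 hzr) 2),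
    mul_nonneg (sub_nonneg.2 i4) (sub_nonneg.2 hzr.le)]

/-- Auxiliary estimate: a neighbour cannot lie in the convex hull of a wedge's axis and one of
its points. -/
lemma not_mem_wedge_hull {r : ℝ} (hr : 0 < r) {q b x : ℂ} (hq : 2 * r ^ 2 ≤ Complex.normSq q)
    (hq' : Complex.normSq q < 4 * r ^ 2) (hb : 2 * r ^ 2 ≤ Complex.normSq b)
    (hb' : Complex.normSq b < 4 * r ^ 2) (hbq : 2 * r ^ 2 ≤ Complex.normSq (b - q))
    (hx : x ∈ wedge r q) {k l m : ℝ} (hk : 0 ≤ k) (hl : 0 < l) (hm : 0 < m)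
    (h : (m : ℂ) * b = k * q + l * x) : False := by
  have hx : ‖x‖ * Complex.normSq q < 2 * r * dot x q := hx
  have hq2 : ‖q‖ < 2 * r := by
    rw [normSq_eq_sq] at hq'
    exact lt_of_pow_lt_pow_left₀ 2 (by positivity) (by linarith)
  have hb2 : ‖b‖ < 2 * r := by
    rw [normSq_eq_sq] at hb'
    exact lt_of_pow_lt_pow_left₀ 2 (by positivity) (by linarith)
  have n1 : m * ‖b‖ ≤ k * ‖q‖ + l * ‖x‖ := by
    calc m * ‖b‖ = ‖(m : ℂ) * b‖ := by
          rw [norm_mul, Complex.norm_real, Real.norm_eq_abs, abs_of_pos hm]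
      _ ≤ ‖(k : ℂ) * q‖ + ‖(l : ℂ) * x‖ := by rw [h]; exact norm_add_le _ _
      _ = _ := by
          rw [norm_mul, norm_mul, Complex.norm_real, Complex.norm_real, Real.norm_eq_abs,
            Real.norm_eq_abs, abs_of_pos hl, abs_of_nonneg hk]
  have e1 : m * b.re = k * q.re + l * x.re := by simpa using congrArg Complex.re h
  have e2 : m * b.im = k * q.im + l * x.im := by simpa using congrArg Complex.im h
  have d : m * dot b q = k * Complex.normSq q + l * dot x q := by
    simp only [dot, Complex.normSq_apply]
    linear_combination q.re * e1 + q.im * e2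
  have hQ : 0 < Complex.normSq q := by nlinarith [pow_pos hr 2]
  -- The condition defining the wedge is homogeneous and convex, and holds at x and, because ‖q‖ <
  -- 2r, at q. So b would be in the wedge of q, which is impossible for separated points.
  have w : ‖b‖ * Complex.normSq q < 2 * r * dot b q := by
    refine lt_of_mul_lt_mul_left ?_ hm.le
    have a1 := mul_le_mul_of_nonneg_right n1 hQ.le
    have a2 := mul_lt_mul_of_pos_left hx hl
    have a3 := mul_le_mul_of_nonneg_left hq2.le (mul_nonneg hk hQ.le)
    nlinarith
  have hb1 : r < ‖b‖ := by
    rw [normSq_eq_sq] at hb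
    exact lt_of_pow_lt_pow_left₀ 2 (norm_nonneg _) (by nlinarith [pow_pos hr 2])
  have e : Complex.normSq (b - q) = ‖b‖ ^ 2 + Complex.normSq q - 2 * dot b q := by
    rw [← normSq_eq_sq]
    simp only [Complex.normSq_apply, Complex.sub_re, Complex.sub_im, dot]; ring
  rw [e] at hbq
  nlinarith [mul_le_mul_of_nonneg_right hq (sub_pos.2 hb1).le, mul_pos (sub_pos.2 hb2) hr,
    mul_le_mul_of_nonneg_left hbq hr.le, mul_pos (sub_pos.2 hb2) (mul_pos hr (hr.trans hb1))]

/-- If x left the cone across its far edge b, then b would lie in the hull of q and x, contrary to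
`not_mem_wedge_hull`. Thus a half wedge is swallowed by a small triangle adjacent to it. -/
lemma mem_openCone_of_mem_wedge {r : ℝ} (hr : 0 < r) {p q b x : ℂ}
    (hq : 2 * r ^ 2 ≤ Complex.normSq q)
    (hb : 2 * r ^ 2 ≤ Complex.normSq b) (hbq : 2 * r ^ 2 ≤ Complex.normSq (b - q))
    (hx : x ∈ wedge r q) :
    (IsSmall r p (p + q) (p + b) → 0 < cross q x → x ∈ openCone q b) ∧
    (IsSmall r p (p + b) (p + q) → 0 < cross x q → x ∈ openCone b q) := by
  have lt4 : ∀ {p v y : ℂ}, Complex.normSq (p - y) < r ^ 2 → Complex.normSq (p + v - y) < r ^ 2 →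
      Complex.normSq v < 4 * r ^ 2 := by
    intro p v y h1 h2
    simpa using normSq_sub_lt_of_near h2 h1
  constructor
  · rintro ⟨hD, y, y1, y2, y3⟩ hqx
    refine ⟨hqx, ?_⟩
    by_contra! hc
    simp only [add_sub_cancel_left] at hD
    refine not_mem_wedge_hull hr hq (lt4 y1 y2) hb (lt4 y1 y3) hbq hx
      (k := -cross x b) (l := cross q b) (m := cross q x) (by linarith) hD hqx ?_
    apply Complex.ext <;> simp [cross] <;> ring
  · rintro ⟨hD, y, y1, y2, y3⟩ hqx
    refine ⟨?_, hqx⟩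
    by_contra! hc
    simp only [add_sub_cancel_left] at hD
    refine not_mem_wedge_hull hr hq (lt4 y1 y3) hb (lt4 y1 y2) hbq hx
      (k := -cross b x) (l := cross b q) (m := cross x q) (by linarith) hD hqx ?_
    apply Complex.ext <;> simp [cross] <;> ring

/-- Turns an overlap of two cones at p into an overlap of the triangles themselves. -/
lemma eventually_mem_openTriangle {p a b x : ℂ} (hD : 0 < cross a b) (hx : x ∈ openCone a b) :
    ∀ᶠ t : ℝ in nhdsWithin 0 (Set.Ioi 0), p + t * x ∈ openTriangle p (p + a) (p + b) := by
  have h1 : ∀ᶠ t : ℝ in nhdsWithin 0 (Set.Ioi 0), 0 < t := self_mem_nhdsWithin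
  have h2 : ∀ᶠ t : ℝ in nhdsWithin 0 (Set.Ioi 0), 0 < t * cross (b - a) x + cross a b := by
    refine Filter.Eventually.filter_mono nhdsWithin_le_nhds ?_
    have hc : Continuous fun t : ℝ => t * cross (b - a) x + cross a b := by fun_prop
    exact hc.continuousAt.eventually_const_lt (by simpa using hD)
  filter_upwards [h1, h2] with t ht h
  obtain ⟨x1, x2⟩ := hx
  have m1 := mul_pos ht x1
  have m2 := mul_pos ht x2
  simp only [openTriangle, Set.mem_ofPred_eq, cross, Complex.sub_re, Complex.sub_im, Complex.add_re,
    Complex.add_im, Complex.re_ofReal_mul, Complex.im_ofReal_mul] at *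
  refine ⟨by linarith, by linarith, by linarith⟩

/-- A wedge meets the cone of a small triangle only if its axis is an edge of the cone. -/
lemma eq_of_mem_wedge_of_mem_openCone {r : ℝ} (hr : 0 < r) {S : Set ℂ} (hS : Separated r S)
    {p q a b x : ℂ} (hp : p ∈ S) (hq : p + q ∈ S) (ha : p + a ∈ S) (hb : p + b ∈ S)
    (h : IsSmall r p (p + a) (p + b)) (hq0 : q ≠ 0)
    (hxq : x ∈ wedge r q) (hx : x ∈ openCone a b) : q = a ∨ q = b := by
  have sep : ∀ {u v : ℂ}, p + u ∈ S → p + v ∈ S → u ≠ v → 2 * r ^ 2 ≤ Complex.normSq (u - v) := by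
    intro u v hu hv huv
    simpa using hS _ hu _ hv (by simpa using huv)
  have sep0 : ∀ {u : ℂ}, p + u ∈ S → u ≠ 0 → 2 * r ^ 2 ≤ Complex.normSq u := by
    intro u hu hu0
    simpa using hS _ hu _ hp (by simpa using hu0)
  have hD : 0 < cross a b := by simpa using h.1
  have ha0 : a ≠ 0 := by rintro rfl; simp [cross] at hD
  have hb0 : b ≠ 0 := by rintro rfl; simp [cross] at hD
  by_contra! hne
  -- By `mem_wedge_of_mem_openCone`, x is also in the wedge of an edge c of the cone. Then p, p + q,
  -- p + c span a small triangle that overlaps the given one near p, so q is one of its edges after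
  -- all.
  have main : ∀ c, (c = a ∨ c = b) → p + c ∈ S → c ≠ 0 → q ≠ c → x ∈ wedge r c → False := by
    intro c hc hcS hc0 hqc hxc
    have aux : ∀ u v, p + u ∈ S → p + v ∈ S → IsSmall r p (p + u) (p + v) → x ∈ openCone u v →
        ({p, p + a, p + b} : Finset ℂ) = {p, p + u, p + v} := by
      intro u v hu hv hs hxc
      obtain ⟨t, t1, t2⟩ := ((eventually_mem_openTriangle (p := p) hD hx).and
        (eventually_mem_openTriangle (p := p) (by simpa using hs.1) hxc)).exists
      exact vertices_eq_of_mem_openTriangle hS hp ha hb hp hu hv h hs t1 t2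
    have fin : (p + q) ∈ ({p, p + a, p + b} : Finset ℂ) → False := by
      simp [hq0, hne.1, hne.2]
    rcases isSmall_of_mem_wedge hr (p := p) (sep0 hq hq0) (sep0 hcS hc0) (sep hq hcS hqc) hxq hxc
      with ⟨hs, hxc⟩ | ⟨hs, hxc⟩
    · apply fin; rw [aux _ _ hq hcS hs hxc]; simp
    · apply fin; rw [aux _ _ hcS hq hs hxc]; simp
  rcases mem_wedge_of_mem_openCone hr (sep0 ha ha0) (sep0 hb hb0) h hx with h1 | h1
  · exact main a (Or.inl rfl) ha ha0 hne.1 h1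
  · exact main b (Or.inr rfl) hb hb0 hne.2 h1

/-! ### Areas -/

lemma volume_standard_triangle :
    volume {z : ℂ | 0 < z.re ∧ 0 < z.im ∧ z.re + z.im < 1} = ENNReal.ofReal (1 / 2) := by
  have h : {z : ℂ | 0 < z.re ∧ 0 < z.im ∧ z.re + z.im < 1} =
      Complex.measurableEquivRealProd ⁻¹'
        (regionBetween (fun _ => (0 : ℝ)) (fun x => 1 - x) (Set.Ioo 0 1)) := by
    ext z
    simp only [Set.mem_ofPred_eq, regionBetween, Set.mem_preimage,
      Complex.measurableEquivRealProd_apply, Set.mem_Ioo]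
    constructor
    · rintro ⟨h1, h2, h3⟩; exact ⟨⟨h1, by linarith⟩, h2, by linarith⟩
    · rintro ⟨⟨h1, -⟩, h2, h3⟩; exact ⟨h1, h2, by linarith⟩
  have hi : IntegrableOn (fun x : ℝ => 1 - x) (Set.Ioo 0 1) :=
    (Continuous.integrableOn_Icc (by fun_prop)).mono_set Set.Ioo_subset_Icc_self
  rw [h, Complex.volume_preserving_equiv_real_prod.measure_preimage_equiv,
    Measure.volume_eq_prod,
    volume_regionBetween_eq_integral (by simp) hi measurableSet_Ioo
    (fun x hx => by linarith [hx.2])]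
  congr 1
  simp only [Pi.sub_apply, sub_zero]
  rw [← integral_Ioc_eq_integral_Ioo, ← intervalIntegral.integral_of_le zero_le_one]
  rw [intervalIntegral.integral_sub (by simp) (by simp)]
  norm_num

lemma volume_openTriangle {p a b : ℂ} (h : 0 < cross (a - p) (b - p)) :
    volume (openTriangle p a b) = ENNReal.ofReal (cross (a - p) (b - p) / 2) := by
  set u := a - p with hu
  set v := b - p with hv
  let M : Matrix (Fin 2) (Fin 2) ℝ := !![u.re, v.re; u.im, v.im]
  let f : ℂ →ₗ[ℝ] ℂ := Matrix.toLin Complex.basisOneI Complex.basisOneI M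
  have hf : ∀ z, f z = z.re * u + z.im * v := by
    intro z
    simp only [f, Matrix.toLin_apply, Complex.coe_basisOneI_repr, Complex.coe_basisOneI, M,
      Matrix.mulVec, dotProduct, Fin.sum_univ_two]
    apply Complex.ext <;> simp <;> ring
  have hdet : LinearMap.det f = cross u v := by
    simp only [f, LinearMap.det_toLin, M, Matrix.det_fin_two_of, cross]; ring
  have himg : openTriangle p a b =
      (fun x => p + x) '' (f '' {z : ℂ | 0 < z.re ∧ 0 < z.im ∧ z.re + z.im < 1}) := by
    ext x
    simp only [Set.mem_image, exists_exists_and_eq_and, Set.mem_ofPred_eq]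
    have ha : a = p + u := by simp [hu]
    have hb : b = p + v := by simp [hv]
    clear_value u v
    subst ha hb
    constructor
    · rintro ⟨h1, h2, h3⟩
      refine ⟨⟨cross (x - p) v / cross u v, cross u (x - p) / cross u v⟩, ⟨?_, ?_, ?_⟩, ?_⟩
      · refine div_pos ?_ h
        simp only [cross, Complex.sub_re, Complex.sub_im, Complex.add_re, Complex.add_im] at *
        linarith
      · refine div_pos ?_ h
        simpa using h1
      · change _ / _ + _ / _ < 1
        rw [← add_div, div_lt_one h]
        simp only [cross, Complex.sub_re, Complex.sub_im, Complex.add_re, Complex.add_im] at *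
        linarith
      · rw [hf]
        have i1 : cross (x - p) v * u.re + cross u (x - p) * v.re = cross u v * (x.re - p.re) := by
          simp only [cross, Complex.sub_re, Complex.sub_im]; ring
        have i2 : cross (x - p) v * u.im + cross u (x - p) * v.im = cross u v * (x.im - p.im) := by
          simp only [cross, Complex.sub_re, Complex.sub_im]; ring
        apply Complex.ext
        · rw [Complex.add_re, Complex.add_re, Complex.re_ofReal_mul, Complex.re_ofReal_mul,
            div_mul_eq_mul_div, div_mul_eq_mul_div, ← add_div, i1, mul_div_cancel_left₀ _ h.ne']
          ring
        · rw [Complex.add_im, Complex.add_im, Complex.im_ofReal_mul, Complex.im_ofReal_mul,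
            div_mul_eq_mul_div, div_mul_eq_mul_div, ← add_div, i2, mul_div_cancel_left₀ _ h.ne']
          ring
    · rintro ⟨z, ⟨h1, h2, h3⟩, rfl⟩
      rw [hf]
      have m1 := mul_pos h1 h
      have m2 := mul_pos h2 h
      have m3 := mul_pos (sub_pos.2 h3) h
      simp only [openTriangle, Set.mem_ofPred_eq, cross, Complex.sub_re, Complex.sub_im,
        Complex.add_re, Complex.add_im, Complex.re_ofReal_mul, Complex.im_ofReal_mul] at *
      refine ⟨by linarith, by linarith, by linarith⟩
  rw [himg, Set.image_add_left, measure_preimage_add, Measure.addHaar_image_linearMap, hdet,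
    volume_standard_triangle, abs_of_pos h, ← ENNReal.ofReal_mul h.le]
  congr 1
  ring

/-! ### Area of a half wedge cut off by its bisector -/

/-- A half of a wedge about the positive real axis. -/
def stdWedge (c : ℝ) : Set ℂ := {z | ‖z‖ * c < z.re ∧ 0 < z.im}

/-- In polar coordinates the half wedge is confined to angles between 0 and arccos c. -/
lemma volume_stdWedge_le {c : ℝ} (hc0 : 0 < c) (hc1 : c < 1) :
    volume (stdWedge c ∩ Metric.ball 0 1) ≤ ENNReal.ofReal (Real.arccos c / 2) := by
  set A := stdWedge c ∩ Metric.ball 0 1 with hA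
  have hAm : MeasurableSet A := by
    refine IsOpen.measurableSet (IsOpen.inter (IsOpen.inter ?_ ?_) Metric.isOpen_ball)
    · exact isOpen_lt (continuous_norm.mul continuous_const) Complex.continuous_re
    · exact isOpen_lt continuous_const Complex.continuous_im
  rw [← lintegral_indicator_one hAm, ← Complex.lintegral_comp_polarCoord_symm,
    ← lintegral_indicator polarCoord.open_target.measurableSet]
  have hle : ∀ q : ℝ × ℝ, polarCoord.target.indicator (fun q : ℝ × ℝ =>
      ENNReal.ofReal q.1 • A.indicator (1 : ℂ → ENNReal) (Complex.polarCoord.symm q)) q ≤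
      (Set.Ioc (0 : ℝ) 1).indicator (fun x => ENNReal.ofReal x) q.1 *
        (Set.Ioo (0 : ℝ) (Real.arccos c)).indicator (fun _ => (1 : ENNReal)) q.2 := by
    rintro ⟨ρ, θ⟩
    by_cases ht : (ρ, θ) ∈ polarCoord.target
    · by_cases hm : Complex.polarCoord.symm (ρ, θ) ∈ A
      · rw [Set.indicator_of_mem ht, Set.indicator_of_mem hm]
        rw [polarCoord_target] at ht
        obtain ⟨h1, h2, h3⟩ := ht
        simp only at h1 h2 h3
        obtain ⟨⟨m1, m2⟩, m3⟩ := hm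
        rw [Complex.polarCoord_symm_apply] at m1 m2 m3
        have hρ : 0 < ρ := h1
        have hn : ‖(ρ : ℂ) * (Real.cos θ + Real.sin θ * Complex.I)‖ = ρ := by
          rw [norm_mul, Complex.norm_real, Real.norm_eq_abs, abs_of_pos hρ]
          have : (Real.cos θ + Real.sin θ * Complex.I : ℂ) = Complex.exp (θ * Complex.I) := by
            rw [Complex.exp_mul_I]; push_cast; rfl
          rw [this, Complex.norm_exp_ofReal_mul_I, mul_one]
        simp only at m1 m2 m3
        rw [mem_ball_zero_iff, hn] at m3
        rw [hn, Complex.re_ofReal_mul] at m1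
        rw [Complex.im_ofReal_mul] at m2
        simp only [Complex.add_re, Complex.ofReal_re, Complex.mul_re, Complex.I_re, mul_zero,
          Complex.ofReal_im, Complex.I_im, mul_one, sub_self, add_zero, Complex.add_im,
          Complex.mul_im, zero_add] at m1 m2
        have c1 : c < Real.cos θ := lt_of_mul_lt_mul_left m1 hρ.le
        have s1 : 0 < Real.sin θ := pos_of_mul_pos_right m2 hρ.le
        have hθ : 0 < θ := by
          by_contra! hθ
          have := Real.sin_nonpos_of_nonpos_of_neg_pi_le hθ h2.le
          linarith
        have hθ2 : θ < Real.arccos c := by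
          by_contra! hh
          have := Real.cos_le_cos_of_nonneg_of_le_pi (Real.arccos_nonneg c) h3.le hh
          rw [Real.cos_arccos (by linarith) hc1.le] at this
          linarith
        rw [Set.indicator_of_mem (show ρ ∈ Set.Ioc (0 : ℝ) 1 from ⟨hρ, m3.le⟩),
          Set.indicator_of_mem (show θ ∈ Set.Ioo (0 : ℝ) (Real.arccos c) from ⟨hθ, hθ2⟩)]
        simp
      · rw [Set.indicator_of_mem ht, Set.indicator_of_notMem hm]; simp
    · rw [Set.indicator_of_notMem ht]; exact zero_le
  refine (lintegral_mono hle).trans ?_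
  rw [Measure.volume_eq_prod, lintegral_prod_mul (by measurability) (by measurability)]
  rw [lintegral_indicator measurableSet_Ioc, lintegral_indicator measurableSet_Ioo]
  have e1 : ∫⁻ x in Set.Ioc (0 : ℝ) 1, ENNReal.ofReal x = ENNReal.ofReal (1 / 2) := by
    rw [← ofReal_integral_eq_lintegral_ofReal]
    · rw [← intervalIntegral.integral_of_le zero_le_one]
      norm_num
    · exact (Continuous.integrableOn_Icc (by fun_prop)).mono_set Set.Ioc_subset_Icc_self
    · exact (ae_restrict_iff' measurableSet_Ioc).2 (Filter.Eventually.of_forall fun x hx => hx.1.le)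
  rw [e1]
  simp only [lintegral_const, MeasurableSet.univ, Measure.restrict_apply, Set.univ_inter,
    Real.volume_Ioo, sub_zero, one_mul]
  rw [← ENNReal.ofReal_mul (by norm_num)]
  exact ENNReal.ofReal_le_ofReal (by linarith)

/-- Half of a wedge, cut off at the bisector, is large compared with the angle of the wedge. -/
lemma volume_stdWedge_inter_ge {r l : ℝ} (hr : 0 < r) (hl : 2 * r ^ 2 ≤ l ^ 2) (hl0 : 0 < l)
    (hl' : l < 2 * r) :
    ENNReal.ofReal (2 * r ^ 2 / Real.pi) * volume (stdWedge (l / (2 * r)) ∩ Metric.ball 0 1) ≤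
      volume (stdWedge (l / (2 * r)) ∩ {z | z.re < l / 2}) := by
  set c := l / (2 * r) with hc
  have hc0 : 0 < c := by positivity
  have hc1 : c < 1 := by rw [hc, div_lt_one (by positivity)]; exact hl'
  set θ := Real.arccos c with hθ
  have hlc : l = 2 * r * c := by rw [hc]; field_simp
  have hcos : Real.cos θ = c := Real.cos_arccos (by linarith) hc1.le
  have hθ0 : 0 < θ := Real.arccos_pos.2 hc1
  have hsin : 0 < Real.sin θ := Real.sin_pos_of_pos_of_lt_pi hθ0
    (lt_of_le_of_ne (Real.arccos_le_pi c) (by rw [hθ, Ne, Real.arccos_eq_pi]; linarith))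
  have hsc : Real.sin θ ^ 2 + c ^ 2 = 1 := by rw [← hcos]; exact Real.sin_sq_add_cos_sq θ
  -- Separation enters here: it keeps 2θ in the range of Jordan's inequality sin t ≥ 2t/π.
  have hθ4 : θ ≤ Real.pi / 4 := by
    by_contra! h
    have := Real.cos_lt_cos_of_nonneg_of_le_pi (by positivity) (Real.arccos_le_pi c) h
    rw [hcos, Real.cos_pi_div_four] at this
    have h2 : (√2 / 2) ^ 2 ≤ c ^ 2 := by
      rw [div_pow, Real.sq_sqrt (by norm_num), hc, div_pow, div_le_div_iff₀ (by norm_num)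
        (by positivity)]
      nlinarith
    have := abs_le_of_sq_le_sq h2 hc0.le
    rw [abs_of_pos (by positivity)] at this
    linarith
  have hD : cross ((l / 2 : ℝ) - 0 : ℂ) (⟨l / 2, r * Real.sin θ⟩ - 0) =
      r ^ 2 * (Real.sin θ * c) := by
    simp only [cross, sub_zero, Complex.ofReal_re, Complex.ofReal_im]
    rw [hlc]; ring
  -- The right triangle with angle θ at the origin and hypotenuse r; its area is r² sin 2θ / 4.
  have hsub : openTriangle 0 (l / 2 : ℝ) ⟨l / 2, r * Real.sin θ⟩ ⊆
      stdWedge c ∩ {z | z.re < l / 2} := by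
    rintro z ⟨h1, h2, h3⟩
    simp only [cross, sub_zero, Complex.ofReal_re, Complex.ofReal_im, Complex.sub_re,
      Complex.sub_im, zero_mul, zero_sub] at h1 h2 h3
    have hz : 0 < z.im := by
      have : 0 < l / 2 * z.im := by linarith
      exact pos_of_mul_pos_right this (by positivity)
    have hz1 : z.re < l / 2 := by
      have : 0 < (r * Real.sin θ) * (l / 2 - z.re) := by linarith
      have := pos_of_mul_pos_right this (by positivity)
      linarith
    refine ⟨⟨?_, hz⟩, hz1⟩
    have hre : z.im * c < Real.sin θ * z.re := by
      have e : 0 < r * (Real.sin θ * z.re - z.im * c) := by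
        rw [hlc] at h3; simp at h3; linarith
      have := pos_of_mul_pos_right e hr.le
      linarith
    have hre0 : 0 < z.re := pos_of_mul_pos_right ((mul_pos hz hc0).trans hre) hsin.le
    refine lt_of_pow_lt_pow_left₀ 2 hre0.le ?_
    rw [mul_pow, ← normSq_eq_sq, Complex.normSq_apply]
    have : (z.im * c) ^ 2 < (Real.sin θ * z.re) ^ 2 :=
      pow_lt_pow_left₀ hre (by positivity) two_ne_zero
    have e : Real.sin θ ^ 2 = 1 - c ^ 2 := by linarith
    rw [mul_pow (Real.sin θ), e] at this
    nlinarith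
  refine le_trans ?_ (measure_mono hsub)
  rw [volume_openTriangle (by rw [hD]; positivity), hD]
  refine (mul_le_mul_right (volume_stdWedge_le hc0 hc1) _).trans ?_
  rw [← ENNReal.ofReal_mul (by positivity)]
  refine ENNReal.ofReal_le_ofReal ?_
  have hj := Real.mul_le_sin (x := 2 * θ) (by positivity) (by linarith)
  rw [Real.sin_two_mul, hcos] at hj
  have : 2 * r ^ 2 / Real.pi * (θ / 2) = r ^ 2 / 4 * (2 / Real.pi * (2 * θ)) := by
    field_simp; ring
  rw [← hθ, this]
  nlinarith [mul_le_mul_of_nonneg_left hj (sq_nonneg r)]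

lemma finite_inter_of_pairwise_le_dist {α : Type*} [MetricSpace α] [ProperSpace α] {s K : Set α}
    {ε : ℝ} (hε : 0 < ε) (hs : s.Pairwise fun x y => ε ≤ dist x y) (hK : Bornology.IsBounded K) :
    (K ∩ s).Finite := by
  have hd : DiscreteTopology s := DiscreteTopology.of_forall_le_dist hε
    fun x y hxy => hs x.2 y.2 (Subtype.coe_injective.ne hxy)
  exact Metric.finite_isBounded_inter_isClosed hd.isDiscrete hK
    (Metric.isClosed_of_pairwise_le_dist hε hs)

/-- The two halves of a wedge. -/
def halfWedge (r : ℝ) (q : ℂ × Bool) : Set ℂ :=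
  wedge r q.1 ∩ {x | 0 < if q.2 then cross q.1 x else cross x q.1}

lemma isOpen_wedge (r : ℝ) (q : ℂ) : IsOpen (wedge r q) := by
  refine isOpen_lt (continuous_norm.mul continuous_const) ?_
  unfold dot; fun_prop

lemma isOpen_halfWedge (r : ℝ) (q : ℂ × Bool) : IsOpen (halfWedge r q) := by
  refine (isOpen_wedge _ _).inter (isOpen_lt continuous_const ?_)
  split_ifs
  · exact continuous_cross_left _
  · exact continuous_cross_right _

/-- A rotation takes the real axis to the direction of `q.1`, preceded by complex conjugation for
the half on the other side; this reduces the claim to `volume_stdWedge_inter_ge`. -/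
lemma volume_halfWedge_inter_ge {r : ℝ} (hr : 0 < r) {q : ℂ × Bool}
    (hq : 2 * r ^ 2 ≤ Complex.normSq q.1) (hq' : Complex.normSq q.1 < 4 * r ^ 2) :
    ENNReal.ofReal (2 * r ^ 2 / Real.pi) * volume (halfWedge r q ∩ Metric.ball 0 1) ≤
      volume (halfWedge r q ∩ {x | dot x q.1 < Complex.normSq q.1 / 2}) := by
  obtain ⟨q, σ⟩ := q
  simp only at hq hq'
  set l := ‖q‖ with hl
  rw [normSq_eq_sq, ← hl] at hq hq'
  have hl0 : 0 < l := by
    rcases (norm_nonneg q).eq_or_lt with h | h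
    · rw [← hl] at h; rw [← h] at hq; nlinarith [pow_pos hr 2]
    · exact h
  have hl2 : l < 2 * r := lt_of_pow_lt_pow_left₀ 2 (by positivity) (by linarith)
  have hu : ‖q / l‖ = 1 := by
    rw [norm_div, Complex.norm_real, Real.norm_eq_abs, abs_of_pos hl0, ← hl, div_self hl0.ne']
  let ψ0 : ℂ ≃ₗᵢ[ℝ] ℂ := rotation ⟨q / l, by simpa [Submonoid.unitSphere] using hu⟩
  have hψ0 : ∀ z, ψ0 z = q / l * z := fun z => rotation_apply _ _
  have hq2 : q.re * q.re + q.im * q.im = l * l := by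
    rw [← Complex.normSq_apply, normSq_eq_sq, sq]
  have key : ∀ ψ : ℂ ≃ₗᵢ[ℝ] ℂ, (∀ z, dot (ψ z) q = l * z.re) →
      (∀ z, (if σ then cross q (ψ z) else cross (ψ z) q) = l * z.im) →
      ENNReal.ofReal (2 * r ^ 2 / Real.pi) * volume (halfWedge r (q, σ) ∩ Metric.ball 0 1) ≤
      volume (halfWedge r (q, σ) ∩ {x | dot x q < Complex.normSq q / 2}) := by
    intro ψ h1 h2
    have hvol : ∀ s : Set ℂ, MeasurableSet s → volume s = volume (ψ ⁻¹' s) := fun s hs =>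
      (ψ.measurePreserving.measure_preimage hs.nullMeasurableSet).symm
    have hw : ψ ⁻¹' (halfWedge r (q, σ)) = stdWedge (l / (2 * r)) := by
      ext z
      simp only [halfWedge, wedge, stdWedge, Set.mem_preimage, Set.mem_inter_iff,
        Set.mem_ofPred_eq, h1, h2, LinearIsometryEquiv.norm_map]
      refine and_congr ?_ ⟨fun h => pos_of_mul_pos_right h hl0.le, fun h => mul_pos hl0 h⟩
      rw [normSq_eq_sq, ← hl, mul_div_assoc', div_lt_iff₀ (by positivity)]
      constructor
      · intro h
        refine lt_of_mul_lt_mul_left ?_ hl0.le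
        linarith
      · intro h
        have := mul_lt_mul_of_pos_left h hl0
        linarith
    have hb : ψ ⁻¹' (Metric.ball 0 1) = Metric.ball 0 1 := by
      ext z; simp
    have hd : ψ ⁻¹' {x | dot x q < Complex.normSq q / 2} = {z | z.re < l / 2} := by
      ext z
      simp only [Set.mem_preimage, Set.mem_ofPred_eq, h1, normSq_eq_sq, ← hl]
      constructor
      · intro h
        refine lt_of_mul_lt_mul_left ?_ hl0.le
        linarith
      · intro h
        have := mul_lt_mul_of_pos_left h hl0
        linarith
    have hdo : IsOpen {x | dot x q < Complex.normSq q / 2} :=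
      isOpen_lt (by unfold dot; fun_prop) continuous_const
    rw [hvol _ ((isOpen_halfWedge r _).inter Metric.isOpen_ball).measurableSet,
      hvol _ ((isOpen_halfWedge r _).inter hdo).measurableSet, Set.preimage_inter,
      Set.preimage_inter, hw, hb, hd]
    exact volume_stdWedge_inter_ge hr hq hl0 hl2
  have ere : ∀ w : ℂ, (q / l * w).re = (q.re * w.re - q.im * w.im) / l := by
    intro w
    rw [div_mul_eq_mul_div, Complex.div_ofReal_re, Complex.mul_re]
  have eim : ∀ w : ℂ, (q / l * w).im = (q.re * w.im + q.im * w.re) / l := by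
    intro w
    rw [div_mul_eq_mul_div, Complex.div_ofReal_im, Complex.mul_im]
  cases σ
  · refine key (Complex.conjLIE.trans ψ0) (fun z => ?_) (fun z => ?_)
    · simp only [LinearIsometryEquiv.trans_apply, hψ0, dot, ere, eim, Complex.conjLIE_apply,
        Complex.conj_re, Complex.conj_im]
      field_simp
      linear_combination z.re * hq2
    · simp only [LinearIsometryEquiv.trans_apply, hψ0, cross, ere, eim, Complex.conjLIE_apply,
        Complex.conj_re, Complex.conj_im, Bool.false_eq_true, if_false]
      field_simp
      linear_combination z.im * hq2
  · refine key ψ0 (fun z => ?_) (fun z => ?_)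
    · simp only [hψ0, dot, ere, eim]
      field_simp
      linear_combination z.re * hq2
    · simp only [hψ0, cross, ere, eim, if_true]
      field_simp
      linear_combination z.im * hq2

lemma volume_line_eq_zero {q : ℂ} (hq : q ≠ 0) : volume {x | cross q x = 0} = 0 := by
  let f : ℂ →ₗ[ℝ] ℝ := q.re • Complex.imLm - q.im • Complex.reLm
  have hf : ∀ x, f x = cross q x := fun x => by simp [f, cross]
  have : {x | cross q x = 0} = (LinearMap.ker f : Set ℂ) := by
    ext x; simp [← hf]
  rw [this]
  refine Measure.addHaar_submodule volume _ fun h => hq ?_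
  rw [LinearMap.ker_eq_top] at h
  have h1 := hf 1
  have h2 := hf Complex.I
  rw [h] at h1 h2
  simp only [LinearMap.zero_apply, cross, Complex.one_im, Complex.one_re, Complex.I_re,
    Complex.I_im] at h1 h2
  exact Complex.ext (by rw [Complex.zero_re]; linarith) (by rw [Complex.zero_im]; linarith)

/-! ### The part of a Voronoi cell outside the small triangles -/

/-- The part of the truncated Voronoi cell of the origin outside the cones in `Tr`. -/
def restCell (r : ℝ) (nb : Finset ℂ) (Tr : Finset (ℂ × ℂ)) : Set ℂ :=
  {x | ‖x‖ < r ∧ (∀ q ∈ nb, dot x q < Complex.normSq q / 2) ∧ ∀ t ∈ Tr, x ∉ openCone t.1 t.2}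

lemma measurableSet_restCell (r : ℝ) (nb : Finset ℂ) (Tr : Finset (ℂ × ℂ)) :
    MeasurableSet (restCell r nb Tr) := by
  have : restCell r nb Tr = Metric.ball 0 r ∩ ((⋂ q ∈ nb, {x | dot x q < Complex.normSq q / 2}) ∩
      ⋂ t ∈ Tr, (openCone t.1 t.2)ᶜ) := by
    ext x; simp [restCell]
  rw [this]
  refine Metric.isOpen_ball.measurableSet.inter (MeasurableSet.inter ?_ ?_)
  · exact Finset.measurableSet_biInter _ fun q _ => IsOpen.measurableSet
      (isOpen_lt (by unfold dot; fun_prop) continuous_const)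
  · exact Finset.measurableSet_biInter _ fun t _ => (isOpen_openCone _ _).measurableSet.compl

/-- Up to null sets, the directions outside the cones consist of whole half wedges, which are
disjoint, and of a remainder C₀ that meets no wedge. Over C₀ the cell fills the disc of radius r, a
factor r² ≥ 2r²/π; over a half wedge it contains the triangle cut off by the bisector. -/
lemma volume_restCell_ge {r : ℝ} (hr : 0 < r) {S : Set ℂ} (hS : Separated r S) {p : ℂ} (hp : p ∈ S)
    {nb : Finset ℂ} (hnb : ∀ q, q ∈ nb ↔ q ≠ 0 ∧ p + q ∈ S ∧ Complex.normSq q < 4 * r ^ 2)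
    {Tr : Finset (ℂ × ℂ)} (hTr : ∀ t, t ∈ Tr ↔ p + t.1 ∈ S ∧ p + t.2 ∈ S ∧
      IsSmall r p (p + t.1) (p + t.2)) :
    ENNReal.ofReal (2 * r ^ 2 / Real.pi) *
      volume ((⋂ t ∈ Tr, (openCone t.1 t.2)ᶜ) ∩ Metric.ball 0 1) ≤ volume (restCell r nb Tr) := by
  classical
  have sep : ∀ {u v : ℂ}, p + u ∈ S → p + v ∈ S → u ≠ v → 2 * r ^ 2 ≤ Complex.normSq (u - v) := by
    intro u v hu hv huv
    simpa using hS _ hu _ hv (by simpa using huv)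
  have sep0 : ∀ {u : ℂ}, p + u ∈ S → u ≠ 0 → 2 * r ^ 2 ≤ Complex.normSq u := by
    intro u hu hu0
    simpa using hS _ hu _ hp (by simpa using hu0)
  have hTr0 : ∀ {a b : ℂ}, (a, b) ∈ Tr → a ≠ 0 ∧ b ≠ 0 ∧ a ≠ b := by
    intro a b h
    have hD : 0 < cross a b := by simpa using ((hTr _).1 h).2.2.1
    refine ⟨?_, ?_, ?_⟩
    · rintro rfl; simp [cross] at hD
    · rintro rfl; simp [cross] at hD
    · rintro rfl; simp [cross, mul_comm] at hD
  set C : Set ℂ := ⋂ t ∈ Tr, (openCone t.1 t.2)ᶜ with hC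
  have memC : ∀ x, x ∈ C ↔ ∀ t ∈ Tr, x ∉ openCone t.1 t.2 := by intro x; simp [hC]
  have hCm : MeasurableSet C :=
    Finset.measurableSet_biInter _ fun t _ => (isOpen_openCone _ _).measurableSet.compl
  -- Whether a half wedge avoids all cones depends only on whether its axis bounds a small triangle
  -- on that side: `F1` and `F2` below.
  set H : Finset (ℂ × Bool) := (nb ×ˢ Finset.univ).filter fun q =>
    ∀ b, (if q.2 then (q.1, b) else (b, q.1)) ∉ Tr with hH
  have memH : ∀ q : ℂ × Bool, q ∈ H ↔ q.1 ∈ nb ∧ ∀ b, (if q.2 then (q.1, b) else (b, q.1)) ∉ Tr := by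
    intro q; simp [hH]
  -- directions outside the cones belong to halves of wedges which avoid the cones
  have F1 : ∀ q ∈ nb, ∀ σ : Bool, ∀ x ∈ C, x ∈ halfWedge r (q, σ) → (q, σ) ∈ H := by
    intro q hq σ x hx hxw
    obtain ⟨hq0, hqS, -⟩ := (hnb q).1 hq
    refine (memH _).2 ⟨hq, fun b hb => ?_⟩
    cases σ
    · simp only [Bool.false_eq_true, if_false] at hb
      obtain ⟨hbS, -, hs⟩ := (hTr _).1 hb
      obtain ⟨hb0, -, hbq⟩ := hTr0 hb
      refine (memC x).1 hx _ hb ((mem_openCone_of_mem_wedge hr (sep0 hqS hq0) (sep0 hbS hb0)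
        (sep hbS hqS hbq) hxw.1).2 hs ?_)
      simpa using hxw.2
    · simp only [if_true] at hb
      obtain ⟨-, hbS, hs⟩ := (hTr _).1 hb
      obtain ⟨-, hb0, hbq⟩ := hTr0 hb
      refine (memC x).1 hx _ hb ((mem_openCone_of_mem_wedge hr (sep0 hqS hq0) (sep0 hbS hb0)
        (sep hbS hqS hbq.symm) hxw.1).1 hs ?_)
      simpa using hxw.2
  have F2 : ∀ q ∈ H, halfWedge r q ⊆ C := by
    rintro ⟨q, σ⟩ hq x hx
    obtain ⟨hqn, hqb⟩ := (memH _).1 hq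
    obtain ⟨hq0, hqS, -⟩ := (hnb q).1 hqn
    rw [memC]
    rintro ⟨a, b⟩ ht hxt
    obtain ⟨haS, hbS, hs⟩ := (hTr _).1 ht
    simp only at hxt
    rcases eq_of_mem_wedge_of_mem_openCone hr hS hp hqS haS hbS hs hq0 hx.1 hxt with rfl | rfl
    · cases σ
      · have h1 : 0 < cross x q := by simpa using hx.2
        have h2 := hxt.1
        simp only [cross] at h1 h2
        linarith
      · exact hqb b (by simpa using ht)
    · cases σ
      · exact hqb a (by simpa using ht)
      · have h1 : 0 < cross q x := by simpa using hx.2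
        have h2 := hxt.2
        simp only [cross] at h1 h2
        linarith
  have F3 : ∀ q ∈ nb, ∀ q' ∈ nb, ∀ x ∈ C, x ∈ wedge r q → x ∈ wedge r q' → q = q' := by
    intro q hq q' hq' x hx h h'
    by_contra hne
    obtain ⟨hq0, hqS, -⟩ := (hnb q).1 hq
    obtain ⟨hq0', hqS', -⟩ := (hnb q').1 hq'
    rcases isSmall_of_mem_wedge hr (p := p) (sep0 hqS hq0) (sep0 hqS' hq0') (sep hqS hqS' hne) h h'
      with ⟨h1, h2⟩ | ⟨h1, h2⟩
    · exact (memC x).1 hx (q, q') ((hTr _).2 ⟨hqS, hqS', h1⟩) h2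
    · exact (memC x).1 hx (q', q) ((hTr _).2 ⟨hqS', hqS, h1⟩) h2
  set C₀ : Set ℂ := C \ ⋃ q ∈ nb, wedge r q with hC₀
  have hC₀m : MeasurableSet C₀ :=
    hCm.diff (Finset.measurableSet_biUnion _ fun q _ => (isOpen_wedge r q).measurableSet)
  -- the upper bound for the angle
  have hup : volume (C ∩ Metric.ball 0 1) ≤
      volume (C₀ ∩ Metric.ball 0 1) + ∑ q ∈ H, volume (halfWedge r q ∩ Metric.ball 0 1) := by
    have hsub : C ∩ Metric.ball 0 1 ⊆ (C₀ ∩ Metric.ball 0 1) ∪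
        (⋃ q ∈ H, halfWedge r q ∩ Metric.ball 0 1) ∪ ⋃ q ∈ nb, {x | cross q x = 0} := by
      rintro x ⟨hx, hxb⟩
      by_cases hw : ∃ q ∈ nb, x ∈ wedge r q
      · obtain ⟨q, hq, hxq⟩ := hw
        have main : ∀ σ, x ∈ halfWedge r (q, σ) → x ∈ (C₀ ∩ Metric.ball 0 1) ∪
            (⋃ q ∈ H, halfWedge r q ∩ Metric.ball 0 1) ∪ ⋃ q ∈ nb, {x | cross q x = 0} := by
          intro σ hσ
          refine Or.inl (Or.inr ?_)
          simp only [Set.mem_iUnion]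
          exact ⟨(q, σ), F1 q hq σ x hx hσ, hσ, hxb⟩
        rcases lt_trichotomy 0 (cross q x) with h | h | h
        · exact main true ⟨hxq, by simpa using h⟩
        · refine Or.inr ?_
          simp only [Set.mem_iUnion]
          exact ⟨q, hq, h.symm⟩
        · refine main false ⟨hxq, ?_⟩
          simp only [cross, Bool.false_eq_true, if_false, Set.mem_ofPred_eq] at h ⊢
          linarith
      · refine Or.inl (Or.inl ⟨⟨hx, ?_⟩, hxb⟩)
        simpa using hw
    refine (measure_mono hsub).trans ((measure_union_le _ _).trans ?_)
    have hz : volume (⋃ q ∈ nb, {x | cross q x = 0}) = 0 := by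
      refine (measure_biUnion_null_iff nb.countable_toSet).2 fun q hq => ?_
      exact volume_line_eq_zero ((hnb q).1 hq).1
    rw [hz, add_zero]
    exact (measure_union_le _ _).trans (add_le_add le_rfl (measure_biUnion_finset_le _ _))
  -- the lower bound for the area
  set Tq : ℂ × Bool → Set ℂ := fun q => halfWedge r q ∩ {x | dot x q.1 < Complex.normSq q.1 / 2}
    with hTq
  have hTqo : ∀ q, IsOpen (Tq q) := fun q => (isOpen_halfWedge r q).inter
    (isOpen_lt (by unfold dot; fun_prop) continuous_const)
  -- Inside the disc of radius r, the bisector of q is only reached within the wedge of q.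
  have hfar : ∀ q ∈ nb, ∀ x, ‖x‖ < r → x ∉ wedge r q → dot x q < Complex.normSq q / 2 := by
    intro q hq x hx hxw
    obtain ⟨hq0, hqS, -⟩ := (hnb q).1 hq
    have hN : 0 < Complex.normSq q := Complex.normSq_pos.2 hq0
    simp only [wedge, Set.mem_ofPred_eq, not_lt] at hxw
    have := mul_lt_mul_of_pos_right hx hN
    have : r * (2 * dot x q) < r * Complex.normSq q := by linarith
    have := lt_of_mul_lt_mul_left this hr.le
    linarith
  have hlow : volume (C₀ ∩ Metric.ball 0 r) + ∑ q ∈ H, volume (Tq q) ≤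
      volume (restCell r nb Tr) := by
    have hdis1 : (↑H : Set (ℂ × Bool)).PairwiseDisjoint Tq := by
      rintro ⟨q, σ⟩ hq ⟨q', σ'⟩ hq' hne
      rw [Function.onFun, Set.disjoint_left]
      intro x hx hx'
      have hq1 := ((memH _).1 hq).1
      have hq1' := ((memH _).1 hq').1
      have := F3 q hq1 q' hq1' x (F2 _ hq hx.1) hx.1.1 hx'.1.1
      subst this
      have h1 := hx.1.2
      have h2 := hx'.1.2
      cases σ <;> cases σ' <;> first | exact hne rfl | skip
      all_goals
        simp only [Set.mem_ofPred_eq, cross, Bool.false_eq_true, if_false, if_true] at h1 h2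
        linarith
    have hdis2 : Disjoint (C₀ ∩ Metric.ball 0 r) (⋃ q ∈ H, Tq q) := by
      rw [Set.disjoint_left]
      rintro x ⟨⟨-, hx⟩, -⟩ hx'
      simp only [Set.mem_iUnion, not_exists] at hx hx'
      obtain ⟨q, hq, hxq⟩ := hx'
      exact hx q.1 ((memH _).1 hq).1 hxq.1.1
    rw [← measure_biUnion_finset hdis1 fun q _ => (hTqo q).measurableSet,
      ← measure_union hdis2 (Finset.measurableSet_biUnion _ fun q _ => (hTqo q).measurableSet)]
    refine measure_mono (Set.union_subset ?_ ?_)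
    · rintro x ⟨⟨hx, hxw⟩, hxr⟩
      rw [mem_ball_zero_iff] at hxr
      simp only [Set.mem_iUnion, not_exists] at hxw
      exact ⟨hxr, fun q hq => hfar q hq x hxr (hxw q hq), (memC x).1 hx⟩
    · intro x hx
      simp only [Set.mem_iUnion] at hx
      obtain ⟨q, hq, hxq⟩ := hx
      have hqn := ((memH _).1 hq).1
      have hxC := F2 _ hq hxq.1
      have hN : 0 < Complex.normSq q.1 := Complex.normSq_pos.2 ((hnb _).1 hqn).1
      have h1 : ‖x‖ * Complex.normSq q.1 < 2 * r * dot x q.1 := hxq.1.1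
      have h2 : dot x q.1 < Complex.normSq q.1 / 2 := hxq.2
      have hxr : ‖x‖ < r := by
        refine lt_of_mul_lt_mul_right ?_ hN.le
        have := mul_lt_mul_of_pos_left h2 hr
        linarith
      refine ⟨hxr, fun q' hq' => ?_, (memC x).1 hxC⟩
      by_cases h : q' = q.1
      · rw [h]; exact h2
      · exact hfar q' hq' x hxr fun hw => h (F3 _ hq' _ hqn x hxC hw hxq.1.1)
  have hscale : volume (C₀ ∩ Metric.ball 0 r) =
      ENNReal.ofReal (r ^ 2) * volume (C₀ ∩ Metric.ball 0 1) := by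
    have hcone : ∀ (t : ℝ) (x : ℂ), 0 < t → (t • x ∈ C₀ ↔ x ∈ C₀) := by
      intro t x ht
      have hc : ∀ u v : ℂ, t • x ∈ openCone u v ↔ x ∈ openCone u v := by
        intro u v
        have e1 : cross u (t • x) = t * cross u x := by
          simp only [cross, Complex.smul_re, Complex.smul_im, smul_eq_mul]; ring
        have e2 : cross (t • x) v = t * cross x v := by
          simp only [cross, Complex.smul_re, Complex.smul_im, smul_eq_mul]; ring
        simp only [openCone, Set.mem_ofPred_eq, e1, e2, mul_pos_iff_of_pos_left ht]
      have hw : ∀ q : ℂ, t • x ∈ wedge r q ↔ x ∈ wedge r q := by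
        intro q
        have e : dot (t • x) q = t * dot x q := by
          simp only [dot, Complex.smul_re, Complex.smul_im, smul_eq_mul]; ring
        simp only [wedge, Set.mem_ofPred_eq, e, norm_smul, Real.norm_eq_abs, abs_of_pos ht]
        rw [mul_assoc t, mul_left_comm (2 * r), mul_lt_mul_iff_of_pos_left ht]
      simp only [hC₀, Set.mem_sdiff, memC, hc, Set.mem_iUnion, hw]
    have : C₀ ∩ Metric.ball 0 r = r • (C₀ ∩ Metric.ball 0 1) := by
      ext x
      rw [Set.mem_smul_set_iff_inv_smul_mem₀ hr.ne']
      simp only [Set.mem_inter_iff, hcone _ _ (inv_pos.2 hr), mem_ball_zero_iff, norm_smul,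
        norm_inv, Real.norm_eq_abs, abs_of_pos hr]
      rw [inv_mul_lt_iff₀ hr, mul_one]
    rw [this, Measure.addHaar_smul, Complex.finrank_real_complex, abs_of_pos (by positivity)]
  calc _ ≤ ENNReal.ofReal (2 * r ^ 2 / Real.pi) * (volume (C₀ ∩ Metric.ball 0 1) +
        ∑ q ∈ H, volume (halfWedge r q ∩ Metric.ball 0 1)) := by gcongr
    _ = ENNReal.ofReal (2 * r ^ 2 / Real.pi) * volume (C₀ ∩ Metric.ball 0 1) +
        ∑ q ∈ H, ENNReal.ofReal (2 * r ^ 2 / Real.pi) *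
          volume (halfWedge r q ∩ Metric.ball 0 1) := by rw [mul_add, Finset.mul_sum]
    _ ≤ volume (C₀ ∩ Metric.ball 0 r) + ∑ q ∈ H, volume (Tq q) := by
        refine add_le_add ?_ (Finset.sum_le_sum fun q hq => ?_)
        · rw [hscale]
          gcongr
          rw [div_le_iff₀ Real.pi_pos]
          nlinarith [Real.two_le_pi, pow_pos hr 2]
        · obtain ⟨h1, h2, h3⟩ := (hnb q.1).1 ((memH _).1 hq).1
          exact volume_halfWedge_inter_ge hr (sep0 h2 h1) h3
    _ ≤ _ := hlow

/-! ### Distribution of the plane area among the points -/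

/-- The neighbours of `p`, as vectors. -/
def neighbours (r : ℝ) (S : Set ℂ) (p : ℂ) : Set ℂ :=
  {q | q ≠ 0 ∧ p + q ∈ S ∧ Complex.normSq q < 4 * r ^ 2}

/-- The small triangles with vertex `p`, as pairs of vectors. -/
def smallTriangles (r : ℝ) (S : Set ℂ) (p : ℂ) : Set (ℂ × ℂ) :=
  {t | p + t.1 ∈ S ∧ p + t.2 ∈ S ∧ IsSmall r p (p + t.1) (p + t.2)}

lemma finite_neighbours {r : ℝ} (hr : 0 < r) {S : Set ℂ} (hS : Separated r S) (p : ℂ) :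
    (neighbours r S p).Finite := by
  have hpw : S.Pairwise fun x y => r ≤ dist x y := by
    intro x hx y hy hxy
    have := hS x hx y hy hxy
    rw [normSq_eq_sq, ← dist_eq_norm] at this
    exact le_of_sq_le_sq (by nlinarith [pow_pos hr 2]) dist_nonneg
  have h := finite_inter_of_pairwise_le_dist hr hpw (Metric.isBounded_ball (x := p) (r := 2 * r))
  refine (h.preimage (f := fun q => p + q) (add_right_injective p).injOn).subset ?_
  rintro q ⟨-, hq, hq'⟩
  refine ⟨?_, hq⟩
  rw [Metric.mem_ball, dist_eq_norm, add_sub_cancel_left]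
  rw [normSq_eq_sq] at hq'
  exact lt_of_pow_lt_pow_left₀ 2 (by positivity) (by linarith)

lemma smallTriangles_subset {r : ℝ} {S : Set ℂ} {p : ℂ} :
    smallTriangles r S p ⊆ neighbours r S p ×ˢ neighbours r S p := by
  rintro ⟨a, b⟩ ⟨ha, hb, hD, y, h1, h2, h3⟩
  simp only [add_sub_cancel_left] at hD
  refine ⟨⟨?_, ha, ?_⟩, ⟨?_, hb, ?_⟩⟩
  · rintro rfl; simp [cross] at hD
  · simpa using normSq_sub_lt_of_near h2 h1
  · rintro rfl; simp [cross] at hD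
  · simpa using normSq_sub_lt_of_near h3 h1

lemma sum_insert_le' {α : Type*} [DecidableEq α] (f : α → ENNReal) (a : α) (s : Finset α) :
    ∑ x ∈ insert a s, f x ≤ f a + ∑ x ∈ s, f x := by
  by_cases h : a ∈ s
  · rw [Finset.insert_eq_of_mem h]; exact le_add_self
  · rw [Finset.sum_insert h]

/-- In a separated plane set in which every triangle with short sides has area at least `A`,
every point may be given an amount `2 * A` of area, distributed over its neighbourhood, in such a
way that no point of the plane is used more than once. -/
theorem exists_area_distribution {S : Set ℂ} {r A : ℝ} (hr : 0 < r) (hA : 0 < A) (hAr : A ≤ r ^ 2)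
    (hS : Separated r S)
    (htri : ∀ p ∈ S, ∀ a ∈ S, ∀ b ∈ S, Complex.normSq (a - p) < 4 * r ^ 2 →
      Complex.normSq (b - p) < 4 * r ^ 2 → Complex.normSq (a - b) < 4 * r ^ 2 →
      0 < cross (a - p) (b - p) → 2 * A ≤ cross (a - p) (b - p)) :
    ∃ g : ℂ → ℂ → ENNReal, (∀ p ∈ S, Measurable (g p)) ∧
      (∀ p ∈ S, ENNReal.ofReal (2 * A) ≤ ∫⁻ x, g p x) ∧
      (∀ p ∈ S, ∀ x, g p x ≠ 0 → dist x p ≤ 3 * r) ∧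
      (∀ x, ∀ F : Finset ℂ, ↑F ⊆ S → ∑ p ∈ F, g p x ≤ 1) := by
  classical
  have hfin : ∀ p, (neighbours r S p).Finite := finite_neighbours hr hS
  have hfin' : ∀ p, (smallTriangles r S p).Finite := fun p =>
    ((hfin p).prod (hfin p)).subset smallTriangles_subset
  set nb : ℂ → Finset ℂ := fun p => (hfin p).toFinset with hnb
  set Tr : ℂ → Finset (ℂ × ℂ) := fun p => (hfin' p).toFinset with hTr
  have mem_nb : ∀ p q, q ∈ nb p ↔ q ≠ 0 ∧ p + q ∈ S ∧ Complex.normSq q < 4 * r ^ 2 := by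
    intro p q; simp [hnb, neighbours]
  have mem_Tr : ∀ p t, t ∈ Tr p ↔ p + t.1 ∈ S ∧ p + t.2 ∈ S ∧
      IsSmall r p (p + t.1) (p + t.2) := by
    intro p t; simp [hTr, smallTriangles]
  set κ : ENNReal := ENNReal.ofReal (2 / Real.pi) with hκ
  set rest : ℂ → Set ℂ := fun p => (fun x => x - p) ⁻¹' restCell r (nb p) (Tr p) with hrest
  set T : ℂ → ℂ × ℂ → Set ℂ := fun p t => openTriangle p (p + t.1) (p + t.2) with hT
  have hrestm : ∀ p, MeasurableSet (rest p) := fun p =>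
    (measurableSet_restCell _ _ _).preimage (by fun_prop)
  have hTm : ∀ p t, MeasurableSet (T p t) := fun p t => (isOpen_openTriangle _ _ _).measurableSet
  -- The factor κ · `sectorArea` is the angle at p divided by π, so the shares of one triangle add
  -- up to at most 1.
  set g : ℂ → ℂ → ENNReal := fun p x => (rest p).indicator 1 x +
    ∑ t ∈ Tr p, κ * sectorArea t.1 t.2 * (T p t).indicator 1 x with hg
  have hgm1 : ∀ p, Measurable ((rest p).indicator (1 : ℂ → ENNReal)) := fun p =>
    measurable_one.indicator (hrestm p)
  have hgm2 : ∀ p t, Measurable fun x => κ * sectorArea t.1 t.2 *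
      (T p t).indicator (1 : ℂ → ENNReal) x := fun p t =>
    (measurable_one.indicator (hTm p t)).const_mul _
  have hnear : ∀ p ∈ S, ∀ x ∈ rest p, ∀ q ∈ S, q ≠ p →
      Complex.normSq (x - p) < Complex.normSq (x - q) := by
    intro p hp x hx q hq hqp
    obtain ⟨h1, h2, -⟩ := hx
    simp only at h1 h2
    by_cases hc : Complex.normSq (q - p) < 4 * r ^ 2
    · have := h2 (q - p) ((mem_nb _ _).2 ⟨sub_ne_zero.2 hqp, by simpa using hq, hc⟩)
      simp only [dot, Complex.normSq_apply, Complex.sub_re, Complex.sub_im] at this ⊢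
      nlinarith
    -- A point at distance at least 2r is farther from x than p is, because ‖x − p‖ < r. So the
    -- neighbours suffice to define the truncated cell.
    · push Not at hc
      rw [normSq_eq_sq] at hc ⊢
      rw [normSq_eq_sq]
      have h3 : 2 * r ≤ ‖q - p‖ := by
        refine le_of_sq_le_sq ?_ (norm_nonneg _)
        linarith
      have h4 : ‖q - p‖ ≤ ‖x - p‖ + ‖x - q‖ := by
        have := norm_sub_le (x - p) (x - q)
        simpa using this
      exact pow_lt_pow_left₀ (by linarith) (norm_nonneg _) two_ne_zero
  refine ⟨g, fun p _ => (hgm1 p).add (Finset.measurable_fun_sum _ fun t _ => hgm2 p t), ?_, ?_, ?_⟩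
  · intro p hp
    have hvol : ∀ t ∈ Tr p, ENNReal.ofReal A ≤ volume (T p t) := by
      intro t ht
      obtain ⟨h1, h2, h3⟩ := (mem_Tr p t).1 ht
      rw [hT, volume_openTriangle h3.1]
      refine ENNReal.ofReal_le_ofReal ?_
      obtain ⟨hD, y, y1, y2, y3⟩ := h3
      have := htri p hp _ h1 _ h2 (normSq_sub_lt_of_near y2 y1) (normSq_sub_lt_of_near y3 y1)
        (normSq_sub_lt_of_near y2 y3) hD
      linarith
    have htotal : ∫⁻ x, g p x = volume (rest p) +
        ∑ t ∈ Tr p, κ * sectorArea t.1 t.2 * volume (T p t) := by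
      simp only [hg]
      rw [lintegral_add_left (hgm1 p), lintegral_finsetSum _ fun t _ => hgm2 p t,
        lintegral_indicator_one (hrestm p)]
      congr 1
      refine Finset.sum_congr rfl fun t _ => ?_
      rw [lintegral_const_mul _ (measurable_one.indicator (hTm p t)),
        lintegral_indicator_one (hTm p t)]
    have hr1 : volume (rest p) = volume (restCell r (nb p) (Tr p)) := by
      simp only [hrest, sub_eq_add_neg]
      exact measure_preimage_add_right _ _ _
    have hmain := volume_restCell_ge hr hS hp (mem_nb p) (mem_Tr p)
    set C : Set ℂ := ⋂ t ∈ Tr p, (openCone t.1 t.2)ᶜ with hC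
    have hcover : ENNReal.ofReal Real.pi ≤
        volume (C ∩ Metric.ball 0 1) + ∑ t ∈ Tr p, sectorArea t.1 t.2 := by
      rw [← volume_unit_disc]
      have : Metric.ball (0 : ℂ) 1 ⊆ (C ∩ Metric.ball 0 1) ∪
          ⋃ t ∈ Tr p, openCone t.1 t.2 ∩ Metric.ball 0 1 := by
        intro x hx
        by_cases h : x ∈ C
        · exact Or.inl ⟨h, hx⟩
        · right
          simp only [hC, Set.mem_iInter, Set.mem_compl_iff, not_forall, not_not] at h
          obtain ⟨t, ht, hxt⟩ := h
          simp only [Set.mem_iUnion]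
          exact ⟨t, ht, hxt, hx⟩
      refine (measure_mono this).trans ((measure_union_le _ _).trans ?_)
      exact add_le_add le_rfl (measure_biUnion_finset_le _ _)
    -- Each unit of sector area, of which there are π in all, is worth κA: in a cone because the
    -- triangle has area at least A, elsewhere because 2r²/π ≥ κA.
    calc ENNReal.ofReal (2 * A) = ENNReal.ofReal A * κ * ENNReal.ofReal Real.pi := by
          rw [hκ, ← ENNReal.ofReal_mul hA.le, ← ENNReal.ofReal_mul (by positivity)]
          congr 1
          field_simp
      _ ≤ ENNReal.ofReal A * κ * (volume (C ∩ Metric.ball 0 1) +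
            ∑ t ∈ Tr p, sectorArea t.1 t.2) := by gcongr
      _ = ENNReal.ofReal A * κ * volume (C ∩ Metric.ball 0 1) +
            ∑ t ∈ Tr p, κ * sectorArea t.1 t.2 * ENNReal.ofReal A := by
          rw [mul_add, Finset.mul_sum]
          congr 1
          refine Finset.sum_congr rfl fun t _ => ?_
          ring
      _ ≤ _ := by
          rw [htotal, hr1]
          refine add_le_add (le_trans ?_ hmain) (Finset.sum_le_sum fun t ht => ?_)
          · gcongr
            rw [hκ, ← ENNReal.ofReal_mul hA.le]
            refine ENNReal.ofReal_le_ofReal ?_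
            rw [mul_div_assoc', div_le_div_iff_of_pos_right Real.pi_pos]
            linarith
          · gcongr
            exact hvol t ht
  · intro p hp x hx
    by_cases h : x ∈ rest p
    · have : ‖x - p‖ < r := h.1
      rw [dist_eq_norm]; linarith
    · have : ∑ t ∈ Tr p, κ * sectorArea t.1 t.2 * (T p t).indicator 1 x ≠ 0 := by
        intro h0; apply hx
        simp only [hg]
        rw [h0, Set.indicator_of_notMem h, zero_add]
      obtain ⟨t, ht, htx⟩ := Finset.exists_ne_zero_of_sum_ne_zero this
      have hxT : x ∈ T p t := by
        by_contra hn
        rw [Set.indicator_of_notMem hn, mul_zero] at htx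
        exact htx rfl
      obtain ⟨h1, h2, hD, y, y1, y2, y3⟩ := (mem_Tr p t).1 ht
      have hsub : Convex ℝ (Metric.ball y r) := convex_ball y r
      have hxy : x ∈ Metric.ball y r := by
        obtain ⟨e1, e2, e3⟩ := openTriangle_weights (p := p) (a := p + t.1) (b := p + t.2) (x := x)
        have hD' := hD
        obtain ⟨w3, w1, w2⟩ := hxT
        have hmem : ∀ v, Complex.normSq (v - y) < r ^ 2 → v ∈ Metric.ball y r := by
          intro v hv
          rw [Metric.mem_ball, dist_eq_norm]
          rw [normSq_eq_sq] at hv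
          exact lt_of_pow_lt_pow_left₀ 2 hr.le hv
        generalize cross (p + t.1 - p) (p + t.2 - p) = D at *
        have := hsub.sum_mem (t := (Finset.univ : Finset (Fin 3)))
          (w := ![cross (p + t.2 - (p + t.1)) (x - (p + t.1)) / D,
            cross (p - (p + t.2)) (x - (p + t.2)) / D, cross (p + t.1 - p) (x - p) / D])
          (z := ![p, p + t.1, p + t.2]) ?_ ?_ ?_
        · convert this using 1
          simp only [Fin.sum_univ_three, Matrix.cons_val]
          apply Complex.ext
          · simp only [Complex.add_re, Complex.smul_re, smul_eq_mul] at e2 ⊢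
            field_simp
            linear_combination -e2
          · simp only [Complex.add_im, Complex.smul_im, smul_eq_mul] at e3 ⊢
            field_simp
            linear_combination -e3
        · intro i _
          fin_cases i
          · exact (div_pos w1 hD).le
          · exact (div_pos w2 hD).le
          · exact (div_pos w3 hD).le
        · simp only [Fin.sum_univ_three, Matrix.cons_val]
          rw [← add_div, ← add_div, e1, div_self hD.ne']
        · intro i _
          fin_cases i
          · exact hmem _ y1
          · exact hmem _ y2
          · exact hmem _ y3
      rw [Metric.mem_ball] at hxy
      have hpy : dist p y < r := by
        rw [normSq_eq_sq] at y1
        rw [dist_eq_norm]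
        exact lt_of_pow_lt_pow_left₀ 2 hr.le y1
      linarith [dist_triangle_right x p y]
  · intro x F hF
    by_cases hx : ∃ p ∈ S, ∃ t ∈ Tr p, x ∈ T p t
    · obtain ⟨p, hp, t, ht, hxt⟩ := hx
      obtain ⟨ha, hb, hs⟩ := (mem_Tr p t).1 ht
      set a := p + t.1 with hadef
      set b := p + t.2 with hbdef
      -- No rest cell meets a small triangle: at a vertex the cone has been removed, and any other
      -- point is beaten by some vertex.
      have hrest0 : ∀ q ∈ S, x ∉ rest q := by
        intro q hq hxq
        have hn := hnear q hq x hxq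
        by_cases hqv : q = p ∨ q = a ∨ q = b
        · have aux : ∀ u v, IsSmall r q u v → u ∈ S → v ∈ S → x ∈ openTriangle q u v → False := by
            intro u v hs hu hv hxu
            refine hxq.2.2 (u - q, v - q) ((mem_Tr _ _).2 ?_)
              (sub_mem_openCone_of_mem_openTriangle hxu)
            simpa using ⟨hu, hv, hs⟩
          rcases hqv with rfl | rfl | rfl
          · exact aux a b hs ha hb hxt
          · exact aux b p hs.rotate hb hp (openTriangle_rotate p a b ▸ hxt)
          · exact aux p a hs.rotate.rotate hp ha
              (openTriangle_rotate a b p ▸ openTriangle_rotate p a b ▸ hxt)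
        · push Not at hqv
          exact not_nearest_of_mem_openTriangle hS hp ha hb hq hs hxt hqv.1 hqv.2.1 hqv.2.2
            (hn p hp hqv.1.symm).le (hn a ha hqv.2.1.symm).le (hn b hb hqv.2.2.symm).le
      have hval : ∀ q ∈ S, ∀ u v, IsSmall r q u v → u ∈ S → v ∈ S → x ∈ openTriangle q u v →
          g q x = κ * sectorArea (u - q) (v - q) := by
        intro q hq u v hsq hu hv hxu
        simp only [hg]
        rw [Set.indicator_of_notMem (hrest0 q hq), zero_add]
        rw [Finset.sum_eq_single_of_mem (u - q, v - q)
          ((mem_Tr _ _).2 (by simpa using ⟨hu, hv, hsq⟩))]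
        · rw [Set.indicator_of_mem]
          · simp
          · simpa [hT] using hxu
        · rintro ⟨u', v'⟩ ht' hne
          rw [Set.indicator_of_notMem, mul_zero]
          intro hx'
          obtain ⟨hu', hv', hs'⟩ := (mem_Tr _ _).1 ht'
          simp only at hu' hv' hs'
          have heq := vertices_eq_of_mem_openTriangle hS hq hu hv hq hu' hv' hsq hs' hxu hx'
          have hD1 := hsq.1
          have hD2 := hs'.1
          have m1 : q + u' ∈ ({q, u, v} : Finset ℂ) := by rw [heq]; simp
          have m2 : q + v' ∈ ({q, u, v} : Finset ℂ) := by rw [heq]; simp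
          simp only [Finset.mem_insert, Finset.mem_singleton] at m1 m2
          simp only [add_sub_cancel_left] at hD2
          rcases m1 with m1 | m1 | m1
          · have : u' = 0 := by simpa using m1
            rw [this] at hD2; simp [cross] at hD2
          · rcases m2 with m2 | m2 | m2
            · have : v' = 0 := by simpa using m2
              rw [this] at hD2; simp [cross] at hD2
            · have : u' = v' := by
                have := m1.trans m2.symm
                simpa using this
              rw [this] at hD2; simp [cross, mul_comm] at hD2
            · apply hne
              rw [← m1, ← m2]; simp
          · rcases m2 with m2 | m2 | m2
            · have : v' = 0 := by simpa using m2
              rw [this] at hD2; simp [cross] at hD2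
            · rw [← m1, ← m2] at hD1
              simp only [add_sub_cancel_left, cross] at hD1 hD2
              linarith
            · have : u' = v' := by
                have := m1.trans m2.symm
                simpa using this
              rw [this] at hD2; simp [cross, mul_comm] at hD2
      have hzero : ∀ q ∈ F, q ∉ ({p, a, b} : Finset ℂ) → g q x = 0 := by
        intro q hq hqv
        have hqS := hF hq
        simp only [hg]
        rw [Set.indicator_of_notMem (hrest0 q hqS), zero_add]
        refine Finset.sum_eq_zero fun t' ht' => ?_
        rw [Set.indicator_of_notMem, mul_zero]
        intro hx'
        obtain ⟨hu', hv', hs'⟩ := (mem_Tr _ _).1 ht'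
        refine hqv ?_
        rw [vertices_eq_of_mem_openTriangle hS hp ha hb hqS hu' hv' hs hs' hxt hx']
        simp
      have hsum := sectorArea_add_le (a - p) (b - p)
      have hxa : x ∈ openTriangle a b p := openTriangle_rotate p a b ▸ hxt
      have hxb : x ∈ openTriangle b p a := openTriangle_rotate a b p ▸ hxa
      calc ∑ q ∈ F, g q x ≤ ∑ q ∈ ({p, a, b} : Finset ℂ), g q x := by
            refine (Finset.sum_subset_zero_on_sdiff (s₁ := F ∩ {p, a, b}) (s₂ := F)
              Finset.inter_subset_left (fun q hq => ?_) fun q _ => rfl).symm.le.trans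
              (Finset.sum_le_sum_of_subset Finset.inter_subset_right)
            rw [Finset.mem_sdiff, Finset.mem_inter] at hq
            exact hzero q hq.1 fun h => hq.2 ⟨hq.1, h⟩
        _ ≤ g p x + g a x + g b x := by
            have h1 := sum_insert_le' (fun q => g q x) p {a, b}
            have h2 := sum_insert_le' (fun q => g q x) a {b}
            rw [Finset.sum_singleton] at h2
            rw [add_assoc]
            exact h1.trans (add_le_add le_rfl h2)
        _ = κ * (sectorArea (a - p) (b - p) + sectorArea (b - p - (a - p)) (-(a - p)) +
              sectorArea (-(b - p)) (a - p - (b - p))) := by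
            rw [hval p hp a b hs ha hb hxt, hval a ha b p hs.rotate hb hp hxa,
              hval b hb p a hs.rotate.rotate hp ha hxb]
            rw [sub_sub_sub_cancel_right, sub_sub_sub_cancel_right, neg_sub, neg_sub]
            ring
        _ ≤ 1 := by
            have e : κ = ENNReal.ofReal (1 / Real.pi) * 2 := by
              rw [hκ, show (2 : ENNReal) = ENNReal.ofReal 2 by simp,
                ← ENNReal.ofReal_mul (by positivity)]
              congr 1; ring
            rw [e, mul_assoc]
            refine (mul_le_mul_right hsum _).trans ?_
            rw [← ENNReal.ofReal_mul (by positivity)]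
            simp [Real.pi_ne_zero]
    · push Not at hx
      have hgx : ∀ q ∈ S, g q x = (rest q).indicator 1 x := by
        intro q hq
        simp only [hg]
        rw [Finset.sum_eq_zero, add_zero]
        intro t ht
        rw [Set.indicator_of_notMem (hx q hq t ht), mul_zero]
      rw [Finset.sum_congr rfl fun q hq => hgx q (hF hq)]
      by_cases hr' : ∃ q ∈ F, x ∈ rest q
      · obtain ⟨q, hq, hxq⟩ := hr'
        rw [Finset.sum_eq_single_of_mem q hq, Set.indicator_of_mem hxq]
        · rfl
        · intro q' hq' hne
          rw [Set.indicator_of_notMem]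
          intro hx'
          have h1 := hnear q (hF hq) x hxq q' (hF hq') hne
          have h2 := hnear q' (hF hq') x hx' q (hF hq) hne.symm
          linarith
      · push Not at hr'
        rw [Finset.sum_eq_zero fun q hq => Set.indicator_of_notMem (hr' q hq) _]
        exact zero_le_one

/-! ### Counting centres -/

lemma volume_closedBall_E3 (x : E3) {R : ℝ} (hR : 0 ≤ R) :
    volume (Metric.closedBall x R) = ENNReal.ofReal (4 * Real.pi / 3 * R ^ 3) := by
  rw [EuclideanSpace.volume_closedBall_fin_three, ← ENNReal.ofReal_pow hR,
    ← ENNReal.ofReal_mul (by positivity)]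
  congr 1; ring

/-- Counting centres changes the radius R by a bounded amount a, which is harmless in the limit. -/
lemma tendsto_ratio (K a : ℝ) :
    Filter.Tendsto (fun R : ℝ => ENNReal.ofReal (K * ((R + a) / R) ^ 3)) Filter.atTop
      (nhds (ENNReal.ofReal K)) := by
  refine ENNReal.tendsto_ofReal ?_
  have h1 : Filter.Tendsto (fun R : ℝ => (R + a) / R) Filter.atTop (nhds 1) := by
    have : Filter.Tendsto (fun R : ℝ => 1 + a / R) Filter.atTop (nhds (1 + 0)) :=
      tendsto_const_nhds.add (tendsto_const_nhds.div_atTop Filter.tendsto_id)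
    rw [add_zero] at this
    refine this.congr' ?_
    filter_upwards [Filter.eventually_gt_atTop 0] with R hR
    field_simp
  simpa using (h1.pow 3).const_mul K

lemma coveredPortion_eq_of_pos {U : Set E3} {R : ℝ} (hR : 0 < R) :
    coveredPortion U R =
      volume (U ∩ Metric.closedBall 0 R) / ENNReal.ofReal (4 * Real.pi / 3 * R ^ 3) := by
  rw [coveredPortion, volume_closedBall_E3 0 hR.le]

/-- If every point of `X` may be given an amount `V` of volume, distributed over its
neighbourhood, without using any point of space more than once, then unit balls with centres in
`X` cover at most a proportion `4π / (3V)` of space. -/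
theorem upperDensity_le_of_distribution {X U : Set E3} {V ρ : ℝ} (hV : 0 < V) (hρ : 0 ≤ ρ)
    (hU : U ⊆ ⋃ x ∈ X, Metric.closedBall x 1) (G : E3 → E3 → ENNReal)
    (hGm : ∀ x ∈ X, Measurable (G x)) (hGi : ∀ x ∈ X, ENNReal.ofReal V ≤ ∫⁻ y, G x y)
    (hGs : ∀ x ∈ X, ∀ y, G x y ≠ 0 → dist y x ≤ ρ)
    (hG1 : ∀ y, ∀ F : Finset E3, ↑F ⊆ X → ∑ x ∈ F, G x y ≤ 1) :
    upperDensity U ≤ ENNReal.ofReal (4 * Real.pi / 3 / V) := by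
  have hcount : ∀ (R : ℝ), 0 ≤ R → ∀ F : Finset E3, ↑F ⊆ X ∩ Metric.closedBall 0 R →
      (F.card : ℝ) * V ≤ 4 * Real.pi / 3 * (R + ρ) ^ 3 := by
    intro R hR F hF
    have h : (F.card : ENNReal) * ENNReal.ofReal V ≤ volume (Metric.closedBall (0 : E3) (R + ρ)) := by
      calc (F.card : ENNReal) * ENNReal.ofReal V = ∑ x ∈ F, ENNReal.ofReal V := by simp
        _ ≤ ∑ x ∈ F, ∫⁻ y, G x y := Finset.sum_le_sum fun x hx => hGi x (hF hx).1
        _ = ∫⁻ y, ∑ x ∈ F, G x y := (lintegral_finsetSum _ fun x hx => hGm x (hF hx).1).symm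
        _ ≤ ∫⁻ y, (Metric.closedBall (0 : E3) (R + ρ)).indicator 1 y := by
            refine lintegral_mono fun y => ?_
            by_cases hy : y ∈ Metric.closedBall (0 : E3) (R + ρ)
            · rw [Set.indicator_of_mem hy]
              exact hG1 y F fun x hx => (hF hx).1
            · rw [Set.indicator_of_notMem hy]
              refine (Finset.sum_eq_zero fun x hx => ?_).le
              by_contra hne
              have h1 := hGs x (hF hx).1 y hne
              have h2 := (hF hx).2
              rw [Metric.mem_closedBall] at h2 hy
              exact hy ((dist_triangle y x 0).trans (by linarith))
        _ = _ := lintegral_indicator_one Metric.isClosed_closedBall.measurableSet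
    rw [volume_closedBall_E3 0 (by positivity), ← ENNReal.ofReal_natCast,
      ← ENNReal.ofReal_mul (by positivity)] at h
    exact (ENNReal.ofReal_le_ofReal_iff (by positivity)).1 h
  have hfin : ∀ R : ℝ, 0 ≤ R → (X ∩ Metric.closedBall 0 R).Finite := by
    intro R hR
    by_contra hinf
    obtain ⟨n, hn⟩ := exists_nat_gt (4 * Real.pi / 3 * (R + ρ) ^ 3 / V)
    obtain ⟨F, hF, hFn⟩ := Set.Infinite.exists_subset_card_eq hinf n
    have := hcount R hR F hF
    rw [hFn, ← le_div_iff₀ hV] at this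
    linarith
  have hev : ∀ᶠ R : ℝ in Filter.atTop, coveredPortion U R ≤
      ENNReal.ofReal (4 * Real.pi / 3 / V * ((R + (1 + ρ)) / R) ^ 3) := by
    filter_upwards [Filter.eventually_gt_atTop 0] with R hR
    rw [coveredPortion_eq_of_pos hR]
    set F := (hfin (R + 1) (by positivity)).toFinset with hFdef
    have hF : ↑F ⊆ X ∩ Metric.closedBall 0 (R + 1) := by simp [hFdef]
    have hsub : U ∩ Metric.closedBall 0 R ⊆ ⋃ x ∈ F, Metric.closedBall x 1 := by
      rintro y ⟨hy, hyR⟩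
      have := hU hy
      simp only [Set.mem_iUnion] at this ⊢
      obtain ⟨x, hx, hxy⟩ := this
      refine ⟨x, ?_, hxy⟩
      simp only [hFdef, Set.Finite.mem_toFinset, Set.mem_inter_iff]
      refine ⟨hx, ?_⟩
      rw [Metric.mem_closedBall] at *
      have := dist_triangle_left x 0 y
      linarith
    have hle : volume (U ∩ Metric.closedBall 0 R) ≤
        ENNReal.ofReal (F.card * (4 * Real.pi / 3)) := by
      refine (measure_mono hsub).trans ((measure_biUnion_finset_le _ _).trans ?_)
      rw [Finset.sum_congr rfl fun x _ => volume_closedBall_E3 x zero_le_one, Finset.sum_const,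
        nsmul_eq_mul, one_pow, mul_one,
          ENNReal.ofReal_mul (Nat.cast_nonneg _), ENNReal.ofReal_natCast]
    refine (ENNReal.div_le_div_right hle _).trans ?_
    rw [← ENNReal.ofReal_div_of_pos (by positivity)]
    refine ENNReal.ofReal_le_ofReal ?_
    have := hcount (R + 1) (by positivity) F hF
    rw [div_le_iff₀ (by positivity), div_pow]
    have e : 4 * Real.pi / 3 / V * ((R + (1 + ρ)) ^ 3 / R ^ 3) * (4 * Real.pi / 3 * R ^ 3) =
        (4 * Real.pi / 3 * (R + 1 + ρ) ^ 3 / V) * (4 * Real.pi / 3) := by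
      field_simp; ring
    rw [e]
    gcongr
    rwa [le_div_iff₀ hV]
  calc upperDensity U ≤ Filter.limsup (fun R : ℝ => ENNReal.ofReal (4 * Real.pi / 3 / V *
        ((R + (1 + ρ)) / R) ^ 3)) Filter.atTop := Filter.limsup_le_limsup hev
    _ = _ := (tendsto_ratio _ _).limsup_eq

/-- If the translates of a bounded set of volume at most `V` by the vectors of a `2`-separated set
`X` cover space, then unit balls with centres in `X` cover at least a proportion `4π / (3V)`. -/
theorem le_liminf_coveredPortion {X U F : Set E3} {V ρ : ℝ} (hV : 0 < V) (hρ : 0 ≤ ρ)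
    (hX : X.Pairwise fun x y => 2 ≤ dist x y) (hU : ⋃ x ∈ X, Metric.closedBall x 1 ⊆ U)
    (hF : F ⊆ Metric.closedBall 0 ρ) (hFV : volume F ≤ ENNReal.ofReal V)
    (hcov : ∀ y : E3, ∃ x ∈ X, y - x ∈ F) :
    ENNReal.ofReal (4 * Real.pi / 3 / V) ≤ Filter.liminf (coveredPortion U) Filter.atTop := by
  have hev : ∀ᶠ R : ℝ in Filter.atTop,
      ENNReal.ofReal (4 * Real.pi / 3 / V * ((R + (-1 - ρ)) / R) ^ 3) ≤ coveredPortion U R := by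
    filter_upwards [Filter.eventually_gt_atTop (1 + ρ)] with R hR
    have hR0 : 0 < R := by linarith
    rw [coveredPortion_eq_of_pos hR0]
    -- Unit balls centred within R − 1 stay in the ball of radius R, while the translates of F by
    -- these centres cover the ball of radius R − 1 − ρ.
    have hfin := finite_inter_of_pairwise_le_dist two_pos hX
      (Metric.isBounded_closedBall (x := (0 : E3)) (r := R - 1))
    set P := hfin.toFinset with hP
    have memP : ∀ x, x ∈ P ↔ x ∈ Metric.closedBall 0 (R - 1) ∧ x ∈ X := by
      intro x; simp [hP]
    have hlow : ENNReal.ofReal (P.card * (4 * Real.pi / 3)) ≤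
        volume (U ∩ Metric.closedBall 0 R) := by
      have hd : (↑P : Set E3).PairwiseDisjoint fun x => Metric.ball x (1 : ℝ) := by
        intro x hx y hy hxy
        refine Metric.ball_disjoint_ball ?_
        have := hX ((memP x).1 hx).2 ((memP y).1 hy).2 hxy
        linarith
      have hm := measure_biUnion_finset (μ := volume) hd fun x _ => Metric.isOpen_ball.measurableSet
      have hs : ∑ x ∈ P, volume (Metric.ball x (1 : ℝ)) =
          ENNReal.ofReal (P.card * (4 * Real.pi / 3)) := by
        rw [Finset.sum_congr rfl fun x _ =>
          (Measure.addHaar_closedBall_eq_addHaar_ball volume x 1).symm.trans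
          (volume_closedBall_E3 x zero_le_one), Finset.sum_const,
          nsmul_eq_mul, one_pow, mul_one,
          ENNReal.ofReal_mul (Nat.cast_nonneg _), ENNReal.ofReal_natCast]
      rw [← hs, ← hm]
      refine measure_mono ?_
      intro y hy
      simp only [Set.mem_iUnion] at hy
      obtain ⟨x, hx, hyx⟩ := hy
      obtain ⟨hx1, hx2⟩ := (memP x).1 hx
      refine ⟨hU ?_, ?_⟩
      · simp only [Set.mem_iUnion]
        exact ⟨x, hx2, Metric.ball_subset_closedBall hyx⟩
      · rw [Metric.mem_closedBall] at *
        rw [Metric.mem_ball] at hyx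
        linarith [dist_triangle y x 0]
    have hcount : 4 * Real.pi / 3 * (R - 1 - ρ) ^ 3 ≤ P.card * V := by
      have hsub : Metric.closedBall (0 : E3) (R - 1 - ρ) ⊆ ⋃ x ∈ P, (fun y => y - x) ⁻¹' F := by
        intro y hy
        obtain ⟨x, hx, hyx⟩ := hcov y
        simp only [Set.mem_iUnion]
        refine ⟨x, (memP x).2 ⟨?_, hx⟩, hyx⟩
        have h1 := hF hyx
        rw [mem_closedBall_zero_iff] at *
        have := norm_sub_le y (y - x)
        rw [sub_sub_cancel] at this
        linarith
      have h := (measure_mono hsub).trans (measure_biUnion_finset_le (μ := volume) _ _)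
      have hv : ∀ x ∈ P, volume ((fun y => y - x) ⁻¹' F) ≤ ENNReal.ofReal V := by
        intro x _
        refine le_trans (le_of_eq ?_) hFV
        simp only [sub_eq_add_neg]
        exact measure_preimage_add_right _ _ _
      replace h := h.trans (Finset.sum_le_sum hv)
      rw [volume_closedBall_E3 _ (by linarith), Finset.sum_const, nsmul_eq_mul,
        ← ENNReal.ofReal_natCast, ← ENNReal.ofReal_mul (by positivity)] at h
      exact (ENNReal.ofReal_le_ofReal_iff (by positivity)).1 h
    refine le_trans ?_ (ENNReal.div_le_div_right hlow _)
    rw [← ENNReal.ofReal_div_of_pos (by positivity)]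
    refine ENNReal.ofReal_le_ofReal ?_
    rw [le_div_iff₀ (by positivity), div_pow]
    have e : 4 * Real.pi / 3 / V * ((R + (-1 - ρ)) ^ 3 / R ^ 3) * (4 * Real.pi / 3 * R ^ 3) =
        (4 * Real.pi / 3 * (R - 1 - ρ) ^ 3 / V) * (4 * Real.pi / 3) := by
      field_simp; ring
    rw [e]
    gcongr
    rwa [div_le_iff₀ hV]
  calc ENNReal.ofReal (4 * Real.pi / 3 / V) = Filter.liminf (fun R : ℝ => ENNReal.ofReal
        (4 * Real.pi / 3 / V * ((R + (-1 - ρ)) / R) ^ 3)) Filter.atTop :=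
        (tendsto_ratio _ _).liminf_eq.symm
    _ ≤ _ := Filter.liminf_le_liminf hev

/-! ### The area of the triangles formed by three strings -/

/-- If the sum is 0, two of the numbers satisfy xy ≥ 0, and the squares add up to 2z² − 2xy. If it
is 2d, they add up to 2d² minus twice the sum of the products of the nonnegative numbers d − eᵢ in
pairs. The quartic is the product in `fac`: it vanishes in the first case and has nonnegative
factors in the second. A change of signs settles −2d. -/
lemma sum_sq_offsets {d e₁ e₂ e₃ : ℝ} (h₁ : |e₁| ≤ d) (h₂ : |e₂| ≤ d) (h₃ : |e₃| ≤ d)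
    (hs : e₁ + e₂ + e₃ = 0 ∨ e₁ + e₂ + e₃ = 2 * d ∨ e₁ + e₂ + e₃ = -(2 * d)) :
    e₁ ^ 2 + e₂ ^ 2 + e₃ ^ 2 ≤ 2 * d ^ 2 ∧
    0 ≤ 2 * (e₁ ^ 2 * e₂ ^ 2 + e₂ ^ 2 * e₃ ^ 2 + e₃ ^ 2 * e₁ ^ 2) - e₁ ^ 4 - e₂ ^ 4 - e₃ ^ 4 ∧
    (e₁ ^ 2 + e₂ ^ 2 + e₃ ^ 2 = 2 * d ^ 2 →
      (e₁ = 0 ∧ e₂ ^ 2 = d ^ 2 ∧ e₃ ^ 2 = d ^ 2) ∨ (e₂ = 0 ∧ e₃ ^ 2 = d ^ 2 ∧ e₁ ^ 2 = d ^ 2) ∨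
      (e₃ = 0 ∧ e₁ ^ 2 = d ^ 2 ∧ e₂ ^ 2 = d ^ 2)) := by
  have hd : 0 ≤ d := (abs_nonneg _).trans h₁
  have q₁ : e₁ ^ 2 ≤ d ^ 2 := sq_le_sq' (abs_le.1 h₁).1 (abs_le.1 h₁).2
  have q₂ : e₂ ^ 2 ≤ d ^ 2 := sq_le_sq' (abs_le.1 h₂).1 (abs_le.1 h₂).2
  have q₃ : e₃ ^ 2 ≤ d ^ 2 := sq_le_sq' (abs_le.1 h₃).1 (abs_le.1 h₃).2
  have fac : 2 * (e₁ ^ 2 * e₂ ^ 2 + e₂ ^ 2 * e₃ ^ 2 + e₃ ^ 2 * e₁ ^ 2) - e₁ ^ 4 - e₂ ^ 4 - e₃ ^ 4 =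
      (e₁ + e₂ + e₃) * (e₂ + e₃ - e₁) * (e₁ + e₃ - e₂) * (e₁ + e₂ - e₃) := by ring
  have fin : ∀ {x y z : ℝ}, x ^ 2 ≤ d ^ 2 → y ^ 2 ≤ d ^ 2 → x ^ 2 + y ^ 2 + z ^ 2 = 2 * d ^ 2 →
      z = 0 → x ^ 2 = d ^ 2 ∧ y ^ 2 = d ^ 2 := by
    rintro x y z hx hy h rfl
    constructor <;> nlinarith
  have zero_case : e₁ + e₂ + e₃ = 0 → e₁ ^ 2 + e₂ ^ 2 + e₃ ^ 2 ≤ 2 * d ^ 2 ∧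
      (e₁ ^ 2 + e₂ ^ 2 + e₃ ^ 2 = 2 * d ^ 2 → e₁ = 0 ∨ e₂ = 0 ∨ e₃ = 0) := by
    intro hs
    have aux : ∀ {x y z : ℝ}, x + y + z = 0 → z ^ 2 ≤ d ^ 2 → 0 ≤ x * y →
        x ^ 2 + y ^ 2 + z ^ 2 ≤ 2 * d ^ 2 ∧ (x ^ 2 + y ^ 2 + z ^ 2 = 2 * d ^ 2 → x = 0 ∨ y = 0) := by
      intro x y z h hz hxy
      have e : z ^ 2 = x ^ 2 + y ^ 2 + 2 * (x * y) := by
        have : z = -(x + y) := by linarith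
        rw [this]; ring
      refine ⟨by linarith, fun h => ?_⟩
      have : x * y = 0 := by linarith
      exact mul_eq_zero.1 this
    by_cases h12 : 0 ≤ e₁ * e₂
    · obtain ⟨a, b⟩ := aux hs q₃ h12
      exact ⟨a, fun h => (b h).elim Or.inl fun h => Or.inr (Or.inl h)⟩
    by_cases h23 : 0 ≤ e₂ * e₃
    · obtain ⟨a, b⟩ := aux (x := e₂) (y := e₃) (z := e₁) (by linarith) q₁ h23
      exact ⟨by linarith, fun h => Or.inr (b (by linarith))⟩
    · have h13 : 0 ≤ e₁ * e₃ := by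
        push Not at h12 h23
        rcases lt_trichotomy e₂ 0 with h | h | h
        · have h1 : 0 < e₁ := by by_contra! hc; nlinarith
          have h3 : 0 < e₃ := by by_contra! hc; nlinarith
          positivity
        · rw [h] at h12; simp at h12
        · have h1 : e₁ < 0 := by by_contra! hc; nlinarith
          have h3 : e₃ < 0 := by by_contra! hc; nlinarith
          nlinarith
      obtain ⟨a, b⟩ := aux (x := e₁) (y := e₃) (z := e₂) (by linarith) q₂ h13
      exact ⟨by linarith, fun h => (b (by linarith)).elim Or.inl fun h => Or.inr (Or.inr h)⟩
  have two_case : ∀ {x y z : ℝ}, x ≤ d → y ≤ d → z ≤ d → x + y + z = 2 * d →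
      x ^ 2 + y ^ 2 + z ^ 2 ≤ 2 * d ^ 2 ∧
      0 ≤ (x + y + z) * (y + z - x) * (x + z - y) * (x + y - z) ∧
      (x ^ 2 + y ^ 2 + z ^ 2 = 2 * d ^ 2 → x = 0 ∨ y = 0 ∨ z = 0) := by
    intro x y z hx hy hz h
    have a1 : 0 ≤ (d - x) * (d - y) := mul_nonneg (by linarith) (by linarith)
    have a2 : 0 ≤ (d - y) * (d - z) := mul_nonneg (by linarith) (by linarith)
    have a3 : 0 ≤ (d - z) * (d - x) := mul_nonneg (by linarith) (by linarith)
    have e : x ^ 2 + y ^ 2 + z ^ 2 =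
        2 * d ^ 2 - 2 * ((d - x) * (d - y) + (d - y) * (d - z) + (d - z) * (d - x)) := by
      have : z = 2 * d - x - y := by linarith
      rw [this]; ring
    refine ⟨by linarith, ?_, fun h' => ?_⟩
    · rw [h]
      refine mul_nonneg (mul_nonneg (mul_nonneg ?_ ?_) ?_) ?_ <;> linarith
    · have b1 : (d - x) * (d - y) = 0 := by linarith
      have b2 : (d - y) * (d - z) = 0 := by linarith
      have b3 : (d - z) * (d - x) = 0 := by linarith
      rcases mul_eq_zero.1 b1 with c | c
      · rcases mul_eq_zero.1 b2 with c' | c'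
        · right; right; linarith
        · right; left; linarith
      · rcases mul_eq_zero.1 b3 with c' | c'
        · left; linarith
        · right; right; linarith
  have main : e₁ ^ 2 + e₂ ^ 2 + e₃ ^ 2 ≤ 2 * d ^ 2 ∧
      0 ≤ 2 * (e₁ ^ 2 * e₂ ^ 2 + e₂ ^ 2 * e₃ ^ 2 + e₃ ^ 2 * e₁ ^ 2) - e₁ ^ 4 - e₂ ^ 4 - e₃ ^ 4 ∧
      (e₁ ^ 2 + e₂ ^ 2 + e₃ ^ 2 = 2 * d ^ 2 → e₁ = 0 ∨ e₂ = 0 ∨ e₃ = 0) := by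
    rw [fac]
    rcases hs with hs | hs | hs
    · obtain ⟨a, b⟩ := zero_case hs
      exact ⟨a, by rw [hs]; simp, b⟩
    · exact two_case (abs_le.1 h₁).2 (abs_le.1 h₂).2 (abs_le.1 h₃).2 hs
    · obtain ⟨a, b, c⟩ := two_case (x := -e₁) (y := -e₂) (z := -e₃) (by linarith [(abs_le.1 h₁).1])
        (by linarith [(abs_le.1 h₂).1]) (by linarith [(abs_le.1 h₃).1]) (by linarith)
      refine ⟨by nlinarith, by nlinarith, fun h => ?_⟩
      simpa using c (by nlinarith)
  refine ⟨main.1, main.2.1, fun h => ?_⟩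
  rcases main.2.2 h with h0 | h0 | h0
  · exact Or.inl ⟨h0, fin q₂ q₃ (by linarith) h0⟩
  · exact Or.inr (Or.inl ⟨h0, fin q₃ q₁ (by linarith) h0⟩)
  · exact Or.inr (Or.inr ⟨h0, fin q₁ q₂ (by linarith) h0⟩)

/-- Sixteen times the square of the area of a triangle, in terms of the squares of its sides. -/
def heron (x y z : ℝ) : ℝ := 2 * (x * y + y * z + z * x) - x ^ 2 - y ^ 2 - z ^ 2

/-- The identity `id` compares `heron` at x, y, z with its value at the least admissible squares 4 −
eᵢ². The difference is a sum of products of nonnegative factors because both triples are non-obtuse,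
the second one by d² ≤ 2. The rest is `sum_sq_offsets`. -/
lemma heron_bound {d e₁ e₂ e₃ x y z : ℝ} (hd : d ^ 2 ≤ 2) (h₁ : |e₁| ≤ d) (h₂ : |e₂| ≤ d)
    (h₃ : |e₃| ≤ d) (hs : e₁ + e₂ + e₃ = 0 ∨ e₁ + e₂ + e₃ = 2 * d ∨ e₁ + e₂ + e₃ = -(2 * d))
    (hx : 4 - e₁ ^ 2 ≤ x) (hy : 4 - e₂ ^ 2 ≤ y) (hz : 4 - e₃ ^ 2 ≤ z) (hxyz : x ≤ y + z)
    (hyzx : y ≤ z + x) (hzxy : z ≤ x + y) :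
    16 * (3 - d ^ 2) ≤ heron x y z ∧ (heron x y z ≤ 16 * (3 - d ^ 2) →
      (e₁ = 0 ∧ e₂ ^ 2 = d ^ 2 ∧ e₃ ^ 2 = d ^ 2 ∧ x = 4 ∧ y = 4 - d ^ 2 ∧ z = 4 - d ^ 2) ∨
      (e₂ = 0 ∧ e₃ ^ 2 = d ^ 2 ∧ e₁ ^ 2 = d ^ 2 ∧ y = 4 ∧ z = 4 - d ^ 2 ∧ x = 4 - d ^ 2) ∨
      (e₃ = 0 ∧ e₁ ^ 2 = d ^ 2 ∧ e₂ ^ 2 = d ^ 2 ∧ z = 4 ∧ x = 4 - d ^ 2 ∧ y = 4 - d ^ 2)) := by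
  obtain ⟨k1, k2, k3⟩ := sum_sq_offsets h₁ h₂ h₃ hs
  have q₁ : e₁ ^ 2 ≤ d ^ 2 := sq_le_sq' (abs_le.1 h₁).1 (abs_le.1 h₁).2
  have q₂ : e₂ ^ 2 ≤ d ^ 2 := sq_le_sq' (abs_le.1 h₂).1 (abs_le.1 h₂).2
  have q₃ : e₃ ^ 2 ≤ d ^ 2 := sq_le_sq' (abs_le.1 h₃).1 (abs_le.1 h₃).2
  have id : heron x y z = 48 - 8 * (e₁ ^ 2 + e₂ ^ 2 + e₃ ^ 2) +
      (2 * (e₁ ^ 2 * e₂ ^ 2 + e₂ ^ 2 * e₃ ^ 2 + e₃ ^ 2 * e₁ ^ 2) - e₁ ^ 4 - e₂ ^ 4 - e₃ ^ 4) +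
      ((x - (4 - e₁ ^ 2)) * ((y + z - x) + (4 - e₂ ^ 2 - e₃ ^ 2 + e₁ ^ 2)) +
       (y - (4 - e₂ ^ 2)) * ((z + x - y) + (4 - e₃ ^ 2 - e₁ ^ 2 + e₂ ^ 2)) +
       (z - (4 - e₃ ^ 2)) * ((x + y - z) + (4 - e₁ ^ 2 - e₂ ^ 2 + e₃ ^ 2))) := by
    simp only [heron]; ring
  have t₁ : 0 ≤ (x - (4 - e₁ ^ 2)) * ((y + z - x) + (4 - e₂ ^ 2 - e₃ ^ 2 + e₁ ^ 2)) :=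
    mul_nonneg (by linarith) (by nlinarith)
  have t₂ : 0 ≤ (y - (4 - e₂ ^ 2)) * ((z + x - y) + (4 - e₃ ^ 2 - e₁ ^ 2 + e₂ ^ 2)) :=
    mul_nonneg (by linarith) (by nlinarith)
  have t₃ : 0 ≤ (z - (4 - e₃ ^ 2)) * ((x + y - z) + (4 - e₁ ^ 2 - e₂ ^ 2 + e₃ ^ 2)) :=
    mul_nonneg (by linarith) (by nlinarith)
  refine ⟨by linarith, fun h => ?_⟩
  have z₁ := le_antisymm (by linarith) t₁
  have z₂ := le_antisymm (by linarith) t₂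
  have z₃ := le_antisymm (by linarith) t₃
  have fin : ∀ {x y z a b c : ℝ}, a = 0 → b ^ 2 = d ^ 2 → c ^ 2 = d ^ 2 →
      4 - b ^ 2 ≤ y → 4 - c ^ 2 ≤ z → 4 - a ^ 2 ≤ x → x ≤ y + z → y ≤ z + x → z ≤ x + y →
      (x - (4 - a ^ 2)) * ((y + z - x) + (4 - b ^ 2 - c ^ 2 + a ^ 2)) = 0 →
      (y - (4 - b ^ 2)) * ((z + x - y) + (4 - c ^ 2 - a ^ 2 + b ^ 2)) = 0 →
      (z - (4 - c ^ 2)) * ((x + y - z) + (4 - a ^ 2 - b ^ 2 + c ^ 2)) = 0 →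
      x = 4 ∧ y = 4 - d ^ 2 ∧ z = 4 - d ^ 2 := by
    intro x y z a b c ha hb hc hy hz hx h1 h2 h3 k1 k2 k3
    rw [ha, hb, hc] at k1 k2 k3
    rw [hb] at hy
    rw [hc] at hz
    rw [ha] at hx
    have ey : y = 4 - d ^ 2 := by
      rcases mul_eq_zero.1 k2 with h | h <;> linarith
    have ez : z = 4 - d ^ 2 := by
      rcases mul_eq_zero.1 k3 with h | h <;> linarith
    refine ⟨?_, ey, ez⟩
    -- The second factor can vanish only if d² = 2, the case of a right angle, and then x = y + z =
    -- 4 all the same.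
    rcases mul_eq_zero.1 k1 with h | h <;> linarith
  rcases k3 (by linarith) with ⟨a, b, c⟩ | ⟨a, b, c⟩ | ⟨a, b, c⟩
  · exact Or.inl ⟨a, b, c, fin a b c hy hz hx hxyz hyzx hzxy z₁ z₂ z₃⟩
  · exact Or.inr (Or.inl ⟨a, b, c, fin a b c hz hx hy hyzx hzxy hxyz z₂ z₃ z₁⟩)
  · exact Or.inr (Or.inr ⟨a, b, c, fin a b c hx hy hz hzxy hxyz hyzx z₃ z₁ z₂⟩)

lemma four_mul_cross_sq (a b : ℂ) : 4 * cross a b ^ 2 =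
    heron (Complex.normSq a) (Complex.normSq b) (Complex.normSq (a - b)) := by
  simp only [cross, heron, Complex.normSq_apply, Complex.sub_re, Complex.sub_im]; ring

/-- Every real number has distance at most `d` from a multiple of `2 * d`. -/
lemma exists_abs_sub_le {d : ℝ} (hd : 0 < d) (t : ℝ) : ∃ k : ℤ, |t - 2 * d * k| ≤ d := by
  refine ⟨round (t / (2 * d)), ?_⟩
  have h := abs_sub_round (t / (2 * d))
  have e : t - 2 * d * round (t / (2 * d)) = 2 * d * (t / (2 * d) - round (t / (2 * d))) := by
    field_simp
  rw [e, abs_mul, abs_of_pos (by positivity : 0 < 2 * d)]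
  nlinarith

/-- The sum is a multiple of 2d of absolute value at most 3d. -/
lemma sum_offsets {d : ℝ} (hd : 0 < d) {t₁ t₂ t₃ : ℝ} (ht : t₁ + t₂ + t₃ = 0) {k₁ k₂ k₃ : ℤ}
    (h₁ : |t₁ - 2 * d * k₁| ≤ d) (h₂ : |t₂ - 2 * d * k₂| ≤ d) (h₃ : |t₃ - 2 * d * k₃| ≤ d) :
    (t₁ - 2 * d * k₁) + (t₂ - 2 * d * k₂) + (t₃ - 2 * d * k₃) = 0 ∨
    (t₁ - 2 * d * k₁) + (t₂ - 2 * d * k₂) + (t₃ - 2 * d * k₃) = 2 * d ∨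
    (t₁ - 2 * d * k₁) + (t₂ - 2 * d * k₂) + (t₃ - 2 * d * k₃) = -(2 * d) := by
  have e : (t₁ - 2 * d * k₁) + (t₂ - 2 * d * k₂) + (t₃ - 2 * d * k₃) =
      -(2 * d * ((k₁ + k₂ + k₃ : ℤ) : ℝ)) := by
    push_cast; linear_combination ht
  rw [e]
  rw [abs_le] at h₁ h₂ h₃
  set K := k₁ + k₂ + k₃ with hK
  have u1 : (K : ℝ) < 2 := by nlinarith
  have u2 : (-2 : ℝ) < K := by nlinarith
  have v1 : K < 2 := by exact_mod_cast u1
  have v2 : -2 < K := by exact_mod_cast u2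
  have : K = 0 ∨ K = 1 ∨ K = -1 := by omega
  rcases this with h | h | h <;> rw [h] <;> simp

/-! ### Strings of balls and their centres -/

/-- The orthogonal projection along the strings. -/
def proj (x : E3) : ℂ := ⟨x 0, x 1⟩

@[simp] lemma proj_re (x : E3) : (proj x).re = x 0 := rfl
@[simp] lemma proj_im (x : E3) : (proj x).im = x 1 := rfl
@[simp] lemma zAxis_zero : zAxis 0 = 0 := by simp [zAxis]
@[simp] lemma zAxis_one : zAxis 1 = 0 := by simp [zAxis]
@[simp] lemma zAxis_two : zAxis 2 = 1 := by simp [zAxis]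

lemma dist_sq_eq (x y : E3) :
    dist x y ^ 2 = Complex.normSq (proj x - proj y) + (x 2 - y 2) ^ 2 := by
  rw [EuclideanSpace.dist_eq, Real.sq_sqrt (Finset.sum_nonneg fun i _ => sq_nonneg _),
    Fin.sum_univ_three]
  simp only [Real.dist_eq, sq_abs, Complex.normSq_apply, Complex.sub_re, Complex.sub_im, proj_re,
    proj_im]
  ring

lemma two_le_dist_iff (x y : E3) :
    2 ≤ dist x y ↔ 4 ≤ Complex.normSq (proj x - proj y) + (x 2 - y 2) ^ 2 := by
  rw [← dist_sq_eq]
  constructor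
  · intro h; nlinarith
  · intro h; exact le_of_sq_le_sq (by linarith) dist_nonneg

lemma ext_proj {x y : E3} (h : proj x = proj y) (h2 : x 2 = y 2) : x = y := by
  ext i
  fin_cases i
  · exact congrArg Complex.re h
  · exact congrArg Complex.im h
  · exact h2

lemma mem_vadd_ballString {c d : ℝ} {t y : E3} :
    y ∈ t +ᵥ ballString c d ↔ ∃ k : ℤ, dist y (t + (c + 2 * d * k) • zAxis) ≤ 1 := by
  rw [Set.mem_vadd_set_iff_neg_vadd_mem]
  simp only [ballString, stringCentres, Set.mem_iUnion, Set.mem_range, exists_prop,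
    exists_exists_eq_and, Metric.mem_closedBall, vadd_eq_add]
  refine exists_congr fun k => ?_
  rw [dist_eq_norm, dist_eq_norm, show -t + y - (c + 2 * d * (k : ℝ)) • zAxis =
    y - (t + (c + 2 * d * (k : ℝ)) • zAxis) by abel]

lemma mem_centres {c d : ℝ} {T : Set E3} {x : E3} :
    x ∈ T + stringCentres c d ↔ ∃ t ∈ T, ∃ k : ℤ, x = t + (c + 2 * d * k) • zAxis := by
  rw [Set.mem_add]
  simp only [stringCentres, Set.mem_range, exists_exists_eq_and]
  simp only [eq_comm]

lemma sUnion_translates {c d : ℝ} {T : Set E3} :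
    ⋃₀ translates (ballString c d) T = ⋃ x ∈ T + stringCentres c d, Metric.closedBall x 1 := by
  ext y
  simp only [translates, Set.sUnion_image, Set.mem_iUnion, mem_vadd_ballString, mem_centres,
    exists_prop, Metric.mem_closedBall]
  constructor
  · rintro ⟨t, ht, k, hk⟩; exact ⟨_, ⟨t, ht, k, rfl⟩, hk⟩
  · rintro ⟨_, ⟨t, ht, k, rfl⟩, hk⟩; exact ⟨t, ht, k, hk⟩

/-- A string of balls determines its centres. -/
lemma centre_mem_of_vadd_eq {c d : ℝ} {t t' : E3}
    (h : t +ᵥ ballString c d = t' +ᵥ ballString c d) (k : ℤ) :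
    ∃ l : ℤ, t + (c + 2 * d * k) • zAxis = t' + (c + 2 * d * l) • zAxis := by
  set x := t + (c + 2 * d * k) • zAxis with hx
  -- The two opposite horizontal extremes of the ball at x belong to balls of the other string.
  -- Adding the two squared distances leaves no room for x to differ from the first centre found.
  have key : ∀ s : ℝ, |s| = 1 → ∃ l : ℤ,
      dist (x + s • EuclideanSpace.single 0 1) (t' + (c + 2 * d * l) • zAxis) ≤ 1 := by
    intro s hs
    rw [← mem_vadd_ballString, ← h, mem_vadd_ballString]
    refine ⟨k, ?_⟩
    rw [← hx, dist_self_add_left, norm_smul, Real.norm_eq_abs, hs]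
    simp
  obtain ⟨l, hl⟩ := key 1 (by simp)
  obtain ⟨l', hl'⟩ := key (-1) (by simp)
  have sq_le : ∀ {a b : E3}, dist a b ≤ 1 → dist a b ^ 2 ≤ 1 := by
    intro a b h; exact pow_le_one₀ dist_nonneg h
  have h1 := sq_le hl
  have h2 := sq_le hl'
  rw [dist_sq_eq] at h1 h2
  simp [Complex.normSq_apply] at h1 h2
  refine ⟨l, ?_⟩
  have a0 : x 0 - t' 0 = 0 := by
    have : (x 0 - t' 0) ^ 2 ≤ 0 := by nlinarith
    exact pow_eq_zero_iff two_ne_zero |>.1 (le_antisymm this (sq_nonneg _))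
  have a1 : x 1 - t' 1 = 0 := by
    have : (x 1 - t' 1) ^ 2 ≤ 0 := by nlinarith
    exact pow_eq_zero_iff two_ne_zero |>.1 (le_antisymm this (sq_nonneg _))
  have a2 : x 2 - (t' 2 + (c + 2 * d * l)) = 0 := by
    have : (x 2 - (t' 2 + (c + 2 * d * l))) ^ 2 ≤ 0 := by nlinarith
    exact pow_eq_zero_iff two_ne_zero |>.1 (le_antisymm this (sq_nonneg _))
  refine ext_proj (Complex.ext ?_ ?_) ?_
  · simp; linarith
  · simp; linarith
  · simp; linarith

lemma ball_subset_interior_vadd {c d : ℝ} {t : E3} (k : ℤ) :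
    Metric.ball (t + (c + 2 * d * k) • zAxis) 1 ⊆ interior (t +ᵥ ballString c d) := by
  refine interior_maximal (fun y hy => ?_) Metric.isOpen_ball
  exact mem_vadd_ballString.2 ⟨k, (Metric.mem_ball.1 hy).le⟩

lemma disjoint_ball_one_iff {x y : E3} :
    Disjoint (Metric.ball x 1) (Metric.ball y 1) ↔ 2 ≤ dist x y := by
  constructor
  · intro h
    by_contra! hlt
    refine Set.disjoint_left.1 h (show midpoint ℝ x y ∈ _ from ?_) ?_
    · rw [Metric.mem_ball, dist_midpoint_left]
      simp; linarith
    · rw [Metric.mem_ball, dist_midpoint_right]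
      simp; linarith
  · intro h
    exact Metric.ball_disjoint_ball (by linarith)

lemma two_le_dist_of_same_string {d : ℝ} (hd : 1 ≤ d) {t : E3} {a : ℝ} {k l : ℤ} (hkl : k ≠ l) :
    2 ≤ dist (t + (a + 2 * d * k) • zAxis) (t + (a + 2 * d * l) • zAxis) := by
  rw [two_le_dist_iff]
  have h1 : (1 : ℝ) ≤ ((k - l : ℤ) : ℝ) ^ 2 := by
    have : 1 ≤ (k - l) ^ 2 := by
      have : 0 < (k - l) ^ 2 := by
        have := sub_ne_zero.2 hkl
        positivity
      omega
    exact_mod_cast this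
  push_cast at h1
  have e : (2 * d * (k : ℝ) - 2 * d * l) ^ 2 = 4 * (d ^ 2 * ((k : ℝ) - l) ^ 2) := by ring
  have h2 : 1 ≤ d ^ 2 * ((k : ℝ) - l) ^ 2 := one_le_mul_of_one_le_of_one_le (by nlinarith) h1
  simp [Complex.normSq_apply]
  linarith

/-- The centres of the balls in a packing of strings are `2`-separated. -/
lemma pairwise_of_isPacking {c d : ℝ} (hd : 1 ≤ d) {T : Set E3}
    (hT : IsPacking (translates (ballString c d) T)) :
    (T + stringCentres c d).Pairwise fun x y => 2 ≤ dist x y := by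
  intro x hx y hy hxy
  obtain ⟨t, ht, k, rfl⟩ := mem_centres.1 hx
  obtain ⟨t', ht', k', rfl⟩ := mem_centres.1 hy
  -- Different t and t' may give the same string, about which the packing condition says nothing;
  -- then both centres lie on one string and d ≥ 1 separates them.
  by_cases h : t +ᵥ ballString c d = t' +ᵥ ballString c d
  · obtain ⟨l, hl⟩ := centre_mem_of_vadd_eq h k
    rw [hl] at hxy ⊢
    exact two_le_dist_of_same_string hd fun h => hxy (by rw [h])
  · have := hT ⟨t, ht, rfl⟩ ⟨t', ht', rfl⟩ h
    exact disjoint_ball_one_iff.1 (this.mono (ball_subset_interior_vadd k)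
      (ball_subset_interior_vadd k'))

/-- Strings whose centres are `2`-separated form a packing. -/
lemma isPacking_of_pairwise {c d : ℝ} {T : Set E3}
    (hT : (T + stringCentres c d).Pairwise fun x y => 2 ≤ dist x y) :
    IsPacking (translates (ballString c d) T) := by
  rintro _ ⟨t, ht, rfl⟩ _ ⟨t', ht', rfl⟩ hne
  rw [Function.onFun, Set.disjoint_left]
  intro z hz hz'
  apply hne
  simp only at hz hz' ⊢
  -- Closed balls through z might merely touch. Perturbing z twice gives a point in two open unit
  -- balls, so their centres coincide, and then so do the strings.
  have hclos : ∀ {w x : E3}, dist w x ≤ 1 → w ∈ closure (Metric.ball x (1 : ℝ)) := by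
    intro w x h
    rwa [closure_ball x one_ne_zero, Metric.mem_closedBall]
  obtain ⟨k, hk⟩ := mem_vadd_ballString.1 (interior_subset hz)
  obtain ⟨w, hw, hwb⟩ := mem_closure_iff.1 (hclos hk) _ isOpen_interior hz'
  obtain ⟨k', hk'⟩ := mem_vadd_ballString.1 (interior_subset hw)
  obtain ⟨v, hv, hvb⟩ := mem_closure_iff.1 (hclos hk') _ Metric.isOpen_ball hwb
  have heq : t + (c + 2 * d * k) • zAxis = t' + (c + 2 * d * k') • zAxis := by
    by_contra hne'
    have := hT (mem_centres.2 ⟨t, ht, k, rfl⟩) (mem_centres.2 ⟨t', ht', k', rfl⟩) hne'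
    exact Set.disjoint_left.1 (disjoint_ball_one_iff.2 this) hv hvb
  have ht' : t' = t + (2 * d * (k - k')) • zAxis := by
    rw [eq_comm, ← sub_eq_iff_eq_add] at heq
    rw [← heq]
    module
  ext y
  rw [mem_vadd_ballString, mem_vadd_ballString, ht']
  constructor
  · rintro ⟨l, hl⟩
    refine ⟨l - k + k', ?_⟩
    convert hl using 2
    push_cast; module
  · rintro ⟨l, hl⟩
    refine ⟨l + k - k', ?_⟩
    convert hl using 2
    push_cast; module

/-! ### Space as the product of the plane and the vertical line -/

lemma measurePreserving_proj :
    MeasurePreserving (fun y : E3 => (proj y, y 2)) volume volume := by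
  have h1 := PiLp.volume_preserving_ofLp (Fin 3)
  have h2 := volume_preserving_piFinSuccAbove (fun _ : Fin 3 => ℝ) 2
  have h3 : MeasurePreserving (Complex.measurableEquivPi.symm) volume volume :=
    Complex.volume_preserving_equiv_pi.symm
  have h4 := (MeasurePreserving.id (volume : Measure ℝ)).prod h3
  have h5 := ((Measure.measurePreserving_swap (μ := (volume : Measure ℝ))
    (ν := (volume : Measure ℂ))).comp h4).comp (h2.comp h1)
  have hfun : (fun y : E3 => (proj y, y 2)) =
      (Prod.swap ∘ Prod.map id ⇑Complex.measurableEquivPi.symm) ∘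
      ⇑(MeasurableEquiv.piFinSuccAbove (fun _ : Fin 3 => ℝ) 2) ∘ WithLp.ofLp := by
    funext y
    refine Prod.ext (Complex.ext ?_ ?_) ?_
    · simp [Complex.measurableEquivPi]; rfl
    · simp [Complex.measurableEquivPi]; rfl
    · rfl
  rw [hfun]
  exact h5

lemma lintegral_proj_mul {g : ℂ → ENNReal} {h : ℝ → ENNReal} (hg : Measurable g)
    (hh : Measurable h) :
    ∫⁻ y : E3, g (proj y) * h (y 2) = (∫⁻ z, g z) * ∫⁻ t, h t := by
  rw [← lintegral_prod_mul hg.aemeasurable hh.aemeasurable, ← Measure.volume_eq_prod,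
    ← measurePreserving_proj.lintegral_comp]
  exact (hg.comp measurable_fst).mul (hh.comp measurable_snd)

lemma measurable_proj : Measurable proj := measurePreserving_proj.measurable.fst

lemma measurable_height : Measurable fun y : E3 => y 2 := measurePreserving_proj.measurable.snd

/-! ### Periodic separated sets and their density -/

/-- A `2`-separated set which is invariant under the translation by `2 * d` along the
`z`-axis. -/
structure IsStringSet (d : ℝ) (X : Set E3) : Prop where
  pairwise : X.Pairwise fun x y => 2 ≤ dist x y
  periodic : ∀ x ∈ X, ∀ k : ℤ, x + (2 * d * k) • zAxis ∈ X

lemma isStringSet_centres {c d : ℝ} (hd : 1 ≤ d) {T : Set E3}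
    (hT : IsPacking (translates (ballString c d) T)) : IsStringSet d (T + stringCentres c d) := by
  refine ⟨pairwise_of_isPacking hd hT, fun x hx k => ?_⟩
  obtain ⟨t, ht, l, rfl⟩ := mem_centres.1 hx
  refine mem_centres.2 ⟨t, ht, l + k, ?_⟩
  push_cast; module

namespace IsStringSet

variable {d : ℝ} {X : Set E3}

lemma le_normSq (hX : IsStringSet d X) {x y : E3} (hx : x ∈ X) (hy : y ∈ X)
    (hxy : proj x ≠ proj y) (k : ℤ) :
    4 - (x 2 - y 2 - 2 * d * k) ^ 2 ≤ Complex.normSq (proj x - proj y) := by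
  have h := hX.pairwise hx (hX.periodic y hy k) (by
    intro h; apply hxy
    rw [h]
    apply Complex.ext <;> simp)
  beta_reduce at h
  rw [two_le_dist_iff] at h
  have e : proj (y + (2 * d * (k : ℝ)) • zAxis) = proj y := by apply Complex.ext <;> simp
  rw [e] at h
  simp only [PiLp.add_apply, PiLp.smul_apply, zAxis_two, smul_eq_mul, mul_one] at h
  have e2 : x 2 - y 2 - 2 * d * k = x 2 - (y 2 + 2 * d * k) := by ring
  rw [e2]
  linarith

/-- Some shift of x is within d < 2 of y on the same vertical line, so separation makes it equal to
y. -/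
lemma exists_of_proj_eq (hX : IsStringSet d X) (hd : 0 < d) (hd2 : d ^ 2 ≤ 2) {x y : E3}
    (hx : x ∈ X) (hy : y ∈ X) (hxy : proj x = proj y) : ∃ k : ℤ, y 2 = x 2 + 2 * d * k := by
  obtain ⟨k, hk⟩ := exists_abs_sub_le hd (y 2 - x 2)
  refine ⟨k, ?_⟩
  have e : proj (x + (2 * d * (k : ℝ)) • zAxis) = proj x := by apply Complex.ext <;> simp
  by_contra hne
  have h := hX.pairwise hy (hX.periodic x hx k) (by
    intro h; apply hne
    rw [h]; simp)
  beta_reduce at h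
  rw [two_le_dist_iff, e, hxy] at h
  simp only [PiLp.add_apply, PiLp.smul_apply, zAxis_two, smul_eq_mul, mul_one, sub_self,
    map_zero, zero_add] at h
  have e2 : y 2 - (x 2 + 2 * d * k) = y 2 - x 2 - 2 * d * k := by ring
  rw [e2] at h
  have := sq_le_sq' (abs_le.1 hk).1 (abs_le.1 hk).2
  linarith

lemma le_normSq' (hX : IsStringSet d X) (hd : 0 < d) {x y : E3} (hx : x ∈ X) (hy : y ∈ X)
    (hxy : proj x ≠ proj y) : 4 - d ^ 2 ≤ Complex.normSq (proj x - proj y) := by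
  obtain ⟨k, hk⟩ := exists_abs_sub_le hd (x 2 - y 2)
  have := hX.le_normSq hx hy hxy k
  have := sq_le_sq' (abs_le.1 hk).1 (abs_le.1 hk).2
  linarith

/-- A non-obtuse triangle formed by three strings has area at least `√(3 - d ^ 2)`; in the case
of equality two of its sides have length `√(4 - d ^ 2)`, the third one has length `2`, and the
offsets of the strings are determined. -/
lemma heron_le (hX : IsStringSet d X) (hd : 0 < d) (hd2 : d ^ 2 ≤ 2) {x y w : E3} (hx : x ∈ X)
    (hy : y ∈ X) (hw : w ∈ X) (hxy : proj x ≠ proj y) (hyw : proj y ≠ proj w)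
    (hwx : proj w ≠ proj x)
    (h1 : Complex.normSq (proj x - proj y) ≤
      Complex.normSq (proj y - proj w) + Complex.normSq (proj w - proj x))
    (h2 : Complex.normSq (proj y - proj w) ≤
      Complex.normSq (proj w - proj x) + Complex.normSq (proj x - proj y))
    (h3 : Complex.normSq (proj w - proj x) ≤
      Complex.normSq (proj x - proj y) + Complex.normSq (proj y - proj w)) :
    ∃ k₁ k₂ k₃ : ℤ, 16 * (3 - d ^ 2) ≤ heron (Complex.normSq (proj x - proj y))
      (Complex.normSq (proj y - proj w)) (Complex.normSq (proj w - proj x)) ∧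
    (heron (Complex.normSq (proj x - proj y))
      (Complex.normSq (proj y - proj w)) (Complex.normSq (proj w - proj x)) ≤ 16 * (3 - d ^ 2) →
      (x 2 - y 2 - 2 * d * k₁ = 0 ∧ (y 2 - w 2 - 2 * d * k₂) ^ 2 = d ^ 2 ∧
        (w 2 - x 2 - 2 * d * k₃) ^ 2 = d ^ 2 ∧ Complex.normSq (proj x - proj y) = 4 ∧
        Complex.normSq (proj y - proj w) = 4 - d ^ 2 ∧
        Complex.normSq (proj w - proj x) = 4 - d ^ 2) ∨
      (y 2 - w 2 - 2 * d * k₂ = 0 ∧ (w 2 - x 2 - 2 * d * k₃) ^ 2 = d ^ 2 ∧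
        (x 2 - y 2 - 2 * d * k₁) ^ 2 = d ^ 2 ∧ Complex.normSq (proj y - proj w) = 4 ∧
        Complex.normSq (proj w - proj x) = 4 - d ^ 2 ∧
        Complex.normSq (proj x - proj y) = 4 - d ^ 2) ∨
      (w 2 - x 2 - 2 * d * k₃ = 0 ∧ (x 2 - y 2 - 2 * d * k₁) ^ 2 = d ^ 2 ∧
        (y 2 - w 2 - 2 * d * k₂) ^ 2 = d ^ 2 ∧ Complex.normSq (proj w - proj x) = 4 ∧
        Complex.normSq (proj x - proj y) = 4 - d ^ 2 ∧
        Complex.normSq (proj y - proj w) = 4 - d ^ 2)) := by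
  obtain ⟨k₁, hk₁⟩ := exists_abs_sub_le hd (x 2 - y 2)
  obtain ⟨k₂, hk₂⟩ := exists_abs_sub_le hd (y 2 - w 2)
  obtain ⟨k₃, hk₃⟩ := exists_abs_sub_le hd (w 2 - x 2)
  have hs := sum_offsets hd (by ring) hk₁ hk₂ hk₃
  exact ⟨k₁, k₂, k₃, heron_bound hd2 hk₁ hk₂ hk₃ hs (hX.le_normSq hx hy hxy k₁)
    (hX.le_normSq hy hw hyw k₂) (hX.le_normSq hw hx hwx k₃) h1 h2 h3⟩

/-- The density of a packing of strings. -/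
theorem upperDensity_le (hX : IsStringSet d X) (hd : 1 ≤ d) (hd2 : d ^ 2 ≤ 2) {U : Set E3}
    (hU : U ⊆ ⋃ x ∈ X, Metric.closedBall x 1) :
    upperDensity U ≤ ENNReal.ofReal (Real.pi / (3 * d * √(3 - d ^ 2))) := by
  classical
  have hd0 : 0 < d := by linarith
  set A := √(3 - d ^ 2) with hA
  have hA2 : A ^ 2 = 3 - d ^ 2 := Real.sq_sqrt (by linarith)
  have hA0 : 0 < A := Real.sqrt_pos.2 (by linarith)
  set r := √((4 - d ^ 2) / 2) with hr
  have hr2 : r ^ 2 = (4 - d ^ 2) / 2 := Real.sq_sqrt (by linarith)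
  have hr0 : 0 < r := Real.sqrt_pos.2 (by linarith)
  have hAr : A ≤ r ^ 2 := by
    rw [hr2]
    refine le_of_sq_le_sq ?_ (by linarith)
    rw [hA2]
    nlinarith [sq_nonneg (2 - d ^ 2)]
  have hS : Separated r (proj '' X) := by
    rintro _ ⟨x, hx, rfl⟩ _ ⟨y, hy, rfl⟩ hxy
    rw [hr2]
    linarith [hX.le_normSq' hd0 hx hy hxy]
  have htri : ∀ p ∈ proj '' X, ∀ a ∈ proj '' X, ∀ b ∈ proj '' X,
      Complex.normSq (a - p) < 4 * r ^ 2 →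
      Complex.normSq (b - p) < 4 * r ^ 2 → Complex.normSq (a - b) < 4 * r ^ 2 →
      0 < cross (a - p) (b - p) → 2 * A ≤ cross (a - p) (b - p) := by
    rintro _ ⟨x, hx, rfl⟩ _ ⟨y, hy, rfl⟩ _ ⟨w, hw, rfl⟩ h1 h2 h3 hc
    have n1 : proj x ≠ proj y := by
      intro h; rw [h] at hc; simp [cross] at hc
    have n2 : proj y ≠ proj w := by
      intro h; rw [h] at hc; simp [cross, mul_comm] at hc
    have n3 : proj w ≠ proj x := by
      intro h; rw [h] at hc; simp [cross] at hc
    have s1 := hX.le_normSq' hd0 hx hy n1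
    have s2 := hX.le_normSq' hd0 hy hw n2
    have s3 := hX.le_normSq' hd0 hw hx n3
    rw [hr2] at h1 h2 h3
    rw [← Complex.normSq_neg, neg_sub] at h1
    -- All squared sides lie between 4 − d² and twice that, so the triangle is non-obtuse.
    obtain ⟨-, -, -, h, -⟩ := hX.heron_le hd0 hd2 hx hy hw n1 n2 n3 (by linarith) (by linarith)
      (by linarith)
    have e := four_mul_cross_sq (proj y - proj x) (proj w - proj x)
    rw [sub_sub_sub_cancel_right, ← Complex.normSq_neg, neg_sub] at e
    have e' : heron (Complex.normSq (proj x - proj y))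
      (Complex.normSq (proj y - proj w)) (Complex.normSq (proj w - proj x)) =
      heron (Complex.normSq (proj x - proj y)) (Complex.normSq (proj w - proj x))
        (Complex.normSq (proj y - proj w)) := by simp only [heron]; ring
    rw [e', ← e] at h
    refine le_of_sq_le_sq ?_ hc.le
    rw [mul_pow, hA2]
    linarith
  obtain ⟨g, hgm, hgi, hgs, hg1⟩ := exists_area_distribution hr0 hA0 hAr hS htri
  -- Multiply the plane distribution by a slab of height 2d about each centre. Centres with the same
  -- projection differ in height by multiples of 2d, so their half-open slabs are disjoint.
  have key := upperDensity_le_of_distribution (X := X) (U := U) (V := 2 * A * (2 * d))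
    (ρ := 3 * r + d) (by positivity) (by positivity) hU
    (fun x y => g (proj x) (proj y) * (Set.Ico (x 2 - d) (x 2 + d)).indicator 1 (y 2)) ?_ ?_ ?_ ?_
  · convert key using 2
    field_simp
    ring
  · intro x hx
    exact ((hgm _ ⟨x, hx, rfl⟩).comp measurable_proj).mul
      ((measurable_one.indicator measurableSet_Ico).comp measurable_height)
  · intro x hx
    rw [lintegral_proj_mul (hgm _ ⟨x, hx, rfl⟩) (measurable_one.indicator measurableSet_Ico),
      lintegral_indicator_one measurableSet_Ico, Real.volume_Ico,
      ENNReal.ofReal_mul (by positivity)]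
    refine mul_le_mul' (hgi _ ⟨x, hx, rfl⟩) (ENNReal.ofReal_le_ofReal (by linarith))
  · intro x hx y hne
    have h1 := hgs _ ⟨x, hx, rfl⟩ _ (left_ne_zero_of_mul hne)
    have h2 : y 2 ∈ Set.Ico (x 2 - d) (x 2 + d) := by
      by_contra h
      exact right_ne_zero_of_mul hne (Set.indicator_of_notMem h _)
    refine le_of_sq_le_sq ?_ (by positivity)
    rw [dist_sq_eq, normSq_eq_sq, ← dist_eq_norm]
    have h3 : (y 2 - x 2) ^ 2 ≤ d ^ 2 := sq_le_sq' (by linarith [h2.1]) (by linarith [h2.2])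
    have h4 : dist (proj y) (proj x) ^ 2 ≤ (3 * r) ^ 2 := pow_le_pow_left₀ dist_nonneg h1 2
    nlinarith [mul_pos hr0 hd0]
  · intro y F hF
    set F' := F.filter fun x => y 2 ∈ Set.Ico (x 2 - d) (x 2 + d) with hF'
    have e : ∑ x ∈ F, g (proj x) (proj y) * (Set.Ico (x 2 - d) (x 2 + d)).indicator 1 (y 2) =
        ∑ x ∈ F', g (proj x) (proj y) := by
      rw [hF', Finset.sum_filter]
      refine Finset.sum_congr rfl fun x _ => ?_
      by_cases h : y 2 ∈ Set.Ico (x 2 - d) (x 2 + d)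
      · rw [Set.indicator_of_mem h, if_pos h]; simp
      · rw [Set.indicator_of_notMem h, if_neg h]; simp
    have hinj : Set.InjOn proj (↑F' : Set E3) := by
      intro x hx x' hx' h
      simp only [hF', Finset.coe_filter, Set.mem_ofPred_eq] at hx hx'
      obtain ⟨k, hk⟩ := hX.exists_of_proj_eq hd0 hd2 (hF hx.1) (hF hx'.1) h
      obtain ⟨-, a1, a2⟩ := hx
      obtain ⟨-, b1, b2⟩ := hx'
      refine ext_proj h ?_
      have u1 : (k : ℝ) < 1 := by nlinarith
      have u2 : (-1 : ℝ) < k := by nlinarith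
      have v1 : k < 1 := by exact_mod_cast u1
      have v2 : -1 < k := by exact_mod_cast u2
      have : k = 0 := by omega
      rw [hk, this]; simp
    rw [e, ← Finset.sum_image (s := F') (g := proj) (f := fun p => g p (proj y)) hinj]
    refine hg1 _ _ ?_
    intro p hp
    simp only [Finset.coe_image, Set.mem_image, Finset.mem_coe] at hp
    obtain ⟨x, hx, rfl⟩ := hp
    exact ⟨x, hF (Finset.mem_filter.1 hx).1, rfl⟩

end IsStringSet

/-! ### Fundamental domains -/

/-- The half-open parallelogram spanned by `u` and `v`. -/
def parallelogram (u v : ℂ) : Set ℂ :=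
  {z | cross z v / cross u v ∈ Set.Ico (0 : ℝ) 1 ∧ cross u z / cross u v ∈ Set.Ico (0 : ℝ) 1}

lemma measurableSet_parallelogram (u v : ℂ) : MeasurableSet (parallelogram u v) :=
  (measurableSet_Ico.preimage ((continuous_cross_right v).div_const _).measurable).inter
    (measurableSet_Ico.preimage ((continuous_cross_left u).div_const _).measurable)

lemma eq_of_cross {u v z : ℂ} (h : cross u v ≠ 0) :
    z = (cross z v / cross u v : ℝ) * u + (cross u z / cross u v : ℝ) * v := by
  have i1 : cross z v * u.re + cross u z * v.re = cross u v * z.re := by simp only [cross]; ring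
  have i2 : cross z v * u.im + cross u z * v.im = cross u v * z.im := by simp only [cross]; ring
  apply Complex.ext
  · rw [Complex.add_re, Complex.re_ofReal_mul, Complex.re_ofReal_mul,
      div_mul_eq_mul_div, div_mul_eq_mul_div, ← add_div, i1, mul_div_cancel_left₀ _ h]
  · rw [Complex.add_im, Complex.im_ofReal_mul, Complex.im_ofReal_mul,
      div_mul_eq_mul_div, div_mul_eq_mul_div, ← add_div, i2, mul_div_cancel_left₀ _ h]

lemma cross_coords {u v : ℂ} (h : cross u v ≠ 0) (s t : ℝ) :
    cross ((s : ℂ) * u + t * v) v / cross u v = s ∧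
    cross u ((s : ℂ) * u + t * v) / cross u v = t := by
  constructor
  · rw [div_eq_iff h]
    simp only [cross, Complex.add_re, Complex.add_im, Complex.re_ofReal_mul, Complex.im_ofReal_mul]
    ring
  · rw [div_eq_iff h]
    simp only [cross, Complex.add_re, Complex.add_im, Complex.re_ofReal_mul, Complex.im_ofReal_mul]
    ring

lemma volume_parallelogram {u v : ℂ} (h : cross u v ≠ 0) :
    volume (parallelogram u v) = ENNReal.ofReal |cross u v| := by
  let M : Matrix (Fin 2) (Fin 2) ℝ := !![u.re, v.re; u.im, v.im]
  let f : ℂ →ₗ[ℝ] ℂ := Matrix.toLin Complex.basisOneI Complex.basisOneI M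
  have hf : ∀ z, f z = z.re * u + z.im * v := by
    intro z
    simp only [f, Matrix.toLin_apply, Complex.coe_basisOneI_repr, Complex.coe_basisOneI, M,
      Matrix.mulVec, dotProduct, Fin.sum_univ_two]
    apply Complex.ext <;> simp <;> ring
  have hdet : LinearMap.det f = cross u v := by
    simp only [f, LinearMap.det_toLin, M, Matrix.det_fin_two_of, cross]; ring
  have himg : parallelogram u v = f '' (Set.Ico (0 : ℝ) 1 ×ℂ Set.Ico (0 : ℝ) 1) := by
    ext z
    constructor
    · rintro ⟨h1, h2⟩
      refine ⟨⟨cross z v / cross u v, cross u z / cross u v⟩, ⟨h1, h2⟩, ?_⟩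
      rw [hf]
      exact (eq_of_cross h).symm
    · rintro ⟨w, ⟨h1, h2⟩, rfl⟩
      rw [hf]
      obtain ⟨e1, e2⟩ := cross_coords h w.re w.im
      exact ⟨by rw [e1]; exact h1, by rw [e2]; exact h2⟩
  have hsq : volume (Set.Ico (0 : ℝ) 1 ×ℂ Set.Ico (0 : ℝ) 1) = 1 := by
    have : (Set.Ico (0 : ℝ) 1 ×ℂ Set.Ico (0 : ℝ) 1) =
        Complex.measurableEquivRealProd ⁻¹' (Set.Ico (0 : ℝ) 1 ×ˢ Set.Ico (0 : ℝ) 1) := rfl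
    rw [this, Complex.volume_preserving_equiv_real_prod.measure_preimage_equiv,
      Measure.volume_eq_prod, Measure.prod_prod, Real.volume_Ico]
    simp
  rw [himg, Measure.addHaar_image_linearMap, hdet, hsq, mul_one]

/-- The prism of height `2 * d` over a parallelogram. -/
def prism (u v : ℂ) (d : ℝ) : Set E3 := {y | proj y ∈ parallelogram u v ∧ y 2 ∈ Set.Ico 0 (2 * d)}

lemma measurableSet_prism (u v : ℂ) (d : ℝ) : MeasurableSet (prism u v d) :=
  ((measurableSet_parallelogram u v).preimage measurable_proj).inter
    (measurableSet_Ico.preimage measurable_height)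

lemma volume_prism {u v : ℂ} {d : ℝ} (h : cross u v ≠ 0) :
    volume (prism u v d) = ENNReal.ofReal (2 * d * |cross u v|) := by
  have : prism u v d = (fun y : E3 => (proj y, y 2)) ⁻¹'
      (parallelogram u v ×ˢ Set.Ico 0 (2 * d)) := rfl
  rw [this, measurePreserving_proj.measure_preimage
    ((measurableSet_parallelogram u v).prod measurableSet_Ico).nullMeasurableSet,
    Measure.volume_eq_prod, Measure.prod_prod, volume_parallelogram h, Real.volume_Ico, sub_zero,
    mul_comm (2 * d), ENNReal.ofReal_mul (abs_nonneg _)]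

lemma exists_prism_subset (u v : ℂ) (d : ℝ) :
    ∃ ρ : ℝ, 0 ≤ ρ ∧ (cross u v ≠ 0 → prism u v d ⊆ Metric.closedBall 0 ρ) := by
  refine ⟨‖u‖ + ‖v‖ + |2 * d|, by positivity, fun h y hy => ?_⟩
  obtain ⟨⟨h1, h2⟩, h3⟩ := hy
  rw [Metric.mem_closedBall]
  refine le_of_sq_le_sq ?_ (by positivity)
  have e0 : proj (0 : E3) = 0 := by apply Complex.ext <;> simp
  rw [dist_sq_eq, e0, sub_zero, normSq_eq_sq]
  have n1 : ‖proj y‖ ≤ ‖u‖ + ‖v‖ := by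
    rw [eq_of_cross h (z := proj y)]
    refine (norm_add_le _ _).trans (add_le_add ?_ ?_)
    · rw [norm_mul, Complex.norm_real, Real.norm_eq_abs, abs_of_nonneg h1.1]
      exact mul_le_of_le_one_left (norm_nonneg _) h1.2.le
    · rw [norm_mul, Complex.norm_real, Real.norm_eq_abs, abs_of_nonneg h2.1]
      exact mul_le_of_le_one_left (norm_nonneg _) h2.2.le
  have n2 : (y 2 - (0 : E3) 2) ^ 2 ≤ |2 * d| ^ 2 := by
    simp only [PiLp.zero_apply, sub_zero]
    exact pow_le_pow_left₀ h3.1 (h3.2.le.trans (le_abs_self _)) 2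
  have n3 := pow_le_pow_left₀ (norm_nonneg (proj y)) n1 2
  nlinarith [mul_nonneg (add_nonneg (norm_nonneg u) (norm_nonneg v)) (abs_nonneg (2 * d))]

/-- If the translates of a prism by the vectors of `X` do not overlap, then unit balls with
centres in `X` have density at most that of one ball in each prism. -/
lemma upperDensity_le_of_prism {X U : Set E3} {u v : ℂ} {d : ℝ} (hd : 0 < d) (h : cross u v ≠ 0)
    (hU : U ⊆ ⋃ x ∈ X, Metric.closedBall x 1)
    (hdis : ∀ x ∈ X, ∀ x' ∈ X, ∀ y, y - x ∈ prism u v d → y - x' ∈ prism u v d → x = x') :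
    upperDensity U ≤ ENNReal.ofReal (4 * Real.pi / 3 / (2 * d * |cross u v|)) := by
  classical
  obtain ⟨ρ, hρ, hsub⟩ := exists_prism_subset u v d
  have hc : 0 < |cross u v| := abs_pos.2 h
  refine upperDensity_le_of_distribution (by positivity) hρ hU
    (fun x y => (prism u v d).indicator 1 (y - x)) ?_ ?_ ?_ ?_
  · intro x _
    exact (measurable_one.indicator (measurableSet_prism u v d)).comp (measurable_id.sub_const x)
  · intro x _
    rw [lintegral_sub_right_eq_self (fun y => (prism u v d).indicator (1 : E3 → ENNReal) y) x,
      lintegral_indicator_one (measurableSet_prism u v d), volume_prism h]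
  · intro x _ y hy
    have : y - x ∈ prism u v d := by
      by_contra hn
      exact hy (Set.indicator_of_notMem hn _)
    have := hsub h this
    rwa [mem_closedBall_zero_iff, ← dist_eq_norm] at this
  · intro y F hF
    by_cases hy : ∃ x ∈ F, y - x ∈ prism u v d
    · obtain ⟨x, hx, hxy⟩ := hy
      rw [Finset.sum_eq_single_of_mem x hx, Set.indicator_of_mem hxy]
      · rfl
      · intro x' hx' hne
        rw [Set.indicator_of_notMem]
        intro hx'y
        exact hne (hdis x' (hF hx') x (hF hx) y hx'y hxy)
    · push Not at hy
      rw [Finset.sum_eq_zero fun x hx => Set.indicator_of_notMem (hy x hx) _]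
      exact zero_le_one

/-! ### Prisms as fundamental domains of lattices with a vertical period -/

/-- The set of all integral combinations of three vectors. -/
def intSpan (a b c : E3) : AddSubgroup E3 where
  carrier := {x | ∃ i j k : ℤ, x = i • a + j • b + k • c}
  zero_mem' := ⟨0, 0, 0, by simp⟩
  add_mem' := by
    rintro _ _ ⟨i, j, k, rfl⟩ ⟨i', j', k', rfl⟩
    exact ⟨i + i', j + j', k + k', by module⟩
  neg_mem' := by
    rintro _ ⟨i, j, k, rfl⟩
    exact ⟨-i, -j, -k, by module⟩

lemma proj_comb (d : ℝ) (i j k : ℤ) (P Q : E3) :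
    proj (i • ((2 * d) • zAxis) + j • P + k • Q) = ((j : ℝ) : ℂ) * proj P + ((k : ℝ) : ℂ) * proj Q := by
  apply Complex.ext <;>
    simp [← Int.cast_smul_eq_zsmul ℝ]

lemma height_comb (d : ℝ) (i j k : ℤ) (P Q : E3) :
    (i • ((2 * d) • zAxis) + j • P + k • Q) 2 = 2 * d * i + j * P 2 + k * Q 2 := by
  simp [← Int.cast_smul_eq_zsmul ℝ]; ring

lemma proj_sub (x y : E3) : proj (x - y) = proj x - proj y := by
  apply Complex.ext <;> simp

lemma proj_add (x y : E3) : proj (x + y) = proj x + proj y := by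
  apply Complex.ext <;> simp

/-- The prism over a basic parallelogram contains a representative of every point modulo the
lattice. -/
lemma exists_sub_mem_prism {d : ℝ} (hd : 0 < d) {P Q : E3} (h : cross (proj P) (proj Q) ≠ 0)
    (y : E3) : ∃ x ∈ intSpan ((2 * d) • zAxis) P Q, y - x ∈ prism (proj P) (proj Q) d := by
  set j := ⌊cross (proj y) (proj Q) / cross (proj P) (proj Q)⌋ with hj
  set k := ⌊cross (proj P) (proj y) / cross (proj P) (proj Q)⌋ with hk
  -- P and Q need not be horizontal, so the height is reduced modulo 2d only after their
  -- contribution is removed.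
  set t := y 2 - j * P 2 - k * Q 2 with ht
  set i := ⌊t / (2 * d)⌋ with hi
  refine ⟨i • ((2 * d) • zAxis) + j • P + k • Q, ⟨i, j, k, rfl⟩, ?_⟩
  have e : proj (y - (i • ((2 * d) • zAxis) + j • P + k • Q)) =
      (cross (proj y) (proj Q) / cross (proj P) (proj Q) - j : ℝ) * proj P +
      (cross (proj P) (proj y) / cross (proj P) (proj Q) - k : ℝ) * proj Q := by
    rw [proj_sub, proj_comb]
    nth_rewrite 1 [eq_of_cross h (z := proj y)]
    push_cast; ring
  refine ⟨?_, ?_⟩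
  · rw [e]
    obtain ⟨e1, e2⟩ := cross_coords h (cross (proj y) (proj Q) / cross (proj P) (proj Q) - j)
      (cross (proj P) (proj y) / cross (proj P) (proj Q) - k)
    refine ⟨?_, ?_⟩
    · rw [e1, hj]; exact ⟨Int.fract_nonneg _, Int.fract_lt_one _⟩
    · rw [e2, hk]; exact ⟨Int.fract_nonneg _, Int.fract_lt_one _⟩
  · have h2 : (y - (i • ((2 * d) • zAxis) + j • P + k • Q)) 2 = t - 2 * d * i := by
      rw [PiLp.sub_apply, height_comb, ht]; ring
    rw [h2]
    have h3 : t - 2 * d * i = 2 * d * Int.fract (t / (2 * d)) := by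
      rw [Int.fract, ← hi]; field_simp
    rw [h3]
    exact ⟨by have := Int.fract_nonneg (t / (2 * d)); positivity,
      mul_lt_of_lt_one_right (by positivity) (Int.fract_lt_one _)⟩

lemma eq_of_sub_mem_prism {d : ℝ} (hd : 0 < d) {P Q : E3} (h : cross (proj P) (proj Q) ≠ 0)
    {x x' y : E3} (hx : x' - x ∈ intSpan ((2 * d) • zAxis) P Q)
    (h1 : y - x ∈ prism (proj P) (proj Q) d) (h2 : y - x' ∈ prism (proj P) (proj Q) d) :
    x = x' := by
  obtain ⟨i, j, k, hijk⟩ := hx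
  have hsub : y - x = (y - x') + (i • ((2 * d) • zAxis) + j • P + k • Q) := by
    rw [← hijk]; abel
  obtain ⟨⟨a1, a2⟩, a3⟩ := h1
  obtain ⟨⟨b1, b2⟩, b3⟩ := h2
  have hp : proj (y - x) = proj (y - x') + ((j : ℝ) * proj P + (k : ℝ) * proj Q) := by
    rw [hsub, proj_add, proj_comb]
  have hh : (y - x) 2 = (y - x') 2 + (2 * d * i + j * P 2 + k * Q 2) := by
    rw [hsub, PiLp.add_apply, height_comb]
  have c1 : cross (proj (y - x)) (proj Q) / cross (proj P) (proj Q) =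
      cross (proj (y - x')) (proj Q) / cross (proj P) (proj Q) + j := by
    rw [hp, div_add' _ _ _ h]
    congr 1
    simp only [cross, Complex.add_re, Complex.add_im, Complex.re_ofReal_mul, Complex.im_ofReal_mul]
    ring
  have c2 : cross (proj P) (proj (y - x)) / cross (proj P) (proj Q) =
      cross (proj P) (proj (y - x')) / cross (proj P) (proj Q) + k := by
    rw [hp, div_add' _ _ _ h]
    congr 1
    simp only [cross, Complex.add_re, Complex.add_im, Complex.re_ofReal_mul, Complex.im_ofReal_mul]
    ring
  rw [c1] at a1
  rw [c2] at a2
  have hIco : ∀ {s : ℝ} {n : ℤ}, s ∈ Set.Ico (0 : ℝ) 1 → s + n ∈ Set.Ico (0 : ℝ) 1 → n = 0 := by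
    rintro s n ⟨s1, s2⟩ ⟨s3, s4⟩
    have u1 : (n : ℝ) < 1 := by linarith
    have u2 : (-1 : ℝ) < n := by linarith
    have v1 : n < 1 := by exact_mod_cast u1
    have v2 : -1 < n := by exact_mod_cast u2
    omega
  have hj := hIco b1 a1
  have hk := hIco b2 a2
  rw [hh, hj, hk] at a3
  have hi : i = 0 := by
    obtain ⟨s1, s2⟩ := b3
    obtain ⟨s3, s4⟩ := a3
    have u1 : (i : ℝ) < 1 := by push_cast at *; nlinarith
    have u2 : (-1 : ℝ) < i := by push_cast at *; nlinarith
    have v1 : i < 1 := by exact_mod_cast u1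
    have v2 : -1 < i := by exact_mod_cast u2
    omega
  rw [hi, hj, hk] at hijk
  simp only [zero_smul, add_zero] at hijk
  exact (sub_eq_zero.1 hijk).symm

/-! ### The lattices generated by tetrahedra and by pyramids -/

lemma latticeGeneratedBy_eq {S : Set E3} {A : E3} {G : AddSubgroup E3} (hA : A ∈ S)
    (hS : ∀ s ∈ S, s - A ∈ G) (hG : G ≤ AddSubgroup.closure (S - S)) :
    latticeGeneratedBy S = A +ᵥ (G : Set E3) := by
  have hle : AddSubgroup.closure (S - S) = G := by
    refine le_antisymm ((AddSubgroup.closure_le G).2 ?_) hG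
    rintro _ ⟨s, hs, t, ht, rfl⟩
    have := G.sub_mem (hS s hs) (hS t ht)
    rwa [sub_sub_sub_cancel_right] at this
  ext x
  rw [latticeGeneratedBy, hle, Set.mem_add, Set.mem_vadd_set]
  constructor
  · rintro ⟨s, hs, g, hg, rfl⟩
    exact ⟨s - A + g, G.add_mem (hS s hs) hg, by rw [vadd_eq_add]; abel⟩
  · rintro ⟨g, hg, rfl⟩
    exact ⟨A, hA, g, hg, rfl⟩

lemma intSpan_le {a b c : E3} {G : AddSubgroup E3} (ha : a ∈ G) (hb : b ∈ G) (hc : c ∈ G) :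
    intSpan a b c ≤ G := by
  rintro _ ⟨i, j, k, rfl⟩
  exact G.add_mem (G.add_mem (G.zsmul_mem ha i) (G.zsmul_mem hb j)) (G.zsmul_mem hc k)

lemma latticeGeneratedBy_tetrahedron (A B C E : E3) :
    latticeGeneratedBy {A, B, C, E} = A +ᵥ (intSpan (B - A) (C - A) (E - A) : Set E3) := by
  have hs : ∀ s ∈ ({A, B, C, E} : Set E3), s - A ∈
      AddSubgroup.closure (({A, B, C, E} : Set E3) - {A, B, C, E}) := fun s hs =>
    AddSubgroup.subset_closure (Set.sub_mem_sub hs (by simp))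
  refine latticeGeneratedBy_eq (by simp) ?_
    (intSpan_le (hs B (by simp)) (hs C (by simp)) (hs E (by simp)))
  rintro s (rfl | rfl | rfl | rfl)
  · rw [sub_self]; exact AddSubgroup.zero_mem _
  · exact ⟨1, 0, 0, by simp⟩
  · exact ⟨0, 1, 0, by simp⟩
  · exact ⟨0, 0, 1, by simp⟩

/-- The vector C − A, absent from the pyramid, is recovered as the lateral edge E − S. -/
lemma latticeGeneratedBy_pyramid {A B C E R S : E3} (hS : S = A + (E - C)) (hR : R = B + (E - C)) :
    latticeGeneratedBy {A, B, R, S, E} = A +ᵥ (intSpan (B - A) (C - A) (E - A) : Set E3) := by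
  have hs : ∀ s ∈ ({A, B, R, S, E} : Set E3), s - A ∈
      AddSubgroup.closure (({A, B, R, S, E} : Set E3) - {A, B, R, S, E}) := fun s hs =>
    AddSubgroup.subset_closure (Set.sub_mem_sub hs (by simp))
  refine latticeGeneratedBy_eq (by simp) ?_
    (intSpan_le (hs B (by simp)) ?_ (hs E (by simp)))
  · rintro s (rfl | rfl | rfl | rfl | rfl)
    · rw [sub_self]; exact AddSubgroup.zero_mem _
    · exact ⟨1, 0, 0, by simp⟩
    · exact ⟨1, -1, 1, by rw [hR]; module⟩
    · exact ⟨0, -1, 1, by rw [hS]; module⟩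
    · exact ⟨0, 0, 1, by simp⟩
  · have h := AddSubgroup.sub_mem _ (hs E (by simp)) (hs S (by simp))
    have e : E - A - (S - A) = C - A := by rw [hS]; abel
    rwa [e] at h

/-- Both A and B lie in the bisecting plane of CE. -/
lemma inner_eq_zero_of_dist_eq {A B C E : E3} (h1 : dist A C = dist A E)
    (h2 : dist B C = dist B E) : inner ℝ (B - A) (E - C) = 0 := by
  rw [dist_eq_norm, dist_eq_norm] at h1 h2
  have h1' : ‖A - C‖ ^ 2 = ‖A - E‖ ^ 2 := by rw [h1]
  have h2' : ‖B - C‖ ^ 2 = ‖B - E‖ ^ 2 := by rw [h2]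
  rw [@norm_sub_sq ℝ, @norm_sub_sq ℝ] at h1' h2'
  simp only [inner_sub_left, inner_sub_right]
  simp only [RCLike.re_to_real] at h1' h2'
  linarith

/-- X and X − (S − A) are mirror images in the plane through A orthogonal to S − A, and B lies in
this plane. -/
lemma dist_eq_of_inner_eq_zero {A B X S : E3} (h : inner ℝ (B - A) (S - A) = 0)
    (h1 : dist X A = dist X S) : dist B (X - (S - A)) = dist X B := by
  have h1' : ‖X - A‖ ^ 2 = ‖X - S‖ ^ 2 := by rw [← dist_eq_norm, h1, dist_eq_norm]
  rw [dist_comm X B, dist_eq_norm, dist_eq_norm]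
  refine (sq_eq_sq₀ (norm_nonneg _) (norm_nonneg _)).1 ?_
  have e1 : X - S = (X - A) - (S - A) := by abel
  have e2 : B - (X - (S - A)) = (B - X) + (S - A) := by abel
  have e3 : B - A = (B - X) + (X - A) := by abel
  rw [e1, norm_sub_sq_real (X - A) (S - A)] at h1'
  rw [e3, inner_add_left] at h
  rw [e2, @norm_add_sq ℝ]
  simp only [RCLike.re_to_real]
  linarith

theorem tetrahedron_iff_pyramid (d : ℝ) (A B : E3) (Λ : Set E3) :
    (∃ C E : E3, IsTetrahedron d A B C E ∧ Λ = latticeGeneratedBy {A, B, C, E}) ↔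
    (∃ R S X : E3, IsRectPyramid d A B R S X ∧ Λ = latticeGeneratedBy {A, B, R, S, X}) := by
  constructor
  · rintro ⟨C, E, ⟨hAB, hAC, hAE, hBC, hBE, hCE⟩, rfl⟩
    -- With E as apex, two lateral edges are edges of the tetrahedron and the other two are
    -- translates of AC and BC.
    refine ⟨B + (E - C), A + (E - C), E, ⟨by abel, ?_, hAB, ?_, ?_, ?_, ?_, ?_⟩, ?_⟩
    · rw [add_sub_cancel_left]
      exact inner_eq_zero_of_dist_eq (hAC.trans hAE.symm) (hBC.trans hBE.symm)
    · rw [dist_self_add_right, ← dist_eq_norm, dist_comm, hCE]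
    · rw [dist_comm, hAE]
    · rw [dist_comm, hBE]
    · rw [dist_eq_norm, show E - (B + (E - C)) = C - B by abel, ← dist_eq_norm, dist_comm, hBC]
    · rw [dist_eq_norm, show E - (A + (E - C)) = C - A by abel, ← dist_eq_norm, dist_comm, hAC]
    · rw [latticeGeneratedBy_tetrahedron, latticeGeneratedBy_pyramid rfl rfl]
  · rintro ⟨R, S, X, ⟨hR, hort, hAB, hBR, hXA, hXB, hXR, hXS⟩, rfl⟩
    have hSA : dist S A = 2 := by rw [dist_eq_norm, ← hR, ← dist_eq_norm, dist_comm, hBR]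
    refine ⟨X - (S - A), X, ⟨hAB, ?_, ?_, ?_, ?_, ?_⟩, ?_⟩
    · rw [dist_eq_norm, show A - (X - (S - A)) = S - X by abel, ← dist_eq_norm, dist_comm, hXS]
    · rw [dist_comm, hXA]
    · rw [dist_eq_of_inner_eq_zero hort (hXA.trans hXS.symm), hXB]
    · rw [dist_comm, hXB]
    · rw [dist_comm, dist_eq_norm, sub_sub_cancel, ← dist_eq_norm, hSA]
    · rw [latticeGeneratedBy_tetrahedron]
      refine latticeGeneratedBy_pyramid (by abel) ?_
      rw [sub_sub_cancel, ← hR]; abel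

theorem exists_tetrahedron {d : ℝ} (hd : 0 ≤ d) (hd2 : d ^ 2 ≤ 2) :
    ∃ A B C E : E3, IsTetrahedron d A B C E ∧ B - A = (2 * d) • zAxis := by
  have hA : √(3 - d ^ 2) ^ 2 = 3 - d ^ 2 := Real.sq_sqrt (by linarith)
  have key : ∀ {x y : E3} {r : ℝ}, 0 ≤ r →
      Complex.normSq (proj x - proj y) + (x 2 - y 2) ^ 2 = r ^ 2 → dist x y = r := by
    intro x y r hr h
    rwa [← dist_sq_eq, sq_eq_sq₀ dist_nonneg hr] at h
  -- The last two vertices are at mid-height d and 2 apart; their squared distance to the ends of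
  -- the edge is (3 − d²) + 1 + d² = 4.
  refine ⟨0, (2 * d) • zAxis, !₂[√(3 - d ^ 2), 1, d], !₂[√(3 - d ^ 2), -1, d],
    ⟨?_, ?_, ?_, ?_, ?_, ?_⟩, sub_zero _⟩ <;>
  refine key (by positivity) ?_ <;>
  simp [Complex.normSq_apply] <;>
  linarith

/-! ### The densest lattice -/

/-- The vectors from an end of the edge of length `2 * d` parallel to the `z`-axis of a
tetrahedron with five edges of length `2` to the two opposite vertices. -/
structure IsFrame (d : ℝ) (P Q : E3) : Prop where
  height_left : P 2 = d
  height_right : Q 2 = d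
  normSq_left : Complex.normSq (proj P) = 4 - d ^ 2
  normSq_right : Complex.normSq (proj Q) = 4 - d ^ 2
  normSq_sub : Complex.normSq (proj P - proj Q) = 4

lemma proj_smul_zAxis (t : ℝ) : proj (t • zAxis) = 0 := by apply Complex.ext <;> simp

lemma isFrame_of_isTetrahedron {d : ℝ} (hd : 0 < d) {A B C E : E3} (h : IsTetrahedron d A B C E)
    (hAB : B - A = (2 * d) • zAxis) : IsFrame d (C - A) (E - A) := by
  obtain ⟨-, hAC, hAE, hBC, hBE, hCE⟩ := h
  have hB : B = A + (2 * d) • zAxis := by rw [← hAB]; abel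
  have hpB : proj B = proj A := by rw [hB, proj_add, proj_smul_zAxis, add_zero]
  have hB2 : B 2 = A 2 + 2 * d := by rw [hB]; simp
  have key : ∀ {C : E3}, dist A C = 2 → dist B C = 2 →
      (C - A) 2 = d ∧ Complex.normSq (proj (C - A)) = 4 - d ^ 2 := by
    intro C h1 h2
    have k1 := dist_sq_eq A C
    have k2 := dist_sq_eq B C
    rw [h1] at k1
    rw [h2, hpB, hB2] at k2
    have hh : C 2 - A 2 = d := by
      have : d * (C 2 - A 2 - d) = 0 := by linear_combination (k2 - k1) / 4
      rcases mul_eq_zero.1 this with h | h <;> linarith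
    refine ⟨hh, ?_⟩
    rw [proj_sub, ← neg_sub, Complex.normSq_neg]
    rw [← hh]; linarith
  obtain ⟨c1, c2⟩ := key hAC hBC
  obtain ⟨e1, e2⟩ := key hAE hBE
  refine ⟨c1, e1, c2, e2, ?_⟩
  have k := dist_sq_eq C E
  rw [hCE] at k
  simp only [PiLp.sub_apply] at c1 e1
  rw [proj_sub, proj_sub, sub_sub_sub_cancel_right]
  have : C 2 - E 2 = 0 := by linarith
  rw [this] at k
  linarith

namespace IsFrame

variable {d : ℝ} {P Q : E3}

lemma cross_sq (h : IsFrame d P Q) : cross (proj P) (proj Q) ^ 2 = 4 * (3 - d ^ 2) := by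
  have k := four_mul_cross_sq (proj P) (proj Q)
  rw [h.normSq_left, h.normSq_right, h.normSq_sub, heron] at k
  linarith

lemma abs_cross (h : IsFrame d P Q) : |cross (proj P) (proj Q)| = 2 * √(3 - d ^ 2) := by
  rw [← Real.sqrt_sq_eq_abs, h.cross_sq, Real.sqrt_mul (by norm_num),
    show (4 : ℝ) = 2 ^ 2 by norm_num, Real.sqrt_sq (by norm_num)]

lemma cross_ne_zero (h : IsFrame d P Q) (hd2 : d ^ 2 ≤ 2) : cross (proj P) (proj Q) ≠ 0 := by
  intro hc
  have := h.cross_sq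
  rw [hc] at this
  linarith

lemma normSq_comb (h : IsFrame d P Q) (j k : ℝ) :
    Complex.normSq (j * proj P + k * proj Q) =
      (4 - d ^ 2) * (j ^ 2 + k ^ 2) + 2 * (2 - d ^ 2) * (j * k) := by
  have h1 := h.normSq_left
  have h2 := h.normSq_right
  have h3 := h.normSq_sub
  simp only [Complex.normSq_apply, Complex.add_re, Complex.add_im, Complex.sub_re, Complex.sub_im,
    Complex.re_ofReal_mul, Complex.im_ofReal_mul] at h1 h2 h3 ⊢
  linear_combination (j ^ 2 + j * k) * h1 + (k ^ 2 + j * k) * h2 - j * k * h3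

/-- The squared norm is (3 − d²)(j + k)² + (j − k)² + d²(2i + j + k)². If j + k is odd, all three
squares are at least 1. If it is even and j, k are not both 0, the planar part alone is at least
2(j² + k²) ≥ 4. If j = k = 0, then d ≥ 1 suffices. -/
lemma two_le_norm (h : IsFrame d P Q) (hd : 1 ≤ d) (hd2 : d ^ 2 ≤ 2) {x : E3}
    (hx : x ∈ intSpan ((2 * d) • zAxis) P Q) (hx0 : x ≠ 0) : 2 ≤ ‖x‖ := by
  obtain ⟨i, j, k, rfl⟩ := hx
  set x := i • ((2 * d) • zAxis) + j • P + k • Q with hxdef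
  rw [← dist_zero_right, two_le_dist_iff]
  have hp0 : proj (0 : E3) = 0 := by apply Complex.ext <;> simp
  have hz0 : (0 : E3) 2 = 0 := by simp
  rw [hp0, hz0, sub_zero, sub_zero, hxdef, proj_comb, height_comb, h.normSq_comb, h.height_left,
    h.height_right]
  have hd1 : 1 ≤ d ^ 2 := by nlinarith
  by_cases hjk : j = 0 ∧ k = 0
  · obtain ⟨rfl, rfl⟩ := hjk
    have hi : i ≠ 0 := by
      rintro rfl
      apply hx0
      simp [hxdef]
    have hi2 : (1 : ℝ) ≤ (i : ℝ) ^ 2 := by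
      have : 0 < i ^ 2 := by positivity
      have : 1 ≤ i ^ 2 := this
      exact_mod_cast this
    push_cast
    nlinarith
  · have hpos : 1 ≤ j ^ 2 + k ^ 2 := by
      rcases not_and_or.1 hjk with h | h
      · have : 0 < j ^ 2 := by positivity
        nlinarith [sq_nonneg k]
      · have : 0 < k ^ 2 := by positivity
        nlinarith [sq_nonneg j]
    have hsq1 : 0 ≤ ((j : ℝ) + k) ^ 2 := sq_nonneg _
    have hsq2 : 0 ≤ ((j : ℝ) - k) ^ 2 := sq_nonneg _
    rcases Int.even_or_odd (j + k) with he | ho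
    · have h2 : 2 ≤ j ^ 2 + k ^ 2 := by
        obtain ⟨m, hm⟩ := he
        have : (j ^ 2 + k ^ 2) % 2 = 0 := by
          have : j ^ 2 + k ^ 2 = 2 * (2 * m ^ 2 - j * k) := by
            have : k = m + m - j := by omega
            rw [this]; ring
          omega
        omega
      have h2' : (2 : ℝ) ≤ (j : ℝ) ^ 2 + (k : ℝ) ^ 2 := by exact_mod_cast h2
      nlinarith [sq_nonneg (2 * d * i + j * d + k * d)]
    · have h1' : (1 : ℝ) ≤ (j : ℝ) ^ 2 + (k : ℝ) ^ 2 := by exact_mod_cast hpos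
      have hodd : (1 : ℝ) ≤ (2 * i + j + k : ℝ) ^ 2 := by
        have : 2 * i + j + k ≠ 0 := by
          obtain ⟨m, hm⟩ := ho
          omega
        have : 0 < (2 * i + j + k) ^ 2 := by positivity
        have : 1 ≤ (2 * i + j + k) ^ 2 := this
        exact_mod_cast this
      have hk1 : (1 : ℝ) ≤ ((j : ℝ) + k) ^ 2 := by
        have : j + k ≠ 0 := by
          obtain ⟨m, hm⟩ := ho
          omega
        have : 0 < (j + k) ^ 2 := by positivity
        have : 1 ≤ (j + k) ^ 2 := this
        exact_mod_cast this
      have hk2 : (1 : ℝ) ≤ ((j : ℝ) - k) ^ 2 := by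
        have : j - k ≠ 0 := by
          obtain ⟨m, hm⟩ := ho
          omega
        have : 0 < (j - k) ^ 2 := by positivity
        have : 1 ≤ (j - k) ^ 2 := this
        exact_mod_cast this
      have e1 : (2 * d * i + j * d + k * d) ^ 2 = d ^ 2 * (2 * i + j + k : ℝ) ^ 2 := by ring
      have e2 : (4 - d ^ 2) * ((j : ℝ) ^ 2 + (k : ℝ) ^ 2) + 2 * (2 - d ^ 2) * (j * k) =
        (3 - d ^ 2) * ((j : ℝ) + k) ^ 2 + ((j : ℝ) - k) ^ 2 := by ring
      rw [e1, e2]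
      nlinarith

lemma discreteTopology (h : IsFrame d P Q) (hd : 1 ≤ d) (hd2 : d ^ 2 ≤ 2) :
    DiscreteTopology (intSpan ((2 * d) • zAxis) P Q) := by
  refine DiscreteTopology.of_forall_le_norm (r := 2) (by norm_num) fun x hx => ?_
  exact h.two_le_norm hd hd2 x.2 (fun h0 => hx (Subtype.ext h0))

/-- The vertical period already belongs to the lattice, so passing to the centres only translates by
c. -/
lemma centres_eq (c : ℝ) (A : E3) :
    (A +ᵥ (intSpan ((2 * d) • zAxis) P Q : Set E3)) + stringCentres c d =
      (A + c • zAxis) +ᵥ (intSpan ((2 * d) • zAxis) P Q : Set E3) := by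
  ext x
  rw [mem_centres, Set.mem_vadd_set]
  constructor
  · rintro ⟨_, ⟨_, ⟨i, j, k, rfl⟩, rfl⟩, l, rfl⟩
    refine ⟨_, ⟨i + l, j, k, rfl⟩, ?_⟩
    simp only [vadd_eq_add, ← Int.cast_smul_eq_zsmul ℝ]
    push_cast
    module
  · rintro ⟨g, hg, rfl⟩
    refine ⟨A + g, ⟨g, hg, rfl⟩, 0, ?_⟩
    simp only [vadd_eq_add]
    push_cast
    module

lemma pairwise_vadd (h : IsFrame d P Q) (hd : 1 ≤ d) (hd2 : d ^ 2 ≤ 2) (A : E3) :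
    (A +ᵥ (intSpan ((2 * d) • zAxis) P Q : Set E3)).Pairwise fun x y => 2 ≤ dist x y := by
  rintro _ ⟨g, hg, rfl⟩ _ ⟨g', hg', rfl⟩ hne
  simp only [vadd_eq_add, dist_add_left] at hne ⊢
  rw [dist_eq_norm]
  exact h.two_le_norm hd hd2 (AddSubgroup.sub_mem _ hg hg')
    (fun h0 => hne (by rw [sub_eq_zero.1 h0]))

lemma isLatticePacking (h : IsFrame d P Q) (hd : 1 ≤ d) (hd2 : d ^ 2 ≤ 2) (c : ℝ) (A : E3) :
    IsLatticePacking (ballString c d) (A +ᵥ (intSpan ((2 * d) • zAxis) P Q : Set E3)) := by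
  refine ⟨⟨_, A, h.discreteTopology hd hd2, rfl⟩, isPacking_of_pairwise ?_⟩
  rw [centres_eq]
  exact h.pairwise_vadd hd hd2 _

/-- The lower limit comes from covering space by prisms of volume 4d√(3 − d²), the upper limit from
the bound for all packings. -/
lemma hasDensity (h : IsFrame d P Q) (hd : 1 ≤ d) (hd2 : d ^ 2 ≤ 2) (c : ℝ) (A : E3) :
    HasDensity (⋃₀ translates (ballString c d) (A +ᵥ (intSpan ((2 * d) • zAxis) P Q : Set E3)))
      (ENNReal.ofReal (Real.pi / (3 * d * √(3 - d ^ 2)))) := by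
  have hd0 : 0 < d := by linarith
  have hA0 : 0 < √(3 - d ^ 2) := Real.sqrt_pos.2 (by linarith)
  have hc := h.cross_ne_zero hd2
  obtain ⟨ρ, hρ, hsub⟩ := exists_prism_subset (proj P) (proj Q) d
  have hlow := le_liminf_coveredPortion (V := 2 * d * |cross (proj P) (proj Q)|)
    (U := ⋃₀ translates (ballString c d) (A +ᵥ (intSpan ((2 * d) • zAxis) P Q : Set E3)))
    (by have := abs_pos.2 hc; positivity) hρ
    (h.pairwise_vadd hd hd2 (A + c • zAxis)) (by rw [sUnion_translates, centres_eq]) (hsub hc)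
    (volume_prism hc).le (fun y => by
      obtain ⟨x, hx, hxy⟩ := exists_sub_mem_prism hd0 hc (y - (A + c • zAxis))
      refine ⟨(A + c • zAxis) + x, ⟨x, hx, rfl⟩, ?_⟩
      rwa [← sub_sub])
  have e : 4 * Real.pi / 3 / (2 * d * |cross (proj P) (proj Q)|) =
      Real.pi / (3 * d * √(3 - d ^ 2)) := by
    rw [h.abs_cross]; field_simp; norm_num
  rw [e] at hlow
  have hup := (isStringSet_centres hd (h.isLatticePacking hd hd2 c A).2).upperDensity_le hd hd2
    sUnion_translates.subset
  exact tendsto_of_le_liminf_of_limsup_le hlow hup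

end IsFrame

/-! ### Uniqueness of the densest lattice -/

lemma proj_zero : proj (0 : E3) = 0 := by apply Complex.ext <;> simp

lemma IsFrame.linearIndependent {d : ℝ} {P Q : E3} (h : IsFrame d P Q) (hd2 : d ^ 2 ≤ 2) :
    LinearIndependent ℝ ![zAxis, P, Q] := by
  rw [Fintype.linearIndependent_iff]
  intro g hg
  rw [Fin.sum_univ_three] at hg
  simp only [Matrix.cons_val_zero, Matrix.cons_val_one, Matrix.cons_val] at hg
  have hp : ((g 1 : ℝ) : ℂ) * proj P + ((g 2 : ℝ) : ℂ) * proj Q = 0 := by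
    have := congrArg proj hg
    rw [proj_zero] at this
    rw [← this]
    apply Complex.ext <;> simp
  obtain ⟨h1, h2⟩ := cross_coords (h.cross_ne_zero hd2) (g 1) (g 2)
  rw [hp] at h1 h2
  have g1 : g 1 = 0 := by rw [← h1]; simp [cross]
  have g2 : g 2 = 0 := by rw [← h2]; simp [cross]
  rw [g1, g2] at hg
  have g0 : g 0 = 0 := by
    have := congrArg (fun x : E3 => x 2) hg
    simpa using this
  intro i
  fin_cases i
  · exact g0
  · exact g1
  · exact g2

/-- The right side depends only on d and the coefficients, which is why any two frames are
congruent. -/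
lemma IsFrame.norm_comb_sq {d : ℝ} {P Q : E3} (h : IsFrame d P Q) (i j k : ℝ) :
    ‖i • zAxis + j • P + k • Q‖ ^ 2 =
      (4 - d ^ 2) * (j ^ 2 + k ^ 2) + 2 * (2 - d ^ 2) * (j * k) + (i + j * d + k * d) ^ 2 := by
  rw [← dist_zero_right, dist_sq_eq, proj_zero, sub_zero, ← h.normSq_comb]
  congr 2
  · apply Complex.ext <;> simp
  · simp [h.height_left, h.height_right]

/-- Any two frames are related by a linear isometry that fixes the direction of the strings. -/
lemma IsFrame.exists_linearIsometryEquiv {d : ℝ} {P Q P' Q' : E3} (h : IsFrame d P Q)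
    (h' : IsFrame d P' Q') (hd2 : d ^ 2 ≤ 2) :
    ∃ ψ : E3 ≃ₗᵢ[ℝ] E3, ψ zAxis = zAxis ∧ ψ P = P' ∧ ψ Q = Q' := by
  have hcard : Fintype.card (Fin 3) = Module.finrank ℝ E3 := by simp
  let b := basisOfLinearIndependentOfCardEqFinrank (h.linearIndependent hd2) hcard
  let b' := basisOfLinearIndependentOfCardEqFinrank (h'.linearIndependent hd2) hcard
  let e := b.equiv b' (Equiv.refl _)
  have he : ∀ i, e (![zAxis, P, Q] i) = ![zAxis, P', Q'] i := by
    intro i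
    have := b.equiv_apply i b' (Equiv.refl _)
    simpa [b, b', e] using this
  have e0 : e zAxis = zAxis := he 0
  have e1 : e P = P' := he 1
  have e2 : e Q = Q' := he 2
  refine ⟨⟨e, fun x => ?_⟩, e0, e1, e2⟩
  refine (sq_eq_sq₀ (norm_nonneg _) (norm_nonneg _)).1 ?_
  have hx := b.sum_repr x
  rw [Fin.sum_univ_three] at hx
  simp only [b, coe_basisOfLinearIndependentOfCardEqFinrank, Matrix.cons_val_zero,
    Matrix.cons_val_one, Matrix.cons_val] at hx
  rw [← hx, map_add, map_add, map_smul, map_smul, map_smul, e0, e1, e2, h.norm_comb_sq,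
    h'.norm_comb_sq]

lemma IsFrame.exists_affineIsometryEquiv {d : ℝ} {P Q P' Q' : E3} (h : IsFrame d P Q)
    (h' : IsFrame d P' Q') (hd2 : d ^ 2 ≤ 2) (A A' : E3) :
    ∃ φ : E3 ≃ᵃⁱ[ℝ] E3, φ.linearIsometryEquiv zAxis = zAxis ∧
      A' +ᵥ (intSpan ((2 * d) • zAxis) P' Q' : Set E3) =
        φ '' (A +ᵥ (intSpan ((2 * d) • zAxis) P Q : Set E3)) := by
  obtain ⟨ψ, h0, h1, h2⟩ := h.exists_linearIsometryEquiv h' hd2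
  refine ⟨AffineIsometryEquiv.mk' (fun x => ψ (x - A) + A') ψ A (fun x => by simp),
    by rw [AffineIsometryEquiv.linearIsometryEquiv_mk']; exact h0, ?_⟩
  have hψ : ∀ i j k : ℤ, ψ (i • ((2 * d) • zAxis) + j • P + k • Q) =
      i • ((2 * d) • zAxis) + j • P' + k • Q' := by
    intro i j k
    simp only [map_add, map_zsmul, map_smul, h0, h1, h2]
  ext x
  simp only [Set.mem_vadd_set, Set.mem_image, vadd_eq_add, AffineIsometryEquiv.coe_mk']
  constructor
  · rintro ⟨_, ⟨i, j, k, rfl⟩, rfl⟩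
    refine ⟨_, ⟨_, ⟨i, j, k, rfl⟩, rfl⟩, ?_⟩
    rw [add_sub_cancel_left, hψ, add_comm]
  · rintro ⟨_, ⟨_, ⟨i, j, k, rfl⟩, rfl⟩, rfl⟩
    refine ⟨_, ⟨i, j, k, rfl⟩, ?_⟩
    rw [add_sub_cancel_left, hψ, add_comm]

/-! ### Groups of centres that attain the bound -/

section Subgroup

variable {d : ℝ} {H : AddSubgroup E3}

lemma eq_zsmul_of_proj_eq_zero (hH : IsStringSet d (H : Set E3)) (hd : 0 < d) (hd2 : d ^ 2 ≤ 2)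
    {x : E3} (hx : x ∈ H) (h : proj x = 0) : ∃ k : ℤ, x = k • ((2 * d) • zAxis) := by
  obtain ⟨k, hk⟩ := hH.exists_of_proj_eq hd hd2 H.zero_mem hx (proj_zero.trans h.symm)
  refine ⟨k, ext_proj ?_ ?_⟩
  · rw [h, ← Int.cast_smul_eq_zsmul ℝ, smul_smul, proj_smul_zAxis]
  · rw [hk, ← Int.cast_smul_eq_zsmul ℝ]; simp; ring

lemma two_le_normSq_proj (hH : IsStringSet d (H : Set E3)) (hd : 0 < d) (hd2 : d ^ 2 ≤ 2)
    {x : E3} (hx : x ∈ H) (h : proj x ≠ 0) : 2 ≤ Complex.normSq (proj x) := by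
  have := hH.le_normSq' hd hx H.zero_mem (by rwa [proj_zero])
  rw [proj_zero, sub_zero] at this
  linarith

lemma smul_zAxis_mem (hH : IsStringSet d (H : Set E3)) : (2 * d) • zAxis ∈ H := by
  have := hH.periodic 0 H.zero_mem 1
  simpa using this

lemma dot_comb (p q : ℂ) (s t : ℝ) : Complex.normSq ((s : ℂ) * p + t * q) =
    s ^ 2 * Complex.normSq p + t ^ 2 * Complex.normSq q +
      s * t * (Complex.normSq p + Complex.normSq q - Complex.normSq (p - q)) := by
  simp only [Complex.normSq_apply, Complex.add_re, Complex.add_im, Complex.sub_re, Complex.sub_im,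
    Complex.re_ofReal_mul, Complex.im_ofReal_mul]
  ring

/-- If all strings through the points of a lattice lie in one plane, then the lattice is not the
densest one. -/
lemma upperDensity_lt_of_cross_eq_zero (hH : IsStringSet d (H : Set E3)) (hd : 1 ≤ d)
    (hd2 : d ^ 2 ≤ 2) {e : ℂ} (he : e ≠ 0) (hcr : ∀ x ∈ H, cross e (proj x) = 0) {x₀ : E3}
    {U : Set E3} (hU : U ⊆ ⋃ x ∈ x₀ +ᵥ (H : Set E3), Metric.closedBall x 1) :
    upperDensity U < ENNReal.ofReal (Real.pi / (3 * d * √(3 - d ^ 2))) := by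
  have hd0 : 0 < d := by linarith
  set a := √(3 - d ^ 2) with ha
  have ha0 : 0 < a := Real.sqrt_pos.2 (by linarith)
  have hn : 0 < Complex.normSq e := Complex.normSq_pos.2 he
  set r := (√(Complex.normSq e))⁻¹ with hr
  have hr0 : 0 < r := inv_pos.2 (Real.sqrt_pos.2 hn)
  have hr2 : r ^ 2 * Complex.normSq e = 1 := by
    rw [hr, inv_pow, Real.sq_sqrt hn.le, inv_mul_cancel₀ hn.ne']
  set u : ℂ := (r : ℂ) * e with hu
  have hu1 : Complex.normSq u = 1 := by
    rw [hu, Complex.normSq_mul, Complex.normSq_ofReal, ← sq, hr2]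
  -- Across the line the prism may be arbitrarily wide without overlaps; any width beyond 2a makes
  -- the density bound strict.
  set v : ℂ := ((2 * a + 1 : ℝ) : ℂ) * (Complex.I * u) with hv
  have hc : cross u v = 2 * a + 1 := by
    have : cross u v = (2 * a + 1) * Complex.normSq u := by
      simp only [hv, cross, Complex.re_ofReal_mul, Complex.im_ofReal_mul, Complex.normSq_apply,
        Complex.I_mul_re, Complex.I_mul_im]
      ring
    rw [this, hu1, mul_one]
  have hc0 : cross u v ≠ 0 := by rw [hc]; positivity
  have hcu : ∀ x ∈ H, cross u (proj x) = 0 := by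
    intro x hx
    have : cross u (proj x) = r * cross e (proj x) := by
      simp only [hu, cross, Complex.re_ofReal_mul, Complex.im_ofReal_mul]
      ring
    rw [this, hcr x hx, mul_zero]
  refine (upperDensity_le_of_prism hd0 hc0 hU ?_).trans_lt ?_
  · rintro _ ⟨g, hg, rfl⟩ _ ⟨g', hg', rfl⟩ y ⟨⟨h1, -⟩, h2⟩ ⟨⟨h3, -⟩, h4⟩
    simp only [vadd_eq_add] at h1 h2 h3 h4 ⊢
    set w := g' - g with hw
    have hwH : w ∈ H := H.sub_mem hg' hg
    have hyw : y - (x₀ + g) = y - (x₀ + g') + w := by rw [hw]; abel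
    rw [hyw] at h1 h2
    set y' := y - (x₀ + g') with hy'
    have hpw : proj w = ((cross (proj w) v / cross u v : ℝ) : ℂ) * u := by
      have := eq_of_cross (z := proj w) hc0
      rwa [hcu w hwH, zero_div, Complex.ofReal_zero, zero_mul, add_zero] at this
    have hadd : cross (proj (y' + w)) v / cross u v =
        cross (proj y') v / cross u v + cross (proj w) v / cross u v := by
      rw [proj_add, ← add_div]
      congr 1
      simp only [cross, Complex.add_re, Complex.add_im]; ring
    rw [hadd] at h1
    set t := cross (proj w) v / cross u v
    have ht : t ^ 2 < 1 := by
      have t1 : t < 1 := by linarith [h1.2, h3.1]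
      have t2 : -1 < t := by linarith [h1.1, h3.2]
      nlinarith
    have hw0 : proj w = 0 := by
      by_contra hne
      have := two_le_normSq_proj hH hd0 hd2 hwH hne
      rw [hpw, Complex.normSq_mul, Complex.normSq_ofReal, hu1] at this
      nlinarith
    obtain ⟨k, hk⟩ := eq_zsmul_of_proj_eq_zero hH hd0 hd2 hwH hw0
    have hw2 : w 2 = 2 * d * k := by rw [hk, ← Int.cast_smul_eq_zsmul ℝ]; simp; ring
    rw [PiLp.add_apply, hw2] at h2
    have hk0 : k = 0 := by
      have u1 : (k : ℝ) < 1 := by nlinarith [h2.2, h4.1]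
      have u2 : (-1 : ℝ) < k := by nlinarith [h2.1, h4.2]
      have v1 : k < 1 := by exact_mod_cast u1
      have v2 : -1 < k := by exact_mod_cast u2
      omega
    rw [hk0, zero_smul, hw] at hk
    rw [sub_eq_zero.1 hk]
  · rw [ENNReal.ofReal_lt_ofReal_iff (by positivity), hc, abs_of_pos (by positivity), div_div,
      div_lt_div_iff₀ (by positivity) (by positivity)]
    have : 0 < Real.pi * d := by positivity
    nlinarith

lemma exists_min_normSq (hH : IsStringSet d (H : Set E3)) (hd : 0 < d) (hd2 : d ^ 2 ≤ 2)
    {S : Set E3} (hS : S ⊆ H) (hne : S.Nonempty) :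
    ∃ x ∈ S, ∀ y ∈ S, Complex.normSq (proj x) ≤ Complex.normSq (proj y) := by
  obtain ⟨s, hs⟩ := hne
  have hsep : (proj '' S).Pairwise fun x y => 1 ≤ dist x y := by
    rintro _ ⟨x, hx, rfl⟩ _ ⟨y, hy, rfl⟩ hxy
    have := two_le_normSq_proj hH hd hd2 (H.sub_mem (hS hx) (hS hy))
      (by rw [proj_sub]; exact sub_ne_zero.2 hxy)
    rw [proj_sub, normSq_eq_sq, ← dist_eq_norm] at this
    nlinarith [dist_nonneg (x := proj x) (y := proj y)]
  have hfin := finite_inter_of_pairwise_le_dist one_pos hsep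
    (Metric.isBounded_closedBall (x := (0 : ℂ)) (r := ‖proj s‖))
  obtain ⟨_, ⟨-, x, hx, rfl⟩, hmin⟩ := Set.exists_min_image _ Complex.normSq hfin
    ⟨proj s, by simp, s, hs, rfl⟩
  refine ⟨x, hx, fun y hy => ?_⟩
  by_cases hy1 : ‖proj y‖ ≤ ‖proj s‖
  · exact hmin _ ⟨by simpa using hy1, y, hy, rfl⟩
  · refine (hmin (proj s) ⟨by simp, s, hs, rfl⟩).trans ?_
    rw [normSq_eq_sq, normSq_eq_sq]
    exact pow_le_pow_left₀ (norm_nonneg _) (not_le.1 hy1).le 2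

/-- A subgroup whose projection is not contained in a line has a basis that projects to two sides
of a non-obtuse triangle. -/
lemma exists_reduced_basis (hH : IsStringSet d (H : Set E3)) (hd : 0 < d) (hd2 : d ^ 2 ≤ 2)
    (hnd : ∀ e : ℂ, e ≠ 0 → ∃ x ∈ H, cross e (proj x) ≠ 0) :
    ∃ P ∈ H, ∃ Q ∈ H, cross (proj P) (proj Q) ≠ 0 ∧ H ≤ intSpan ((2 * d) • zAxis) P Q ∧
      Complex.normSq (proj P) ≤ Complex.normSq (proj Q) ∧
      Complex.normSq (proj Q) ≤ Complex.normSq (proj P - proj Q) ∧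
      Complex.normSq (proj P - proj Q) ≤ Complex.normSq (proj P) + Complex.normSq (proj Q) := by
  have hne : {x | x ∈ H ∧ proj x ≠ 0}.Nonempty := by
    obtain ⟨x, hx, hx1⟩ := hnd 1 one_ne_zero
    exact ⟨x, hx, fun h => hx1 (by rw [h]; simp [cross])⟩
  -- Gauss reduction: a shortest nonzero projection, then a shortest one independent of it, with the
  -- sign chosen to avoid an obtuse angle.
  obtain ⟨P, ⟨hP, hP0⟩, hPmin⟩ := exists_min_normSq hH hd hd2 (fun x hx => hx.1) hne
  have hne2 : {x | x ∈ H ∧ cross (proj P) (proj x) ≠ 0}.Nonempty := hnd _ hP0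
  obtain ⟨Q₁, ⟨hQ₁, hQ₁c⟩, hQ₁min⟩ := exists_min_normSq hH hd hd2 (fun x hx => hx.1) hne2
  have key : ∃ Q ∈ H, cross (proj P) (proj Q) ≠ 0 ∧
      Complex.normSq (proj Q) = Complex.normSq (proj Q₁) ∧
      Complex.normSq (proj P - proj Q) ≤ Complex.normSq (proj P) + Complex.normSq (proj Q) := by
    by_cases hdot : Complex.normSq (proj P - proj Q₁) ≤
        Complex.normSq (proj P) + Complex.normSq (proj Q₁)
    · exact ⟨Q₁, hQ₁, hQ₁c, rfl, hdot⟩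
    · have hneg : proj (-Q₁) = -proj Q₁ := by apply Complex.ext <;> simp
      refine ⟨-Q₁, H.neg_mem hQ₁, ?_, ?_, ?_⟩
      · rw [hneg]
        intro h0
        apply hQ₁c
        simp only [cross, Complex.neg_re, Complex.neg_im] at h0 ⊢
        linarith
      · rw [hneg, Complex.normSq_neg]
      · rw [hneg, Complex.normSq_neg]
        push Not at hdot
        simp only [Complex.normSq_apply, Complex.sub_re, Complex.sub_im, Complex.neg_re,
          Complex.neg_im] at hdot ⊢
        linarith
  obtain ⟨Q, hQ, hQc, hQn, hQd⟩ := key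
  have hQmin : ∀ x ∈ H, cross (proj P) (proj x) ≠ 0 →
      Complex.normSq (proj Q) ≤ Complex.normSq (proj x) := fun x hx hxc => by
    rw [hQn]; exact hQ₁min x ⟨hx, hxc⟩
  have hPQ : Complex.normSq (proj P) ≤ Complex.normSq (proj Q) :=
    hPmin Q ⟨hQ, fun h => hQc (by rw [h]; simp [cross])⟩
  have hQPQ : Complex.normSq (proj Q) ≤ Complex.normSq (proj P - proj Q) := by
    rw [← proj_sub]
    refine hQmin _ (H.sub_mem hP hQ) ?_
    intro h0
    apply hQc
    rw [proj_sub] at h0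
    simp only [cross, Complex.sub_re, Complex.sub_im] at h0 ⊢
    linarith
  refine ⟨P, hP, Q, hQ, hQc, fun x hx => ?_, hPQ, hQPQ, hQd⟩
  have hPpos : 0 < Complex.normSq (proj P) := Complex.normSq_pos.2 hP0
  set s := cross (proj x) (proj Q) / cross (proj P) (proj Q) with hs
  set t := cross (proj P) (proj x) / cross (proj P) (proj Q) with ht
  have hst : proj x = (s : ℂ) * proj P + t * proj Q := eq_of_cross hQc
  set x' := x - (round s • P + round t • Q) with hx'
  have hx'H : x' ∈ H := H.sub_mem hx (H.add_mem (H.zsmul_mem hP _) (H.zsmul_mem hQ _))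
  have hpx' : proj x' = ((s - round s : ℝ) : ℂ) * proj P + ((t - round t : ℝ) : ℂ) * proj Q := by
    have e : proj (round s • P + round t • Q) =
        ((round s : ℝ) : ℂ) * proj P + ((round t : ℝ) : ℂ) * proj Q := by
      apply Complex.ext <;> simp [← Int.cast_smul_eq_zsmul ℝ]
    rw [hx', proj_sub, e, hst]
    push_cast; ring
  have hs' : |s - round s| ≤ 1 / 2 := abs_sub_round s
  have ht' : |t - round t| ≤ 1 / 2 := abs_sub_round t
  set σ := s - round s
  set τ := t - round t
  have hσ2 : σ ^ 2 ≤ 1 / 4 := by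
    rw [← sq_abs]; nlinarith [abs_nonneg σ]
  have hτ2 : τ ^ 2 ≤ 1 / 4 := by
    rw [← sq_abs]; nlinarith [abs_nonneg τ]
  -- With |σ|, |τ| ≤ 1/2 and the inner product reduced, the squared length of the remainder is at
  -- most 3/4 of that of Q, so it is parallel to P by minimality of Q. Then it is at most half as
  -- long as P, hence 0.
  have hx'0 : proj x' = 0 := by
    have hc : cross (proj P) (proj x') = 0 := by
      by_contra hne
      have h1 := hQmin x' hx'H hne
      rw [hpx', dot_comb] at h1
      have hστ : σ * τ ≤ 1 / 4 := by nlinarith [sq_nonneg (σ - τ)]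
      set D := Complex.normSq (proj P) + Complex.normSq (proj Q) - Complex.normSq (proj P - proj Q)
      have hD0 : 0 ≤ D := by simp only [D]; linarith
      have hD1 : D ≤ Complex.normSq (proj P) := by simp only [D]; linarith
      have m1 := mul_le_mul_of_nonneg_right hστ hD0
      have m2 := mul_le_mul_of_nonneg_right hσ2 hPpos.le
      have m3 := mul_le_mul_of_nonneg_right hτ2 (hPpos.le.trans hPQ)
      linarith
    have hτ0 : τ = 0 := by
      have := (cross_coords hQc σ τ).2
      rw [← this, ← hpx', hc, zero_div]
    by_contra hne
    have h1 := hPmin x' ⟨hx'H, hne⟩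
    rw [hpx', dot_comb, hτ0] at h1
    nlinarith
  obtain ⟨k, hk⟩ := eq_zsmul_of_proj_eq_zero hH hd hd2 hx'H hx'0
  refine ⟨k, round s, round t, ?_⟩
  rw [← hk, hx']; abel

/-- Heights congruent to ±d modulo 2d become equal to d when multiples of the vertical period are
subtracted, which changes neither projections nor span. -/
lemma exists_frame_of_offsets (hz : (2 * d) • zAxis ∈ H) {P Q : E3} (hP : P ∈ H) (hQ : Q ∈ H)
    (hspan : H ≤ intSpan ((2 * d) • zAxis) P Q) {k l : ℤ} (hk : (P 2 - 2 * d * k) ^ 2 = d ^ 2)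
    (hl : (Q 2 - 2 * d * l) ^ 2 = d ^ 2) (hPn : Complex.normSq (proj P) = 4 - d ^ 2)
    (hQn : Complex.normSq (proj Q) = 4 - d ^ 2) (hPQ : Complex.normSq (proj P - proj Q) = 4) :
    ∃ P' Q', IsFrame d P' Q' ∧ H = intSpan ((2 * d) • zAxis) P' Q' := by
  have shift : ∀ {R : E3} {k : ℤ}, (R 2 - 2 * d * k) ^ 2 = d ^ 2 → ∃ m : ℤ, R 2 = d + 2 * d * m := by
    intro R k h
    rcases sq_eq_sq_iff_eq_or_eq_neg.1 h with h | h
    · exact ⟨k, by linarith⟩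
    · exact ⟨k - 1, by push_cast; linarith⟩
  obtain ⟨m, hm⟩ := shift hk
  obtain ⟨n, hn⟩ := shift hl
  have hproj : ∀ (R : E3) (m : ℤ), proj (R - m • ((2 * d) • zAxis)) = proj R := by
    intro R m
    rw [proj_sub, ← Int.cast_smul_eq_zsmul ℝ, smul_smul, proj_smul_zAxis, sub_zero]
  have hht : ∀ (R : E3) (m : ℤ), (R - m • ((2 * d) • zAxis)) 2 = R 2 - 2 * d * m := by
    intro R m
    rw [← Int.cast_smul_eq_zsmul ℝ]; simp; ring
  refine ⟨P - m • ((2 * d) • zAxis), Q - n • ((2 * d) • zAxis), ⟨?_, ?_, ?_, ?_, ?_⟩, ?_⟩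
  · rw [hht]; linarith
  · rw [hht]; linarith
  · rw [hproj, hPn]
  · rw [hproj, hQn]
  · rw [hproj, hproj, hPQ]
  · refine le_antisymm (hspan.trans (intSpan_le ?_ ?_ ?_)) (intSpan_le hz ?_ ?_)
    · exact ⟨1, 0, 0, by simp⟩
    · exact ⟨m, 1, 0, by module⟩
    · exact ⟨n, 0, 1, by module⟩
    · exact H.sub_mem hP (H.zsmul_mem hz m)
    · exact H.sub_mem hQ (H.zsmul_mem hz n)

/-- The prisms over a reduced basis do not overlap, so attaining the density forces |cross| ≤ 2√(3 −
d²), the equality case of `heron_le` for the triangle 0, P, Q. -/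
lemma exists_frame_of_le_upperDensity (hH : IsStringSet d (H : Set E3)) (hd : 1 ≤ d)
    (hd2 : d ^ 2 ≤ 2) {x₀ : E3} {U : Set E3}
    (hU : U ⊆ ⋃ x ∈ x₀ +ᵥ (H : Set E3), Metric.closedBall x 1)
    (hden : ENNReal.ofReal (Real.pi / (3 * d * √(3 - d ^ 2))) ≤ upperDensity U) :
    ∃ P Q, IsFrame d P Q ∧ H = intSpan ((2 * d) • zAxis) P Q := by
  have hd0 : 0 < d := by linarith
  have hz := smul_zAxis_mem hH
  obtain ⟨P, hP, Q, hQ, hc, hspan, h1, h2, h3⟩ := exists_reduced_basis hH hd0 hd2 (by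
    intro e he
    by_contra! hcr
    exact (upperDensity_lt_of_cross_eq_zero hH hd hd2 he hcr hU).not_ge hden)
  set a := √(3 - d ^ 2) with ha
  have ha0 : 0 < a := Real.sqrt_pos.2 (by linarith)
  have ha2 : a ^ 2 = 3 - d ^ 2 := Real.sq_sqrt (by linarith)
  have hcpos : 0 < |cross (proj P) (proj Q)| := abs_pos.2 hc
  have hca : |cross (proj P) (proj Q)| ≤ 2 * a := by
    have hle := hden.trans (upperDensity_le_of_prism hd0 hc hU (by
      rintro _ ⟨g, hg, rfl⟩ _ ⟨g', hg', rfl⟩ y hy hy'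
      refine eq_of_sub_mem_prism hd0 hc ?_ hy hy'
      simp only [vadd_eq_add, add_sub_add_left_eq_sub]
      exact hspan (H.sub_mem hg' hg)))
    rw [ENNReal.ofReal_le_ofReal_iff (by positivity), div_div,
      div_le_div_iff₀ (by positivity) (by positivity)] at hle
    have hpd : 0 < Real.pi * d := by positivity
    have hle' : (Real.pi * d) * |cross (proj P) (proj Q)| ≤ (Real.pi * d) * (2 * a) := by
      linarith
    exact le_of_mul_le_mul_left hle' hpd
  have hher : heron (Complex.normSq (proj P)) (Complex.normSq (proj Q))
      (Complex.normSq (proj P - proj Q)) ≤ 16 * (3 - d ^ 2) := by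
    rw [← four_mul_cross_sq, ← sq_abs, ← ha2]
    nlinarith
  have hP0 : proj P ≠ 0 := fun h => hc (by rw [h]; simp [cross])
  have hQ0 : proj Q ≠ 0 := fun h => hc (by rw [h]; simp [cross])
  have hPQ : proj P ≠ proj Q := fun h => hc (by rw [h]; simp only [cross]; ring)
  have hp0 : proj (0 : E3) = 0 := proj_zero
  have n1 : Complex.normSq (proj (0 : E3) - proj P) = Complex.normSq (proj P) := by
    rw [hp0, zero_sub, Complex.normSq_neg]
  have n2 : Complex.normSq (proj Q - proj (0 : E3)) = Complex.normSq (proj Q) := by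
    rw [hp0, sub_zero]
  obtain ⟨k₁, k₂, k₃, -, hcases⟩ := hH.heron_le hd0 hd2 H.zero_mem hP hQ
    (by rw [hp0]; exact hP0.symm) hPQ (by rw [hp0]; exact hQ0)
    (by rw [n1, n2]; linarith [Complex.normSq_nonneg (proj P - proj Q)])
    (by rw [n1, n2]; linarith) (by rw [n1, n2]; linarith [Complex.normSq_nonneg (proj P)])
  have hz2 : (0 : E3) 2 = 0 := by simp
  have hneg : ∀ R : E3, proj (-R) = -proj R := fun R => by apply Complex.ext <;> simp
  rw [n1, n2, hz2] at hcases
  -- The frame issues from the vertex opposite the side of length 2: from Q, from the origin and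
  -- from P, respectively.
  rcases hcases (by simp only [heron] at hher ⊢; linarith) with
    ⟨-, e2, e3, q1, q2, q3⟩ | ⟨-, e3, e1, q2, q3, q1⟩ | ⟨-, e1, e2, q3, q1, q2⟩
  · refine exists_frame_of_offsets hz (P := -Q) (Q := P - Q) (k := -k₃) (l := k₂) (H.neg_mem hQ)
      (H.sub_mem hP hQ) (hspan.trans (intSpan_le ⟨1, 0, 0, by simp⟩ ⟨0, -1, 1, by module⟩
      ⟨0, -1, 0, by simp⟩)) ?_ ?_ ?_ ?_ ?_
    · rw [← e3]; simp; ring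
    · rw [← e2]; simp
    · rw [hneg, Complex.normSq_neg, q3]
    · rw [proj_sub, q2]
    · rw [hneg, proj_sub, ← q1, ← Complex.normSq_neg (proj P)]; congr 1; ring
  · refine exists_frame_of_offsets hz (P := P) (Q := Q) (k := -k₁) (l := k₃) hP hQ hspan
      ?_ ?_ q1 q3 q2
    · rw [← e1]; push_cast; ring
    · rw [← e3]; ring
  · refine exists_frame_of_offsets hz (P := -P) (Q := Q - P) (k := k₁) (l := -k₂) (H.neg_mem hP)
      (H.sub_mem hQ hP) (hspan.trans (intSpan_le ⟨1, 0, 0, by simp⟩ ⟨0, -1, 0, by simp⟩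
      ⟨0, -1, 1, by module⟩)) ?_ ?_ ?_ ?_ ?_
    · rw [← e1]; simp
    · rw [← e2]; simp; ring
    · rw [hneg, Complex.normSq_neg, q1]
    · rw [proj_sub, ← neg_sub, Complex.normSq_neg, q2]
    · rw [hneg, proj_sub, ← q3, ← Complex.normSq_neg (proj Q)]; congr 1; ring

end Subgroup

/-- A densest lattice packing of strings has its centres in a translate of a lattice spanned by a
frame. -/
theorem exists_frame_of_isLatticePacking {c d : ℝ} (hd : 1 ≤ d) (hd2 : d ^ 2 ≤ 2) {Λ : Set E3}
    (hΛ : IsLatticePacking (ballString c d) Λ)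
    (hden : ENNReal.ofReal (Real.pi / (3 * d * √(3 - d ^ 2))) ≤
      upperDensity (⋃₀ translates (ballString c d) Λ)) :
    ∃ P Q x₀ : E3, IsFrame d P Q ∧
      Λ + stringCentres c d = x₀ +ᵥ (intSpan ((2 * d) • zAxis) P Q : Set E3) := by
  obtain ⟨⟨G, a, -, rfl⟩, hpack⟩ := hΛ
  -- G itself need not contain the vertical period; the ball centres form a coset of the group
  -- generated by both.
  set H := G ⊔ AddSubgroup.zmultiples ((2 * d) • zAxis) with hHdef
  have hX : (a +ᵥ (G : Set E3)) + stringCentres c d = (a + c • zAxis) +ᵥ (H : Set E3) := by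
    ext x
    rw [mem_centres, Set.mem_vadd_set]
    constructor
    · rintro ⟨_, ⟨g, hg, rfl⟩, k, rfl⟩
      refine ⟨g + k • ((2 * d) • zAxis), AddSubgroup.add_mem_sup hg
        (AddSubgroup.zsmul_mem_zmultiples _ _), ?_⟩
      simp only [vadd_eq_add, ← Int.cast_smul_eq_zsmul ℝ]
      module
    · rintro ⟨h, hh, rfl⟩
      obtain ⟨g, hg, _, ⟨k, rfl⟩, rfl⟩ := AddSubgroup.mem_sup.1 hh
      refine ⟨_, ⟨g, hg, rfl⟩, k, ?_⟩
      simp only [vadd_eq_add, ← Int.cast_smul_eq_zsmul ℝ]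
      module
  have hstr := isStringSet_centres hd hpack
  have hU := (sUnion_translates (c := c) (d := d) (T := a +ᵥ (G : Set E3))).subset
  rw [hX] at hstr hU
  have hH : IsStringSet d (H : Set E3) := by
    constructor
    · intro x hx y hy hxy
      have := hstr.pairwise (Set.vadd_mem_vadd_set (a := a + c • zAxis) hx)
        (Set.vadd_mem_vadd_set (a := a + c • zAxis) hy) (by simpa using hxy)
      simpa using this
    · intro x hx k
      obtain ⟨y, hy, he⟩ := hstr.periodic _ (Set.vadd_mem_vadd_set (a := a + c • zAxis) hx) k
      simp only [vadd_eq_add, add_assoc, add_right_inj] at he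
      rwa [← he]
  obtain ⟨P, Q, hPQ, hspan⟩ := exists_frame_of_le_upperDensity hH hd hd2 hU hden
  exact ⟨P, Q, a + c • zAxis, hPQ, by rw [hX, hspan]⟩

end StringPacking

theorem theorem2p1 (c d : ℝ) (hd₁ : 1 ≤ d) (hd₂ : d ≤ √2) :
    -- every packing of translates of the string has at most the asserted density
    (∀ T : Set E3, IsPacking (translates (ballString c d) T) →
      upperDensity (⋃₀ translates (ballString c d) T)
        ≤ ENNReal.ofReal (Real.pi / (3 * d * √(3 - d ^ 2)))) ∧
    -- there is a tetrahedron as described, with its edge of length `2d` parallel to the `z`-axis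
    (∃ A B C E : E3, IsTetrahedron d A B C E ∧ B - A = (2 * d) • zAxis) ∧
    (∀ A B C E : E3, IsTetrahedron d A B C E → B - A = (2 * d) • zAxis →
      -- its vertices generate a lattice packing of translates of the string
      IsLatticePacking (ballString c d) (latticeGeneratedBy {A, B, C, E}) ∧
      -- this packing attains the bound
      HasDensity (⋃₀ translates (ballString c d) (latticeGeneratedBy {A, B, C, E}))
        (ENNReal.ofReal (Real.pi / (3 * d * √(3 - d ^ 2)))) ∧
      -- any lattice packing attaining the bound has, up to an isometry preserving the direction
      -- of the strings, the same lattice of ball centres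
      (∀ Λ : Set E3, IsLatticePacking (ballString c d) Λ →
        upperDensity (⋃₀ translates (ballString c d) Λ)
          = ENNReal.ofReal (Real.pi / (3 * d * √(3 - d ^ 2))) →
        ∃ φ : E3 ≃ᵃⁱ[ℝ] E3, φ.linearIsometryEquiv zAxis = zAxis ∧
          Λ + stringCentres c d = φ '' latticeGeneratedBy {A, B, C, E})) ∧
    -- the lattices so generated are those generated by the vertices of the rectangular pyramids
    (∀ (A B : E3) (Λ : Set E3),
      (∃ C E : E3, IsTetrahedron d A B C E ∧ Λ = latticeGeneratedBy {A, B, C, E}) ↔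
      (∃ R S X : E3, IsRectPyramid d A B R S X ∧ Λ = latticeGeneratedBy {A, B, R, S, X})) := by
  have hd2 : d ^ 2 ≤ 2 := by
    have := pow_le_pow_left₀ (by linarith) hd₂ 2
    rwa [Real.sq_sqrt (by norm_num)] at this
  have hd0 : 0 < d := by linarith
  refine ⟨fun T hT => (StringPacking.isStringSet_centres hd₁ hT).upperDensity_le hd₁ hd2
      StringPacking.sUnion_translates.subset, StringPacking.exists_tetrahedron hd0.le hd2,
    fun A B C E hT hAB => ?_, StringPacking.tetrahedron_iff_pyramid d⟩
  have hF := StringPacking.isFrame_of_isTetrahedron hd0 hT hAB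
  rw [StringPacking.latticeGeneratedBy_tetrahedron, hAB]
  refine ⟨hF.isLatticePacking hd₁ hd2 c A, hF.hasDensity hd₁ hd2 c A, fun Λ hΛ hden => ?_⟩
  obtain ⟨P, Q, x₀, hPQ, hX⟩ :=
    StringPacking.exists_frame_of_isLatticePacking hd₁ hd2 hΛ hden.ge
  rw [hX]
  exact hF.exists_affineIsometryEquiv hPQ hd2 A x₀
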